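/- **Setting.** Let $\mathcal X$ be a unitary fusion category (a rigid semisimple $\mathbb C$-linear monoidal category with finite dimensional hom spaces, finitely many simple objects up to isomorphism and simple unit, with a compatible positive $C^*$-dagger structure $\dagger$ for which $\otimes$ is a dagger functor with unitary coherence isomorphisms), equipped with its canonical unitary spherical structure, and let $\operatorname{Irr}(\mathcal X)$ be a set of representatives of the simple objects. Tensor signs and associators are suppressed. $Z(\mathcal X)$ is the unitary Drinfeld center: pairs $(X,\sigma_X)$ with a unitary half-braiding $\sigma_{X,U}: X\otimes U\to U\otimes X$. Let $\mathcal A\subset Z(\mathcal X)$ be a full braided unitary tensor subcategory (closed under unit, tensor products, duals, finite direct sums and direct summands), and write $\Phi:\mathcal A\to\mathcal X$ for the forgetful functor. **Tube algebra.** $\operatorname{Tube}(\mathcal X)=\bigoplus_{v,x,y\in\operatorname{Irr}(\mathcal X)}\mathcal X(vx\to yv)$. For an object $V$ and $\varphi\in\mathcal X(Vx\to yV)$ with $x,y\in \operatorname{Irr}(\mathcal X)$ put $[\varphi]=\sum_{w\in\operatorname{Irr}(\mathcal X)}\sum_{\beta}(\mathrm{id}_y\otimes\beta)\,\varphi\,(\beta^\dagger\otimes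 \mathrm{id}_x)$, where $\beta$ runs over an orthonormal basis of $\mathcal X(V\to w)$ for the isometry inner product $\langle f|g\rangle\mathrm{id}_w=g f^\dagger$. The product of $\phi\in\mathcal X(uy'\to zu)$ and $\psi\in\mathcal X(vx\to yv)$ is $\phi\cdot\psi=\delta_{y=y'}[(\phi\otimes \mathrm{id}_v)(\mathrm{id}_u\otimes\psi)]$, the unit is $\sum_{x}[\mathrm{id}_x]$ (with $V=1$), and the adjoint $\psi^*$ is $[\psi']$, where $\psi'\in\mathcal X(\bar v y\to x\bar v)$ is the rotation of $\psi^\dagger$. **Representations.** For $(X,\sigma_X)\in Z(\mathcal X)$ let $H_X=\bigoplus_{y\in\operatorname{Irr}(\mathcal X)}\mathcal X(X\to y)$ with the trace inner product $\langle n|m\rangle=\operatorname{tr}_X(n^\dagger m)$. Then $\phi\in\mathcal X(vy\to zv)$ acts on $m\in\mathcal X(X\to y)$ by closing up the strand $v$: $$\phi\rhd m:\ X\to Xv\bar v\xrightarrow{\sigma_{X,v}\otimes \mathrm{id}_{\bar v}}vX\bar v\xrightarrow{\mathrm{id}_v\otimes m\otimes \mathrm{id}_{\bar v}}vy\bar v\xrightarrow{\phi\otimes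 \mathrm{id}_{\bar v}}zv\bar v\to z,$$ and the other components of $\operatorname{Tube}(\mathcal X)$ act on $m$ by $0$. **Dome algebra.** $\operatorname{Dome}^{\mathcal A}(\mathcal X)=\operatorname{Tube}(\mathcal X)/\mathcal J^{\mathcal A}$, where $\mathcal J^{\mathcal A}$ is the $*$-ideal generated by the elements $[\varphi]-[\varphi^\circ]$ for $a\in\mathcal A$, $x,y\in\operatorname{Irr}(\mathcal X)$, $\varphi\in\mathcal X(\Phi(a)x\to y\Phi(a))$, where (with $V=1$ in $[\varphi^\circ]$) $$\varphi^\circ:\ x\to x\,\Phi(a)\,\overline{\Phi(a)}\xrightarrow{\sigma_{a,x}^{-1}\otimes \mathrm{id}}\Phi(a)\,x\,\overline{\Phi(a)}\xrightarrow{\varphi\otimes \mathrm{id}}y\,\Phi(a)\,\overline{\Phi(a)}\to y .$$ **Theorem.** For every $(X,\sigma_X)\in Z(\mathcal X)$ the following are equivalent. 1. $(X,\sigma_X)\in Z^{\mathcal A}(\mathcal X)$, the Müger centralizer of $\mathcal A$ in $Z(\mathcal X)$: for all $a\in\mathcal A$ the double braiding of $X$ with $a$ is the identity. 2. For all $a\in\mathcal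 A$, $\sigma_{X,\Phi(a)}=\sigma_{a,X}^{-1}$ in $\mathcal X(X\Phi(a)\to\Phi(a)X)$. 3. For all $a\in\mathcal A$ the crossings $\sigma_{X,\Phi(a)}$ and $\sigma_{a,X}^{-1}$ have the same matrix units: for all $x,y,z\in\operatorname{Irr}(\mathcal X)$, $m\in\mathcal X(X\to y)$, $n\in\mathcal X(X\to z)$, $f\in\mathcal X(\Phi(a)y\to x)$, $g\in\mathcal X(z\Phi(a)\to x)$, $$f(\mathrm{id}\otimes m)\,\sigma_{X,\Phi(a)}\,(n^\dagger\otimes \mathrm{id})g^\dagger=f(\mathrm{id}\otimes m)\,\sigma_{a,X}^{-1}\,(n^\dagger\otimes \mathrm{id})g^\dagger\quad\text{in }\mathcal X(x\to x).$$ 4. The representation of $\operatorname{Tube}(\mathcal X)$ on $H_X$ descends to a $*$-representation of $\operatorname{Dome}^{\mathcal A}(\mathcal X)$. Consequently, with $\mathsf{Rep}$ the category of finite dimensional $*$-representations on Hilbert spaces and intertwiners: $(X,\sigma_X)\mapsto H_X$, acting on morphisms by precomposition, is an equivalence $Z^{\mathcal A}(\mathcal X)^{\mathrm{op}}\simeq\mathsf{Rep}(\operatorname{Dome}^{\mathcal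 A}(\mathcal X))$, and there is a (covariant) $\mathbb C$-linear, dagger-preserving equivalence $Z^{\mathcal A}(\mathcal X)\simeq\mathsf{Rep}(\operatorname{Dome}^{\mathcal A}(\mathcal X))$. -/

import Mathlib

open CategoryTheory MonoidalCategory Limits
open scoped ComplexConjugate

universe v u

/-! ## Unitary fusion categories -/

/-- A unitary fusion category: a `ℂ`-linear abelian rigid monoidal category which is semisimple,
has finite dimensional hom spaces and simple unit (finiteness of the set of simple objects is
recorded by `SimpleReps` below), together with a positive dagger structure `dag` for which the
tensor product is a dagger functor and the associators and unitors are unitary. -/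
class UnitaryFusionCategory (C : Type u) [Category.{v} C] [Abelian C] [Linear ℂ C]
    [MonoidalCategory C] [MonoidalPreadditive C] [MonoidalLinear ℂ C] [RigidCategory C] where
  finiteDimensional : ∀ X Y : C, FiniteDimensional ℂ (X ⟶ Y)
  simple_unit : Simple (𝟙_ C)
  semisimple : ∀ X : C, ∃ (n : ℕ) (w : Fin n → C) (b : Bicone w),
    (∀ i, Simple (w i)) ∧ Nonempty b.IsBilimit ∧ Nonempty (X ≅ b.pt)
  /-- The dagger (adjoint) of a morphism. -/
  dag : ∀ {X Y : C}, (X ⟶ Y) → (Y ⟶ X)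
  dag_dag : ∀ {X Y : C} (f : X ⟶ Y), dag (dag f) = f
  dag_id : ∀ X : C, dag (𝟙 X) = 𝟙 X
  dag_comp : ∀ {X Y Z : C} (f : X ⟶ Y) (g : Y ⟶ Z), dag (f ≫ g) = dag g ≫ dag f
  dag_add : ∀ {X Y : C} (f g : X ⟶ Y), dag (f + g) = dag f + dag g
  dag_smul : ∀ {X Y : C} (c : ℂ) (f : X ⟶ Y), dag (c • f) = conj c • dag f
  /-- The C*-condition, part one: the dagger is proper. -/
  eq_zero_of_comp_dag : ∀ {X Y : C} (f : X ⟶ Y), f ≫ dag f = 0 → f = 0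
  /-- The C*-condition, part two: `f ≫ dag f` is a positive element of the algebra `X ⟶ X`. -/
  comp_dag_pos : ∀ {X Y : C} (f : X ⟶ Y), ∃ g : X ⟶ X, f ≫ dag f = g ≫ dag g
  dag_whiskerLeft : ∀ (X : C) {Y Z : C} (f : Y ⟶ Z), dag (X ◁ f) = X ◁ dag f
  dag_whiskerRight : ∀ {Y Z : C} (f : Y ⟶ Z) (X : C), dag (f ▷ X) = dag f ▷ X
  dag_associator : ∀ X Y Z : C, dag (α_ X Y Z).hom = (α_ X Y Z).inv
  dag_leftUnitor : ∀ X : C, dag (λ_ X).hom = (λ_ X).inv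
  dag_rightUnitor : ∀ X : C, dag (ρ_ X).hom = (ρ_ X).inv

namespace DomeAlg

noncomputable section

section Basic

variable {C : Type u} [Category.{v} C] [Abelian C] [Linear ℂ C] [MonoidalCategory C]
  [MonoidalPreadditive C] [MonoidalLinear ℂ C] [RigidCategory C] [UnitaryFusionCategory C]

/-- The dagger of a morphism. -/
abbrev dag {X Y : C} (f : X ⟶ Y) : Y ⟶ X := UnitaryFusionCategory.dag f

instance instFiniteDimensionalHom (X Y : C) : FiniteDimensional ℂ (X ⟶ Y) :=
  UnitaryFusionCategory.finiteDimensional X Y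

instance instSimpleUnit : Simple (𝟙_ C) := UnitaryFusionCategory.simple_unit

theorem dag_dag {X Y : C} (f : X ⟶ Y) : dag (dag f) = f := UnitaryFusionCategory.dag_dag f

theorem dag_comp {X Y Z : C} (f : X ⟶ Y) (g : Y ⟶ Z) : dag (f ≫ g) = dag g ≫ dag f :=
  UnitaryFusionCategory.dag_comp f g

theorem dag_add {X Y : C} (f g : X ⟶ Y) : dag (f + g) = dag f + dag g :=
  UnitaryFusionCategory.dag_add f g

theorem dag_smul {X Y : C} (c : ℂ) (f : X ⟶ Y) : dag (c • f) = conj c • dag f :=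
  UnitaryFusionCategory.dag_smul c f

theorem dag_id (X : C) : dag (𝟙 X) = 𝟙 X := UnitaryFusionCategory.dag_id X

theorem dag_zero (X Y : C) : dag (0 : X ⟶ Y) = 0 := by
  have h := dag_smul (0 : ℂ) (0 : X ⟶ Y)
  simpa using h

theorem exists_scalar {w : C} [Simple w] (f : w ⟶ w) : ∃ c : ℂ, c • 𝟙 w = f :=
  endomorphism_simple_eq_smul_id ℂ f

/-- The scalar `c` with `f = c • 𝟙 w`, for an endomorphism `f` of a simple object `w`. -/
def scalar {w : C} [Simple w] (f : w ⟶ w) : ℂ := (exists_scalar f).choose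

theorem scalar_smul_id {w : C} [Simple w] (f : w ⟶ w) : scalar f • 𝟙 w = f :=
  (exists_scalar f).choose_spec

theorem scalar_unique {w : C} [Simple w] {f : w ⟶ w} {c : ℂ} (h : f = c • 𝟙 w) :
    scalar f = c := by
  have h1 : (scalar f - c) • 𝟙 w = 0 := by rw [sub_smul, scalar_smul_id, h, sub_self]
  rcases smul_eq_zero.1 h1 with h2 | h2
  · exact sub_eq_zero.1 h2
  · exact absurd h2 (id_nonzero w)

theorem scalar_add {w : C} [Simple w] (f g : w ⟶ w) : scalar (f + g) = scalar f + scalar g :=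
  scalar_unique (by rw [add_smul, scalar_smul_id, scalar_smul_id])

theorem scalar_smul {w : C} [Simple w] (c : ℂ) (f : w ⟶ w) : scalar (c • f) = c * scalar f :=
  scalar_unique (by rw [mul_smul, scalar_smul_id])

theorem scalar_dag {w : C} [Simple w] (f : w ⟶ w) : scalar (dag f) = conj (scalar f) :=
  scalar_unique (by
    conv_lhs => rw [← scalar_smul_id f]
    rw [dag_smul, dag_id])

theorem scalar_zero {w : C} [Simple w] : scalar (0 : w ⟶ w) = 0 :=
  scalar_unique (by rw [zero_smul])

/-- `f ≫ dag f` is a nonnegative real multiple of the identity of a simple source. -/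
theorem scalar_comp_dag {w Y : C} [Simple w] (f : w ⟶ Y) :
    ∃ r : ℝ, 0 ≤ r ∧ scalar (f ≫ dag f) = r := by
  obtain ⟨g, hg⟩ := UnitaryFusionCategory.comp_dag_pos f
  refine ⟨Complex.normSq (scalar g), Complex.normSq_nonneg _, ?_⟩
  apply scalar_unique
  change f ≫ UnitaryFusionCategory.dag f = _
  rw [hg]
  conv_lhs => rw [← scalar_smul_id g]
  change (scalar g • 𝟙 w) ≫ dag (scalar g • 𝟙 w) = _
  rw [dag_smul, dag_id, Linear.smul_comp, Category.id_comp, smul_smul, Complex.mul_conj]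

theorem eq_zero_of_scalar_comp_dag {w Y : C} [Simple w] (f : w ⟶ Y)
    (h : scalar (f ≫ dag f) = 0) : f = 0 := by
  apply UnitaryFusionCategory.eq_zero_of_comp_dag f
  have := scalar_smul_id (f ≫ dag f)
  rw [h, zero_smul] at this
  exact this.symm

/-! ## Isometry inner product and orthonormal bases -/

/-- The isometry inner product on `V ⟶ w` for simple `w`: `⟨f | g⟩ • 𝟙 w = dag f ≫ g`. -/
def isometryCore (V w : C) [Simple w] : InnerProductSpace.Core ℂ (V ⟶ w) where
  inner f g := scalar (dag f ≫ g)
  conj_inner_symm f g := by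
    rw [← scalar_dag, dag_comp, dag_dag]
  re_inner_nonneg f := by
    obtain ⟨r, hr, h⟩ := scalar_comp_dag (dag f)
    rw [dag_dag] at h
    change 0 ≤ (scalar (dag f ≫ f)).re
    rw [h]
    simpa using hr
  add_left f g h := by rw [dag_add, Preadditive.add_comp, scalar_add]
  smul_left f g c := by rw [dag_smul, Linear.smul_comp, scalar_smul]
  definite f h := by
    have h' : dag f = 0 := eq_zero_of_scalar_comp_dag (dag f) (by rw [dag_dag]; exact h)
    rw [← dag_dag f, h', dag_zero]

/-- An orthonormal basis of `V ⟶ w` (`w` simple) for the isometry inner product. -/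
structure HomONB (V w : C) where
  n : ℕ
  b : Fin n → (V ⟶ w)
  orthonormal : ∀ i j, dag (b i) ≫ b j = if i = j then 𝟙 w else 0
  span : Submodule.span ℂ (Set.range b) = ⊤

theorem nonempty_homONB (V w : C) [Simple w] : Nonempty (HomONB V w) := by
  let _ : InnerProductSpace.Core ℂ (V ⟶ w) := isometryCore V w
  let _ : NormedAddCommGroup (V ⟶ w) := InnerProductSpace.Core.toNormedAddCommGroup (𝕜 := ℂ)
  let _ : InnerProductSpace ℂ (V ⟶ w) := InnerProductSpace.ofCore _
  let e := stdOrthonormalBasis ℂ (V ⟶ w)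
  refine ⟨⟨_, e, fun i j => ?_, ?_⟩⟩
  · have h : scalar (dag (e i) ≫ e j) = if i = j then 1 else 0 :=
      orthonormal_iff_ite.1 e.orthonormal i j
    rw [← scalar_smul_id (dag (e i) ≫ e j), h]
    split_ifs <;> simp
  · have := e.toBasis.span_eq
    rwa [OrthonormalBasis.coe_toBasis] at this

/-- A chosen orthonormal basis. Every expression below in which it occurs is of the form
`∑ i, b i ⊗ dag (b i)`, so it does not depend on the choice. -/
def homONB (V w : C) [Simple w] : HomONB V w := Classical.choice (nonempty_homONB V w)

/-! ## Duals in the canonical unitary spherical structure -/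

/-- A dual of `V` in the canonical unitary spherical structure (a standard solution of the
conjugate equations): the cups `R : 1 ⟶ V̄ ⊗ V` and `Rbar : 1 ⟶ V ⊗ V̄`, with caps `dag R` and
`dag Rbar`, satisfy the zig-zag equations, and the left and right traces they define agree. -/
structure StandardDual (V : C) where
  bar : C
  R : 𝟙_ C ⟶ bar ⊗ V
  Rbar : 𝟙_ C ⟶ V ⊗ bar
  zigzag : Rbar ▷ V ≫ (α_ V bar V).hom ≫ V ◁ dag R = (λ_ V).hom ≫ (ρ_ V).inv
  zigzag_bar : bar ◁ Rbar ≫ (α_ bar V bar).inv ≫ dag R ▷ bar = (ρ_ bar).hom ≫ (λ_ bar).inv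
  spherical : ∀ f : V ⟶ V, R ≫ bar ◁ f ≫ dag R = Rbar ≫ f ▷ bar ≫ dag Rbar

theorem StandardDual.Rbar_ne_zero {V : C} [Simple V] (D : StandardDual V) : D.Rbar ≠ 0 := by
  intro h
  have hz := D.zigzag
  rw [h, MonoidalPreadditive.zero_whiskerRight, zero_comp] at hz
  apply id_nonzero V
  have : (λ_ V).inv ≫ ((λ_ V).hom ≫ (ρ_ V).inv) ≫ (ρ_ V).hom = 𝟙 V := by simp
  rw [← this, ← hz]
  simp

theorem pos_of_ne_zero {w Y : C} [Simple w] (f : w ⟶ Y) (hf : f ≠ 0) :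
    ∃ r : ℝ, 0 < r ∧ f ≫ dag f = (r : ℂ) • 𝟙 w := by
  obtain ⟨r, hr, h⟩ := scalar_comp_dag f
  refine ⟨r, lt_of_le_of_ne hr ?_, ?_⟩
  · rintro rfl
    exact hf (eq_zero_of_scalar_comp_dag f (by simpa using h))
  · rw [← h, scalar_smul_id]

/-- Every simple object has a dual in the canonical unitary spherical structure. -/
theorem nonempty_standardDual (V : C) [Simple V] : Nonempty (StandardDual V) := by
  let W : C := Vᘁ
  let η : 𝟙_ C ⟶ V ⊗ W := η_ V W
  let ε : W ⊗ V ⟶ 𝟙_ C := ε_ V W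
  have h1 : η ▷ V ≫ (α_ V W V).hom ≫ V ◁ ε = (λ_ V).hom ≫ (ρ_ V).inv :=
    ExactPairing.evaluation_coevaluation V W
  have h2 : W ◁ η ≫ (α_ W V W).inv ≫ ε ▷ W = (ρ_ W).hom ≫ (λ_ W).inv :=
    ExactPairing.coevaluation_evaluation V W
  have hid : (λ_ V).inv ≫ ((λ_ V).hom ≫ (ρ_ V).inv) ≫ (ρ_ V).hom = 𝟙 V := by simp
  have hη : η ≠ 0 := by
    intro h
    rw [h, MonoidalPreadditive.zero_whiskerRight, zero_comp] at h1
    exact id_nonzero V (by rw [← hid, ← h1]; simp)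
  have hε : dag ε ≠ 0 := by
    intro h
    have h' : ε = 0 := by rw [← dag_dag ε, h, dag_zero]
    rw [h', MonoidalPreadditive.whiskerLeft_zero, comp_zero, comp_zero] at h1
    exact id_nonzero V (by rw [← hid, ← h1]; simp)
  obtain ⟨p, hp, hp'⟩ := pos_of_ne_zero η hη
  obtain ⟨q, hq, hq'⟩ := pos_of_ne_zero (dag ε) hε
  rw [dag_dag] at hq'
  let l : ℝ := Real.sqrt (Real.sqrt (q / p))
  have hl : 0 < l := Real.sqrt_pos.2 (Real.sqrt_pos.2 (div_pos hq hp))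
  have hl4 : l * l * (l * l) = q / p := by
    have a : l * l = Real.sqrt (q / p) := Real.mul_self_sqrt (Real.sqrt_nonneg _)
    rw [a]
    exact Real.mul_self_sqrt (div_pos hq hp).le
  have hlc : (l : ℂ) ≠ 0 := by exact_mod_cast hl.ne'
  have hR : dag (((l⁻¹ : ℝ) : ℂ) • dag ε) = ((l⁻¹ : ℝ) : ℂ) • ε := by
    rw [dag_smul, Complex.conj_ofReal, dag_dag]
  have hB : dag ((l : ℂ) • η) = (l : ℂ) • dag η := by
    rw [dag_smul, Complex.conj_ofReal]
  refine ⟨⟨W, ((l⁻¹ : ℝ) : ℂ) • dag ε, (l : ℂ) • η, ?_, ?_, ?_⟩⟩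
  · rw [hR, MonoidalLinear.smul_whiskerRight, MonoidalLinear.whiskerLeft_smul,
      Linear.comp_smul, Linear.comp_smul, Linear.smul_comp, smul_smul, h1]
    rw [Complex.ofReal_inv, inv_mul_cancel₀ hlc, one_smul]
  · rw [hR, MonoidalLinear.smul_whiskerRight, MonoidalLinear.whiskerLeft_smul,
      Linear.comp_smul, Linear.comp_smul, Linear.smul_comp, smul_smul, h2]
    rw [Complex.ofReal_inv, inv_mul_cancel₀ hlc, one_smul]
  · intro f
    rw [hR, hB]
    obtain ⟨c, rfl⟩ := exists_scalar f
    simp only [MonoidalLinear.smul_whiskerRight, MonoidalLinear.whiskerLeft_smul,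
      Linear.comp_smul, Linear.smul_comp, whiskerLeft_id, id_whiskerRight, Category.id_comp,
      hp', hq', smul_smul]
    congr 1
    have : q = l * l * (l * l) * p := by rw [hl4]; field_simp
    rw [this]
    push_cast
    field_simp

/-- The chosen dual of a simple object (unique up to unique unitary isomorphism). -/
def stdDual (V : C) [Simple V] : StandardDual V := Classical.choice (nonempty_standardDual V)

/-- The quantum dimension of a simple object. -/
def qdim (V : C) [Simple V] : ℝ :=
  (scalar ((stdDual V).Rbar ≫ dag (stdDual V).Rbar)).re

theorem qdim_pos (V : C) [Simple V] : 0 < qdim V := by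
  obtain ⟨r, hr, h⟩ := pos_of_ne_zero _ (stdDual V).Rbar_ne_zero
  rw [qdim, scalar_unique h]
  simpa using hr

end Basic

/-! ## The tube algebra -/

/-- A set of representatives of the (finitely many) isomorphism classes of simple objects. -/
structure SimpleReps (C : Type u) [Category.{v} C] [HasZeroMorphisms C] (ι : Type) where
  obj : ι → C
  simple : ∀ i, Simple (obj i)
  eq_of_iso : ∀ i j, Nonempty (obj i ≅ obj j) → i = j
  exists_iso : ∀ w : C, Simple w → ∃ i, Nonempty (w ≅ obj i)

section Tube

variable {C : Type u} [Category.{v} C] [Abelian C] [Linear ℂ C] [MonoidalCategory C]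
  [MonoidalPreadditive C] [MonoidalLinear ℂ C] [RigidCategory C] [UnitaryFusionCategory C]
  {ι : Type} (I : SimpleReps C ι)

instance instSimpleObj (i : ι) : Simple (I.obj i) := I.simple i

/-- The component in `w x ⟶ y w` of the annular diagram of `φ : V x ⟶ y V`: the sum over an
orthonormal basis of `V ⟶ w` (shaded nodes). -/
def fuse {V x y : C} (w : ι) :
    (V ⊗ x ⟶ y ⊗ V) →ₗ[ℂ] (I.obj w ⊗ x ⟶ y ⊗ I.obj w) :=
  ∑ i, (Linear.leftComp ℂ (y ⊗ I.obj w) (dag ((homONB V (I.obj w)).b i) ▷ x)) ∘ₗ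
    (Linear.rightComp ℂ (V ⊗ x) (y ◁ (homONB V (I.obj w)).b i))

/-- Concatenation of `φ : u y ⟶ z u` (above) and `ψ : v x ⟶ y v` (below). -/
def stack {U V x y z : C} :
    (U ⊗ y ⟶ z ⊗ U) →ₗ[ℂ] (V ⊗ x ⟶ y ⊗ V) →ₗ[ℂ] ((U ⊗ V) ⊗ x ⟶ z ⊗ (U ⊗ V)) :=
  LinearMap.mk₂ ℂ
    (fun φ ψ => (α_ U V x).hom ≫ U ◁ ψ ≫ (α_ U y V).inv ≫ φ ▷ V ≫ (α_ z U V).hom)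
    (by intros; simp) (by intros; simp) (by intros; simp) (by intros; simp)

/-- The rotation `v̄ y ⟶ x v̄` of `dag ψ`, for `ψ : v x ⟶ y v`. -/
def rotDag {V x y : C} (D : StandardDual V) (ψ : V ⊗ x ⟶ y ⊗ V) :
    D.bar ⊗ y ⟶ x ⊗ D.bar :=
  D.bar ◁ (ρ_ y).inv ≫ D.bar ◁ (y ◁ D.Rbar) ≫ D.bar ◁ (α_ y V D.bar).inv ≫
    D.bar ◁ (dag ψ ▷ D.bar) ≫ D.bar ◁ (α_ V x D.bar).hom ≫ (α_ D.bar V (x ⊗ D.bar)).inv ≫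
      dag D.R ▷ (x ⊗ D.bar) ≫ (λ_ (x ⊗ D.bar)).hom

/-- The tube algebra `⨁_{v,x,y} (v x ⟶ y v)`; the index `p` is the pair `(x, y)`. -/
def Tube : Type v :=
  ∀ (p : ι × ι) (v : ι), I.obj v ⊗ I.obj p.1 ⟶ I.obj p.2 ⊗ I.obj v

instance : AddCommGroup (Tube I) :=
  inferInstanceAs (AddCommGroup
    (∀ (p : ι × ι) (v : ι), I.obj v ⊗ I.obj p.1 ⟶ I.obj p.2 ⊗ I.obj v))

instance : Module ℂ (Tube I) :=
  inferInstanceAs (Module ℂ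
    (∀ (p : ι × ι) (v : ι), I.obj v ⊗ I.obj p.1 ⟶ I.obj p.2 ⊗ I.obj v))

/-- The element of the tube algebra given by the annular diagram of `φ : V x ⟶ y V`, where
`V` need not be simple; for `V = v` one of the chosen simple objects it is `φ` itself, in
the summand with index `v`. -/
def Tube.of {V : C} (x y : ι) (φ : V ⊗ I.obj x ⟶ I.obj y ⊗ V) : Tube I :=
  open Classical in
  Pi.single (M := fun p : ι × ι => ∀ v : ι, I.obj v ⊗ I.obj p.1 ⟶ I.obj p.2 ⊗ I.obj v)
    (x, y) (fun w => fuse I w φ)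

variable [Fintype ι]

/-- Multiplication. The scalars `√d_w / √(d_u d_v)` that appear when the trivalent nodes are
normalized with respect to the skein module inner product are absorbed by using orthonormal
bases of `u v ⟶ w` with respect to the isometry inner product. -/
instance : Mul (Tube I) where
  mul S T := fun p w => ∑ y, ∑ u, ∑ v, fuse I w (stack (S (y, p.2) u) (T (p.1, y) v))

/-- The unit `∑ x, 𝟙 x`, in the summands with `v = 1`, `x = y`. -/
instance : One (Tube I) where
  one := ∑ x, Tube.of I x x ((λ_ (I.obj x)).hom ≫ (ρ_ (I.obj x)).inv)

/-- The adjoint. The rotation of `dag ψ` is transported to the chosen simple object which is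
isomorphic to the dual of `v`. -/
instance : Star (Tube I) where
  star T := fun p w =>
    ∑ v, fuse I w (rotDag (stdDual (I.obj v)) (T (p.2, p.1) v))

theorem Tube.mul_apply (S T : Tube I) (p : ι × ι) (w : ι) :
    (S * T) p w = ∑ y, ∑ u, ∑ v, fuse I w (stack (S (y, p.2) u) (T (p.1, y) v)) := rfl

theorem Tube.star_apply (T : Tube I) (p : ι × ι) (w : ι) :
    (star T) p w = ∑ v, fuse I w (rotDag (stdDual (I.obj v)) (T (p.2, p.1) v)) := rfl

theorem Tube.sub_apply (S T : Tube I) (p : ι × ι) (w : ι) : (S - T) p w = S p w - T p w := rfl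

theorem Tube.smul_apply (c : ℂ) (T : Tube I) (p : ι × ι) (w : ι) : (c • T) p w = c • T p w := rfl

theorem Tube.mul_sub (S T U : Tube I) : S * (T - U) = S * T - S * U := by
  funext p w
  simp only [Tube.mul_apply, Tube.sub_apply, map_sub, Finset.sum_sub_distrib]

theorem Tube.sub_mul (S T U : Tube I) : (S - T) * U = S * U - T * U := by
  funext p w
  simp only [Tube.mul_apply, Tube.sub_apply, map_sub, LinearMap.sub_apply,
    Finset.sum_sub_distrib]

theorem dag_sub {X Y : C} (f g : X ⟶ Y) : dag (f - g) = dag f - dag g := by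
  have h := dag_add f ((-1 : ℂ) • g)
  rw [dag_smul] at h
  simpa [sub_eq_add_neg] using h

theorem rotDag_sub {V x y : C} (D : StandardDual V) (φ ψ : V ⊗ x ⟶ y ⊗ V) :
    rotDag D (φ - ψ) = rotDag D φ - rotDag D ψ := by
  simp only [rotDag, dag_sub]
  have h : ∀ (a b : y ⊗ V ⟶ V ⊗ x), D.bar ◁ ((a - b) ▷ D.bar) =
      D.bar ◁ (a ▷ D.bar) - D.bar ◁ (b ▷ D.bar) := by
    intro a b
    have h1 : (a - b) ▷ D.bar = a ▷ D.bar - b ▷ D.bar :=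
      ((tensoringRight C).obj D.bar).map_sub
    rw [h1]
    exact ((tensoringLeft C).obj D.bar).map_sub
  simp only [h, Preadditive.comp_sub, Preadditive.sub_comp]

theorem Tube.star_sub (S T : Tube I) : star (S - T) = star S - star T := by
  funext p w
  simp only [Tube.star_apply, Tube.sub_apply, rotDag_sub, map_sub, Finset.sum_sub_distrib]

/-! ## The Drinfeld center -/

/-- The objects of the unitary Drinfeld center: half-braidings all of whose components are
unitary. In `Center C`, the half-braiding `X.2.β U : X ⊗ U ≅ U ⊗ X` is the crossing in
which the strand of `X` passes under that of `U`. -/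
def IsUnitary : ObjectProperty (Center C) :=
  fun X => ∀ U : C, dag (X.2.β U).hom = (X.2.β U).inv

/-- A full (replete) unitary braided tensor subcategory of the unitary Drinfeld center: closed
under the unit, tensor products, duals, finite direct sums and direct summands. -/
structure IsBraidedTensorSubcategory (A : ObjectProperty (Center C)) : Prop where
  unitary : ∀ a, A a → IsUnitary a
  unit : A (𝟙_ (Center C))
  tensor : ∀ a b, A a → A b → A (a ⊗ b)
  dual : ∀ a b : Center C, A a → IsUnitary b → Nonempty (ExactPairing a b) → A b
  summand : ∀ (a b : Center C) (i : b ⟶ a) (p : a ⟶ b), A a → IsUnitary b → i ≫ p = 𝟙 b → A b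
  directSum : ∀ (a b c : Center C) (i : a ⟶ c) (j : b ⟶ c) (p : c ⟶ a) (q : c ⟶ b),
    A a → A b → IsUnitary c → i ≫ p = 𝟙 a → j ≫ q = 𝟙 b →
      p.f ≫ i.f + q.f ≫ j.f = 𝟙 c.1 → A c

/-- The Müger centralizer of `A` in the unitary Drinfeld center. -/
def enrichedCenter (A : ObjectProperty (Center C)) : ObjectProperty (Center C) :=
  fun X => IsUnitary X ∧ ∀ a, A a → (β_ X a).hom ≫ (β_ a X).hom = 𝟙 (X ⊗ a)

/-! ## The representation of the tube algebra attached to an object of the center -/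

/-- Encircle: `x ⟶ x (v v̄) ⟶ (v x) v̄ ⟶ (z v) v̄ ⟶ z`, where `c : x v ⟶ v x` is a crossing. -/
def encircle {V x z : C} (D : StandardDual V) (c : x ⊗ V ⟶ V ⊗ x) (φ : V ⊗ x ⟶ z ⊗ V) :
    x ⟶ z :=
  (ρ_ x).inv ≫ x ◁ D.Rbar ≫ (α_ x V D.bar).inv ≫ c ▷ D.bar ≫ φ ▷ D.bar ≫
    (α_ z V D.bar).hom ≫ z ◁ dag D.Rbar ≫ (ρ_ z).hom

/-- The space `H_X = ⨁_y (X ⟶ y)`. -/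
def HSpace (X : C) : Type v := ∀ y : ι, X ⟶ I.obj y

instance (X : C) : AddCommGroup (HSpace I X) :=
  inferInstanceAs (AddCommGroup (∀ y : ι, X ⟶ I.obj y))

instance (X : C) : Module ℂ (HSpace I X) :=
  inferInstanceAs (Module ℂ (∀ y : ι, X ⟶ I.obj y))

instance (X : C) : FiniteDimensional ℂ (HSpace I X) :=
  inferInstanceAs (FiniteDimensional ℂ (∀ y : ι, X ⟶ I.obj y))

/-- The trace inner product `⟨n | m⟩ = tr_X (n† ∘ m)` on `H_X`: on the summand `X ⟶ y` the
trace is `d_y` times the scalar `m ∘ n† : y ⟶ y`. -/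
def hCore (X : C) : InnerProductSpace.Core ℂ (HSpace I X) where
  inner n m := ∑ y, (qdim (I.obj y) : ℂ) * scalar (dag (n y) ≫ m y)
  conj_inner_symm n m := by
    rw [map_sum]
    refine Finset.sum_congr rfl fun y _ => ?_
    rw [map_mul, Complex.conj_ofReal, ← scalar_dag, dag_comp, dag_dag]
  re_inner_nonneg n := by
    change 0 ≤ (∑ y, (qdim (I.obj y) : ℂ) * scalar (dag (n y) ≫ n y)).re
    rw [Complex.re_sum]
    refine Finset.sum_nonneg fun y _ => ?_
    rw [Complex.re_ofReal_mul]
    exact mul_nonneg (qdim_pos _).le ((isometryCore X (I.obj y)).re_inner_nonneg (n y))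
  add_left n m k := by
    rw [← Finset.sum_add_distrib]
    refine Finset.sum_congr rfl fun y _ => ?_
    change _ * scalar (dag (n y + m y) ≫ k y) = _
    rw [dag_add, Preadditive.add_comp, scalar_add, mul_add]
  smul_left n m c := by
    rw [Finset.mul_sum]
    refine Finset.sum_congr rfl fun y _ => ?_
    change _ * scalar (dag (c • n y) ≫ m y) = _
    rw [dag_smul, Linear.smul_comp, scalar_smul]
    ring
  definite n h := by
    have h0 : ∀ y, 0 ≤ qdim (I.obj y) * (scalar (dag (n y) ≫ n y)).re := fun y =>
      mul_nonneg (qdim_pos _).le ((isometryCore X (I.obj y)).re_inner_nonneg (n y))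
    have h1 : ∑ y, qdim (I.obj y) * (scalar (dag (n y) ≫ n y)).re = 0 := by
      have := congrArg Complex.re h
      rw [Complex.re_sum] at this
      simpa [Complex.re_ofReal_mul] using this
    funext y
    have h2 := (Finset.sum_eq_zero_iff_of_nonneg (fun y _ => h0 y)).1 h1 y (Finset.mem_univ y)
    have h3 : (scalar (dag (n y) ≫ n y)).re = 0 :=
      (mul_eq_zero.1 h2).resolve_left (qdim_pos _).ne'
    obtain ⟨r, -, hr⟩ := scalar_comp_dag (dag (n y))
    rw [dag_dag] at hr
    have h4 : scalar (dag (n y) ≫ n y) = 0 := by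
      rw [hr] at h3 ⊢
      simpa using h3
    exact (isometryCore X (I.obj y)).definite (n y) h4

instance (X : C) : NormedAddCommGroup (HSpace I X) :=
  letI := hCore I X
  InnerProductSpace.Core.toNormedAddCommGroup (𝕜 := ℂ)

instance (X : C) : InnerProductSpace ℂ (HSpace I X) :=
  InnerProductSpace.ofCore (hCore I X).toCore

/-- The action of the tube algebra on `H_X`: `φ ▷ m` is the diagram in which the strand `v`
encircles `m : X ⟶ y` and is crossed by `X` by means of the half-braiding, with `X` under. -/
def tubeAct (X : Center C) (T : Tube I) (m : HSpace I X.1) : HSpace I X.1 :=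
  fun z => ∑ y, ∑ v, encircle (stdDual (I.obj v)) (X.2.β (I.obj v)).hom
    (I.obj v ◁ m y ≫ T (y, z) v)

/-! ## The dome algebra -/

/-- A two-sided ideal closed under the adjoint. -/
structure IsStarIdeal (J : Submodule ℂ (Tube I)) : Prop where
  mul_left : ∀ s t : Tube I, t ∈ J → s * t ∈ J
  mul_right : ∀ s t : Tube I, t ∈ J → t * s ∈ J
  star_mem : ∀ t : Tube I, t ∈ J → star t ∈ J

/-- The generators of the dome ideal, for `a` in `A` and `φ : Φ(a) x ⟶ y Φ(a)`: the annular
diagram of `φ`, minus the diagram `x ⟶ y` in which the strand `Φ(a)` is closed up, passing under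
`x`. The cup and the cap enter through `D.Rbar` and `dag D.Rbar` only, so the latter diagram
does not depend on the dual `D`, which is unique up to unitary isomorphism. -/
def domeRelations (A : ObjectProperty (Center C)) : Set (Tube I) :=
  {t | ∃ (a : Center C) (_ : A a) (D : StandardDual a.1) (x y : ι)
    (φ : a.1 ⊗ I.obj x ⟶ I.obj y ⊗ a.1),
    t = Tube.of I x y φ - Tube.of I x y
      ((λ_ (I.obj x)).hom ≫ encircle D (a.2.β (I.obj x)).inv φ ≫ (ρ_ (I.obj y)).inv)}

/-- The dome ideal: the smallest `*`-ideal of the tube algebra containing the generators. -/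
def domeIdeal (A : ObjectProperty (Center C)) : Submodule ℂ (Tube I) :=
  sInf {J | IsStarIdeal I J ∧ domeRelations I A ⊆ J}

theorem isStarIdeal_domeIdeal (A : ObjectProperty (Center C)) :
    IsStarIdeal I (domeIdeal I A) where
  mul_left s t ht := by
    rw [domeIdeal, Submodule.mem_sInf] at ht ⊢
    exact fun J hJ => hJ.1.mul_left s t (ht J hJ)
  mul_right s t ht := by
    rw [domeIdeal, Submodule.mem_sInf] at ht ⊢
    exact fun J hJ => hJ.1.mul_right s t (ht J hJ)
  star_mem t ht := by
    rw [domeIdeal, Submodule.mem_sInf] at ht ⊢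
    exact fun J hJ => hJ.1.star_mem t (ht J hJ)

/-- The dome algebra: the quotient of the tube algebra by the dome ideal. -/
def Dome (A : ObjectProperty (Center C)) : Type v := Tube I ⧸ domeIdeal I A

instance (A : ObjectProperty (Center C)) : AddCommGroup (Dome I A) :=
  inferInstanceAs (AddCommGroup (Tube I ⧸ domeIdeal I A))

instance (A : ObjectProperty (Center C)) : Module ℂ (Dome I A) :=
  inferInstanceAs (Module ℂ (Tube I ⧸ domeIdeal I A))

/-- The quotient map from the tube algebra to the dome algebra. -/
def Dome.mk (A : ObjectProperty (Center C)) : Tube I →ₗ[ℂ] Dome I A := (domeIdeal I A).mkQ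

instance (A : ObjectProperty (Center C)) : Mul (Dome I A) where
  mul := Quotient.map₂ (· * ·) fun s s' hs t t' ht => by
    have hs' := (Submodule.quotientRel_def _).1 hs
    have ht' := (Submodule.quotientRel_def _).1 ht
    refine (Submodule.quotientRel_def _).2 ?_
    have h : s * t - s' * t' = (s - s') * t + s' * (t - t') := by
      rw [Tube.sub_mul, Tube.mul_sub]; abel
    rw [h]
    exact add_mem ((isStarIdeal_domeIdeal I A).mul_right _ _ hs')
      ((isStarIdeal_domeIdeal I A).mul_left _ _ ht')

instance (A : ObjectProperty (Center C)) : One (Dome I A) where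
  one := Dome.mk I A 1

instance (A : ObjectProperty (Center C)) : Star (Dome I A) where
  star := Quotient.map star fun s s' hs => by
    have hs' := (Submodule.quotientRel_def _).1 hs
    refine (Submodule.quotientRel_def _).2 ?_
    rw [← Tube.star_sub]
    exact (isStarIdeal_domeIdeal I A).star_mem _ hs'

theorem Dome.mk_mul (A : ObjectProperty (Center C)) (s t : Tube I) :
    Dome.mk I A (s * t) = Dome.mk I A s * Dome.mk I A t := rfl

theorem Dome.mk_star (A : ObjectProperty (Center C)) (t : Tube I) :
    Dome.mk I A (star t) = star (Dome.mk I A t) := rfl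

theorem Dome.mk_one (A : ObjectProperty (Center C)) : Dome.mk I A 1 = 1 := rfl

end Tube

/-! ## Categories of representations -/

section Rep

variable {B : Type v} [AddCommGroup B] [Module ℂ B] [Mul B] [One B] [Star B]

/-- A linear map into the endomorphisms of a Hilbert space is a (unital) `*`-representation. -/
structure IsStarRep {H : Type v} [NormedAddCommGroup H] [InnerProductSpace ℂ H]
    (π : B →ₗ[ℂ] (H →ₗ[ℂ] H)) : Prop where
  map_one : π 1 = LinearMap.id
  map_mul : ∀ s t, π (s * t) = π s ∘ₗ π t
  map_star : ∀ t h k, inner ℂ (π (star t) h) k = inner ℂ h (π t k)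

variable (B) in
/-- A finite dimensional `*`-representation of `B`. -/
structure StarRep where
  H : Type v
  [normed : NormedAddCommGroup H]
  [innerProduct : InnerProductSpace ℂ H]
  [finite : FiniteDimensional ℂ H]
  π : B →ₗ[ℂ] (H →ₗ[ℂ] H)
  isStarRep : IsStarRep π

attribute [instance] StarRep.normed StarRep.innerProduct StarRep.finite

/-- Intertwiners. -/
@[ext]
structure StarRep.Hom (V W : StarRep B) where
  lin : V.H →ₗ[ℂ] W.H
  comm : ∀ t h, lin (V.π t h) = W.π t (lin h)

instance : Category (StarRep B) where
  Hom := StarRep.Hom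
  id V := ⟨LinearMap.id, fun _ _ => rfl⟩
  comp f g := ⟨g.lin ∘ₗ f.lin, fun t h => by simp [f.comm, g.comm]⟩

/-- The linear map underlying an intertwiner. -/
def StarRep.toLin {V W : StarRep B} (f : V ⟶ W) : V.H →ₗ[ℂ] W.H := StarRep.Hom.lin f

end Rep

section Main

variable {C : Type u} [Category.{v} C] [Abelian C] [Linear ℂ C] [MonoidalCategory C]
  [MonoidalPreadditive C] [MonoidalLinear ℂ C] [RigidCategory C] [UnitaryFusionCategory C]
  {ι : Type} [Fintype ι] (I : SimpleReps C ι)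

/-- The representation of the tube algebra on `H_X` descends to a `*`-representation of the dome
algebra. -/
def Descends (A : ObjectProperty (Center C)) (X : Center C) : Prop :=
  ∃ π : Dome I A →ₗ[ℂ] (HSpace I X.1 →ₗ[ℂ] HSpace I X.1),
    IsStarRep π ∧ ∀ (t : Tube I) (m : HSpace I X.1), π (Dome.mk I A t) m = tubeAct I X t m

/-- The crossings `σ_{X,Φ(a)}` and `σ_{Φ(a),X}⁻¹` from `X Φ(a)` to `Φ(a) X` have the same matrix
units. -/
def SameMatrixUnits (X a : Center C) : Prop :=
  ∀ (x y z : ι) (m : X.1 ⟶ I.obj y) (n : X.1 ⟶ I.obj z)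
    (f : a.1 ⊗ I.obj y ⟶ I.obj x) (g : I.obj z ⊗ a.1 ⟶ I.obj x),
    dag g ≫ dag n ▷ a.1 ≫ (X.2.β a.1).hom ≫ a.1 ◁ m ≫ f =
      dag g ≫ dag n ▷ a.1 ≫ (a.2.β X.1).inv ≫ a.1 ◁ m ≫ f

/-- `F` is the functor `(X, σ) ↦ H_X` (with the descended action), acting on morphisms by
precomposition. -/
def IsHFunctor (A : ObjectProperty (Center C))
    (F : (enrichedCenter A).FullSubcategoryᵒᵖ ⥤ StarRep (Dome I A)) : Prop :=
  ∃ e : ∀ X : (enrichedCenter A).FullSubcategory,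
      (F.obj (Opposite.op X)).H ≃ₗᵢ[ℂ] HSpace I X.obj.1,
    (∀ (X : (enrichedCenter A).FullSubcategory) (t : Tube I) (h : (F.obj (Opposite.op X)).H),
      e X ((F.obj (Opposite.op X)).π (Dome.mk I A t) h) = tubeAct I X.obj t (e X h)) ∧
    ∀ (X Y : (enrichedCenter A).FullSubcategory) (f : X ⟶ Y) (h : (F.obj (Opposite.op Y)).H)
      (y : ι), (e X (StarRep.toLin (F.map f.op) h)) y = f.hom.f ≫ (e Y h) y

/-- `G` is `ℂ`-linear on morphisms. -/
def IsLinearFunctor {B : Type v} [AddCommGroup B] [Module ℂ B] [Mul B] [One B] [Star B]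
    {P : ObjectProperty (Center C)} (G : P.FullSubcategory ⥤ StarRep B) : Prop :=
  ∀ (X Y : P.FullSubcategory) (f g k : X ⟶ Y) (c : ℂ),
    k.hom.f = f.hom.f + c • g.hom.f →
      StarRep.toLin (G.map k) = StarRep.toLin (G.map f) + c • StarRep.toLin (G.map g)

/-- `G` sends the dagger of a morphism to the Hilbert space adjoint. -/
def IsDaggerFunctor {B : Type v} [AddCommGroup B] [Module ℂ B] [Mul B] [One B] [Star B]
    {P : ObjectProperty (Center C)} (G : P.FullSubcategory ⥤ StarRep B) : Prop :=
  ∀ (X Y : P.FullSubcategory) (f : X ⟶ Y) (g : Y ⟶ X), g.hom.f = dag f.hom.f →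
    ∀ (h : (G.obj X).H) (k : (G.obj Y).H),
      inner ℂ (StarRep.toLin (G.map g) k) h = inner ℂ k (StarRep.toLin (G.map f) h)

end Main

end

end DomeAlg

namespace DomeAlg

noncomputable section

section Diagrams

variable {C : Type u} [Category.{v} C] [Abelian C] [Linear ℂ C] [MonoidalCategory C]
  [MonoidalPreadditive C] [MonoidalLinear ℂ C] [RigidCategory C] [UnitaryFusionCategory C]

theorem dag_whiskerLeft (X : C) {Y Z : C} (f : Y ⟶ Z) : dag (X ◁ f) = X ◁ dag f :=
  UnitaryFusionCategory.dag_whiskerLeft X f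

theorem dag_whiskerRight {Y Z : C} (f : Y ⟶ Z) (X : C) : dag (f ▷ X) = dag f ▷ X :=
  UnitaryFusionCategory.dag_whiskerRight f X

theorem dag_associator_hom (X Y Z : C) : dag (α_ X Y Z).hom = (α_ X Y Z).inv :=
  UnitaryFusionCategory.dag_associator X Y Z

theorem dag_associator_inv (X Y Z : C) : dag (α_ X Y Z).inv = (α_ X Y Z).hom := by
  rw [← dag_associator_hom, dag_dag]

theorem dag_leftUnitor_hom (X : C) : dag (λ_ X).hom = (λ_ X).inv :=
  UnitaryFusionCategory.dag_leftUnitor X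

theorem dag_leftUnitor_inv (X : C) : dag (λ_ X).inv = (λ_ X).hom := by
  rw [← dag_leftUnitor_hom, dag_dag]

theorem dag_rightUnitor_hom (X : C) : dag (ρ_ X).hom = (ρ_ X).inv :=
  UnitaryFusionCategory.dag_rightUnitor X

theorem dag_rightUnitor_inv (X : C) : dag (ρ_ X).inv = (ρ_ X).hom := by
  rw [← dag_rightUnitor_hom, dag_dag]

theorem dag_injective {X Y : C} {f g : X ⟶ Y} (h : dag f = dag g) : f = g := by
  rw [← dag_dag f, h, dag_dag]

namespace StandardDual

variable {U V W : C} (D : StandardDual V)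

theorem zigzag₁ : D.Rbar ▷ V ⊗≫ V ◁ dag D.R = (λ_ V).hom ≫ (ρ_ V).inv := by
  rw [← D.zigzag]; simp [monoidalComp]

theorem zigzag₂ : D.bar ◁ D.Rbar ⊗≫ dag D.R ▷ D.bar = (ρ_ D.bar).hom ≫ (λ_ D.bar).inv := by
  rw [← D.zigzag_bar]; simp [monoidalComp]

theorem zigzag₃ : V ◁ D.R ⊗≫ dag D.Rbar ▷ V = (ρ_ V).hom ≫ (λ_ V).inv := by
  apply dag_injective
  have := D.zigzag
  simp only [monoidalComp, dag_comp, dag_whiskerRight, dag_whiskerLeft, dag_dag,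
    dag_rightUnitor_hom, dag_leftUnitor_inv]
  rw [← this]
  simp [dag_associator_inv]

theorem zigzag₄ : D.R ▷ D.bar ⊗≫ D.bar ◁ dag D.Rbar = (λ_ D.bar).hom ≫ (ρ_ D.bar).inv := by
  apply dag_injective
  have := D.zigzag_bar
  simp only [monoidalComp, dag_comp, dag_whiskerRight, dag_whiskerLeft, dag_dag,
    dag_leftUnitor_hom, dag_rightUnitor_inv]
  rw [← this]
  simp [dag_associator_hom]

/-- The partial trace over the right tensor factor. -/
def ptr {x z : C} (F : x ⊗ V ⟶ z ⊗ V) : x ⟶ z :=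
  (ρ_ x).inv ≫ x ◁ D.Rbar ≫ (α_ x V D.bar).inv ≫ F ▷ D.bar ≫
    (α_ z V D.bar).hom ≫ z ◁ dag D.Rbar ≫ (ρ_ z).hom

theorem encircle_eq_ptr {x z : C} (c : x ⊗ V ⟶ V ⊗ x) (φ : V ⊗ x ⟶ z ⊗ V) :
    encircle D c φ = D.ptr (c ≫ φ) := by
  simp [encircle, ptr]

theorem comp_ptr {x y z : C} (f : x ⟶ y) (F : y ⊗ V ⟶ z ⊗ V) :
    f ≫ D.ptr F = D.ptr (f ▷ V ≫ F) := by
  unfold ptr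
  calc
    _ = 𝟙 _ ⊗≫ (f ▷ 𝟙_ C ≫ y ◁ D.Rbar) ⊗≫ F ▷ D.bar ⊗≫ z ◁ dag D.Rbar ⊗≫ 𝟙 _ := by monoidal
    _ = _ := by rw [← whisker_exchange]; monoidal

theorem ptr_comp {x y z : C} (F : x ⊗ V ⟶ y ⊗ V) (g : y ⟶ z) :
    D.ptr F ≫ g = D.ptr (F ≫ g ▷ V) := by
  unfold ptr
  calc
    _ = 𝟙 _ ⊗≫ x ◁ D.Rbar ⊗≫ F ▷ D.bar ⊗≫ (y ◁ dag D.Rbar ≫ g ▷ 𝟙_ C) ⊗≫ 𝟙 _ := by monoidal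
    _ = _ := by rw [whisker_exchange]; monoidal

theorem dag_ptr {x z : C} (F : x ⊗ V ⟶ z ⊗ V) : dag (D.ptr F) = D.ptr (dag F) := by
  simp [ptr, dag_comp, dag_whiskerLeft, dag_whiskerRight, dag_associator_hom, dag_associator_inv,
    dag_rightUnitor_hom, dag_rightUnitor_inv, dag_dag]

/-- The partial trace as a linear map. -/
def ptrₗ (x z : C) : (x ⊗ V ⟶ z ⊗ V) →ₗ[ℂ] (x ⟶ z) where
  toFun := D.ptr
  map_add' F G := by simp [ptr]
  map_smul' c F := by simp [ptr]

theorem ptr_add {x z : C} (F G : x ⊗ V ⟶ z ⊗ V) : D.ptr (F + G) = D.ptr F + D.ptr G :=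
  (D.ptrₗ x z).map_add F G

theorem ptr_smul {x z : C} (c : ℂ) (F : x ⊗ V ⟶ z ⊗ V) : D.ptr (c • F) = c • D.ptr F :=
  (D.ptrₗ x z).map_smul c F

theorem ptr_zero {x z : C} : D.ptr (0 : x ⊗ V ⟶ z ⊗ V) = 0 := (D.ptrₗ x z).map_zero

theorem ptr_sum {x z : C} {J : Type*} (s : Finset J) (F : J → (x ⊗ V ⟶ z ⊗ V)) :
    D.ptr (∑ j ∈ s, F j) = ∑ j ∈ s, D.ptr (F j) := map_sum (D.ptrₗ x z) F s

/-- Bending the strand `V` at the bottom right up. -/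
def bend {x y : C} (F : x ⊗ V ⟶ y) : x ⟶ y ⊗ D.bar :=
  (ρ_ x).inv ≫ x ◁ D.Rbar ≫ (α_ x V D.bar).inv ≫ F ▷ D.bar

/-- Bending the strand `V̄` at the top right down. -/
def unbend {x y : C} (G : x ⟶ y ⊗ D.bar) : x ⊗ V ⟶ y :=
  G ▷ V ≫ (α_ y D.bar V).hom ≫ y ◁ dag D.R ≫ (ρ_ y).hom

theorem unbend_bend {x y : C} (F : x ⊗ V ⟶ y) : D.unbend (D.bend F) = F := by
  unfold unbend bend
  calc
    _ = 𝟙 _ ⊗≫ x ◁ (D.Rbar ▷ V) ⊗≫ (F ▷ (D.bar ⊗ V) ≫ y ◁ dag D.R) ⊗≫ 𝟙 _ := by monoidal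
    _ = 𝟙 _ ⊗≫ x ◁ (D.Rbar ▷ V ⊗≫ V ◁ dag D.R) ⊗≫ F ⊗≫ 𝟙 _ := by
      rw [← whisker_exchange]; monoidal
    _ = F := by rw [zigzag₁]; monoidal

theorem bend_unbend {x y : C} (G : x ⟶ y ⊗ D.bar) : D.bend (D.unbend G) = G := by
  unfold unbend bend
  calc
    _ = 𝟙 _ ⊗≫ (x ◁ D.Rbar ≫ G ▷ (V ⊗ D.bar)) ⊗≫ y ◁ (dag D.R ▷ D.bar) ⊗≫ 𝟙 _ := by monoidal
    _ = G ⊗≫ y ◁ (D.bar ◁ D.Rbar ⊗≫ dag D.R ▷ D.bar) ⊗≫ 𝟙 _ := by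
      rw [whisker_exchange]; monoidal
    _ = G := by rw [zigzag₂]; monoidal

/-- The map `y ⟶ y V̄ V` given by the cup. -/
def cupR (y : C) : y ⟶ (y ⊗ D.bar) ⊗ V := (ρ_ y).inv ≫ y ◁ D.R ≫ (α_ y D.bar V).inv

theorem ptr_comp_cupR {x y : C} (F : x ⊗ V ⟶ y) : D.ptr (F ≫ D.cupR y) = D.bend F := by
  unfold ptr cupR bend
  calc
    _ = 𝟙 _ ⊗≫ x ◁ D.Rbar ⊗≫ F ▷ D.bar ⊗≫ y ◁ (D.R ▷ D.bar ⊗≫ D.bar ◁ dag D.Rbar) ⊗≫ 𝟙 _ := by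
      monoidal
    _ = _ := by rw [zigzag₄]; monoidal

theorem cupR_comp_ptr {y z : C} (φ : y ⟶ z ⊗ V) :
    D.cupR y ≫ (φ ▷ D.bar ≫ (α_ z V D.bar).hom ≫ z ◁ dag D.Rbar ≫ (ρ_ z).hom) ▷ V = φ := by
  unfold cupR
  calc
    _ = 𝟙 _ ⊗≫ (y ◁ D.R ≫ φ ▷ (D.bar ⊗ V)) ⊗≫ z ◁ (dag D.Rbar ▷ V) ⊗≫ 𝟙 _ := by monoidal
    _ = φ ⊗≫ z ◁ (V ◁ D.R ⊗≫ dag D.Rbar ▷ V) ⊗≫ 𝟙 _ := by rw [whisker_exchange]; monoidal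
    _ = φ := by rw [zigzag₃]; monoidal

theorem eq_of_ptr_comp_eq {x y : C} {F G : x ⊗ V ⟶ y}
    (h : ∀ (z : C) (φ : y ⟶ z ⊗ V), D.ptr (F ≫ φ) = D.ptr (G ≫ φ)) : F = G := by
  have := h _ (D.cupR y)
  rw [ptr_comp_cupR, ptr_comp_cupR] at this
  rw [← D.unbend_bend F, this, unbend_bend]

variable {D} (E : StandardDual W) (D)

/-- The transpose of `b : V ⟶ W` determined by the cups `Rbar`. -/
def rt (b : V ⟶ W) : E.bar ⟶ D.bar :=
  (ρ_ E.bar).inv ≫ E.bar ◁ (D.Rbar ≫ b ▷ D.bar) ≫ (α_ E.bar W D.bar).inv ≫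
    dag E.R ▷ D.bar ≫ (λ_ D.bar).hom

/-- The transpose of `b : V ⟶ W` determined by the cups `R`. -/
def lt (b : V ⟶ W) : E.bar ⟶ D.bar := dag (rt E D (dag b))

theorem Rbar_comp (b : V ⟶ W) : D.Rbar ≫ b ▷ D.bar = E.Rbar ≫ W ◁ rt D E b := by
  unfold rt
  set g := D.Rbar ≫ b ▷ D.bar with hg
  symm
  calc
    _ = 𝟙 _ ⊗≫ (E.Rbar ▷ 𝟙_ C ≫ (W ⊗ E.bar) ◁ g) ⊗≫ W ◁ (dag E.R ▷ D.bar) ⊗≫ 𝟙 _ := by monoidal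
    _ = g ⊗≫ (E.Rbar ▷ W ⊗≫ W ◁ dag E.R) ▷ D.bar ⊗≫ 𝟙 _ := by
      rw [← whisker_exchange]; monoidal
    _ = _ := by rw [zigzag₁]; monoidal

theorem rt_unique {b : V ⟶ W} {s : E.bar ⟶ D.bar}
    (h : D.Rbar ≫ b ▷ D.bar = E.Rbar ≫ W ◁ s) : rt D E b = s := by
  unfold rt
  rw [h]
  calc
    _ = 𝟙 _ ⊗≫ E.bar ◁ E.Rbar ⊗≫ ((E.bar ⊗ W) ◁ s ≫ dag E.R ▷ D.bar) ⊗≫ 𝟙 _ := by monoidal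
    _ = 𝟙 _ ⊗≫ (E.bar ◁ E.Rbar ⊗≫ dag E.R ▷ E.bar) ⊗≫ s ⊗≫ 𝟙 _ := by
      rw [whisker_exchange]; monoidal
    _ = _ := by rw [zigzag₂]; monoidal

theorem rt_surjective (s : E.bar ⟶ D.bar) : ∃ b : V ⟶ W, rt D E b = s := by
  refine ⟨(λ_ V).inv ≫ (E.Rbar ≫ W ◁ s) ▷ V ≫ (α_ W D.bar V).hom ≫ W ◁ dag D.R ≫ (ρ_ W).hom,
    rt_unique D E ?_⟩
  set g := E.Rbar ≫ W ◁ s with hg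
  calc
    _ = 𝟙 _ ⊗≫ (𝟙_ C ◁ D.Rbar ≫ g ▷ (V ⊗ D.bar)) ⊗≫ W ◁ (dag D.R ▷ D.bar) ⊗≫ 𝟙 _ := by monoidal
    _ = g ⊗≫ W ◁ (D.bar ◁ D.Rbar ⊗≫ dag D.R ▷ D.bar) ⊗≫ 𝟙 _ := by
      rw [whisker_exchange]; monoidal
    _ = _ := by rw [zigzag₂]; monoidal

theorem rt_comp (F : StandardDual U) (b : V ⟶ W) (c : W ⟶ U) :
    rt D F (b ≫ c) = rt E F c ≫ rt D E b := by
  apply rt_unique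
  rw [comp_whiskerRight, ← Category.assoc, Rbar_comp D E b, Category.assoc, whisker_exchange,
    ← Category.assoc, Rbar_comp E F c, Category.assoc, MonoidalCategory.whiskerLeft_comp]

theorem rt_id : rt D D (𝟙 V) = 𝟙 D.bar := rt_unique D D (by simp)

theorem rt_add (b c : V ⟶ W) : rt D E (b + c) = rt D E b + rt D E c := by simp [rt]

theorem rt_smul (r : ℂ) (b : V ⟶ W) : rt D E (r • b) = r • rt D E b := by simp [rt]

/-- The transpose as a linear map. -/
def rtₗ : (V ⟶ W) →ₗ[ℂ] (E.bar ⟶ D.bar) where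
  toFun := rt D E
  map_add' := rt_add D E
  map_smul' := rt_smul D E

/-- Sliding a morphism around the cap `dag R`. -/
theorem whiskerLeft_comp_dag_R (b : W ⟶ V) :
    D.bar ◁ b ≫ dag D.R = rt E D b ▷ W ≫ dag E.R := by
  unfold rt
  symm
  calc
    _ = 𝟙 _ ⊗≫ D.bar ◁ E.Rbar ▷ W ⊗≫ D.bar ◁ b ▷ E.bar ▷ W ⊗≫
        (dag D.R ▷ (E.bar ⊗ W) ≫ 𝟙_ C ◁ dag E.R) ⊗≫ 𝟙 _ := by monoidal
    _ = 𝟙 _ ⊗≫ D.bar ◁ E.Rbar ▷ W ⊗≫ D.bar ◁ (b ▷ (E.bar ⊗ W) ≫ V ◁ dag E.R) ⊗≫ 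
        dag D.R ⊗≫ 𝟙 _ := by rw [← whisker_exchange]; monoidal
    _ = 𝟙 _ ⊗≫ D.bar ◁ (E.Rbar ▷ W ⊗≫ W ◁ dag E.R) ⊗≫ D.bar ◁ b ⊗≫ dag D.R ⊗≫ 𝟙 _ := by
      rw [← whisker_exchange]; monoidal
    _ = _ := by rw [zigzag₁]; monoidal

theorem R_comp (b : V ⟶ W) : D.R ≫ D.bar ◁ b = E.R ≫ lt D E b ▷ W := by
  apply dag_injective
  simp only [dag_comp, dag_whiskerLeft, dag_whiskerRight, lt, dag_dag]
  exact whiskerLeft_comp_dag_R D E (dag b)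

end StandardDual

end Diagrams

section Semisimple

variable {C : Type u} [Category.{v} C] [Abelian C] [Linear ℂ C] [MonoidalCategory C]
  [MonoidalPreadditive C] [MonoidalLinear ℂ C] [RigidCategory C] [UnitaryFusionCategory C]

theorem dag_sum {X Y : C} {J : Type*} (s : Finset J) (f : J → (X ⟶ Y)) :
    dag (∑ j ∈ s, f j) = ∑ j ∈ s, dag (f j) :=
  map_sum (AddMonoidHom.mk' (fun g : X ⟶ Y => dag g) dag_add) f s

theorem dag_neg {X Y : C} (f : X ⟶ Y) : dag (-f) = -dag f := by
  simpa [dag_zero] using dag_sub 0 f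

theorem eq_zero_of_comp_dag {X Y : C} {f : X ⟶ Y} (h : f ≫ dag f = 0) : f = 0 :=
  UnitaryFusionCategory.eq_zero_of_comp_dag f h

/-- An orthogonal direct sum decomposition `V = ⨁ w k`. -/
structure OrthoDecomp {K : Type*} [Fintype K] (V : C) (w : K → C) where
  p : ∀ k, V ⟶ w k
  self : ∀ k, dag (p k) ≫ p k = 𝟙 (w k)
  ne : ∀ k l, k ≠ l → dag (p k) ≫ p l = 0
  total : ∑ k, p k ≫ dag (p k) = 𝟙 V

namespace OrthoDecomp

variable {K : Type*} [Fintype K] {V : C} {w : K → C} (P : OrthoDecomp V w)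

attribute [simp] OrthoDecomp.self

@[simp]
theorem self_assoc (k : K) {Y : C} (f : w k ⟶ Y) : dag (P.p k) ≫ P.p k ≫ f = f := by
  rw [← Category.assoc, P.self, Category.id_comp]

theorem ne_assoc (k l : K) (h : k ≠ l) {Y : C} (f : w l ⟶ Y) :
    dag (P.p k) ≫ P.p l ≫ f = 0 := by
  rw [← Category.assoc, P.ne k l h, zero_comp]

theorem expand_left {Y : C} (f : V ⟶ Y) : f = ∑ k, P.p k ≫ dag (P.p k) ≫ f := by
  conv_lhs => rw [← Category.id_comp f, ← P.total, Preadditive.sum_comp]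
  simp

theorem expand_right {Y : C} (f : Y ⟶ V) : f = ∑ k, f ≫ P.p k ≫ dag (P.p k) := by
  conv_lhs => rw [← Category.comp_id f, ← P.total, Preadditive.comp_sum]

end OrthoDecomp

section Reps

variable {ι : Type} (I : SimpleReps C ι)

theorem SimpleReps.hom_eq_zero {i j : ι} (h : i ≠ j) (f : I.obj i ⟶ I.obj j) : f = 0 := by
  by_contra hf
  have := isIso_of_hom_simple hf
  exact h (I.eq_of_iso i j ⟨asIso f⟩)

theorem SimpleReps.eq_zero_of_comp {X Y : C} (f : X ⟶ Y)
    (h : ∀ i (g : Y ⟶ I.obj i), f ≫ g = 0) : f = 0 := by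
  obtain ⟨n, w, b, hw, ⟨hb⟩, ⟨e⟩⟩ := UnitaryFusionCategory.semisimple Y
  rw [← cancel_mono e.hom, zero_comp]
  apply hb.isLimit.hom_ext
  rintro ⟨j⟩
  change (f ≫ e.hom) ≫ b.π j = 0 ≫ b.π j
  rw [zero_comp]
  obtain ⟨i, ⟨e'⟩⟩ := I.exists_iso (w j) (hw j)
  rw [← cancel_mono e'.hom, zero_comp]
  simpa using h i (e.hom ≫ b.π j ≫ e'.hom)

theorem SimpleReps.eq_of_comp {X Y : C} {f f' : X ⟶ Y}
    (h : ∀ i (g : Y ⟶ I.obj i), f ≫ g = f' ≫ g) : f = f' :=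
  sub_eq_zero.1 (I.eq_zero_of_comp _ fun i g => by rw [Preadditive.sub_comp, h, sub_self])

theorem HomONB.eq_sum {V w : C} [Simple w] (B : HomONB V w) (f : V ⟶ w) :
    ∑ i, (B.b i ≫ dag (B.b i)) ≫ f = f := by
  have hf : f ∈ Submodule.span ℂ (Set.range B.b) := by rw [B.span]; trivial
  induction hf using Submodule.span_induction with
  | mem x hx =>
    obtain ⟨j, rfl⟩ := hx
    simp only [Category.assoc, B.orthonormal]
    rw [Finset.sum_eq_single j (fun i _ hi => by rw [if_neg hi, comp_zero]) (by simp), if_pos rfl,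
      Category.comp_id]
  | zero => simp
  | add x y _ _ hx hy => simp only [Preadditive.comp_add, Finset.sum_add_distrib, hx, hy]
  | smul a x _ hx => simp only [Linear.comp_smul, ← Finset.smul_sum, hx]

variable [Fintype ι]

theorem SimpleReps.total (V : C) :
    ∑ i, ∑ k, (homONB V (I.obj i)).b k ≫ dag ((homONB V (I.obj i)).b k) = 𝟙 V := by
  refine I.eq_of_comp fun j g => ?_
  rw [Preadditive.sum_comp, Finset.sum_eq_single j]
  · rw [Preadditive.sum_comp, HomONB.eq_sum, Category.id_comp]
  · intro i _ hij
    rw [Preadditive.sum_comp]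
    refine Finset.sum_eq_zero fun k _ => ?_
    rw [Category.assoc, I.hom_eq_zero hij (dag _ ≫ g), comp_zero]
  · simp

/-- The decomposition of an object into chosen simple objects given by orthonormal bases. -/
def SimpleReps.decomp (V : C) :
    OrthoDecomp V (fun k : Σ i, Fin (homONB V (I.obj i)).n => I.obj k.1) where
  p k := (homONB V (I.obj k.1)).b k.2
  self k := by simp [(homONB V (I.obj k.1)).orthonormal]
  ne := by
    rintro ⟨i, k⟩ ⟨j, l⟩ h
    by_cases hij : i = j
    · subst hij
      rw [HomONB.orthonormal, if_neg]
      rintro rfl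
      exact h rfl
    · exact I.hom_eq_zero hij _
  total := by
    rw [Fintype.sum_sigma]
    exact I.total V

theorem fuse_apply {V x y : C} (w : ι) (φ : V ⊗ x ⟶ y ⊗ V) :
    fuse I w φ = ∑ i, dag ((homONB V (I.obj w)).b i) ▷ x ≫ φ ≫ y ◁ (homONB V (I.obj w)).b i := by
  simp [fuse]

end Reps

/-! ## Orthogonal direct sums -/

theorem mono_comp_dag {X Z : C} (i : X ⟶ Z) [Mono i] : Mono (i ≫ dag i) := by
  refine Preadditive.mono_of_cancel_zero _ fun f hf => ?_
  rw [← cancel_mono i, zero_comp]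
  apply eq_zero_of_comp_dag
  rw [dag_comp, Category.assoc, reassoc_of% hf, zero_comp]

theorem isIso_of_mono_endo {X : C} (g : X ⟶ X) [Mono g] : IsIso g := by
  have hinj : Function.Injective (Linear.rightComp ℂ X g) := fun a b h => (cancel_mono g).1 h
  obtain ⟨h, hh⟩ := LinearMap.surjective_of_injective hinj (𝟙 X)
  have hh' : h ≫ g = 𝟙 X := hh
  exact ⟨h, by rw [← cancel_mono g, Category.assoc, hh', Category.comp_id, Category.id_comp], hh'⟩

/-- The polar decomposition of a monomorphism. -/
theorem exists_isometry {X Z : C} (i : X ⟶ Z) [Mono i] :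
    ∃ (g : X ⟶ X) (_ : IsIso g), (inv g ≫ i) ≫ dag (inv g ≫ i) = 𝟙 X := by
  obtain ⟨g, hg⟩ := UnitaryFusionCategory.comp_dag_pos i
  replace hg : i ≫ dag i = g ≫ dag g := hg
  have h1 := mono_comp_dag i
  rw [hg] at h1
  have : Mono g := mono_of_mono g (dag g)
  have hi := isIso_of_mono_endo g
  refine ⟨g, hi, ?_⟩
  have h2 : dag g ≫ dag (inv g) = 𝟙 X := by rw [← dag_comp, IsIso.inv_hom_id, dag_id]
  rw [dag_comp, Category.assoc, reassoc_of% hg, h2, Category.comp_id, IsIso.inv_hom_id]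

/-- Orthogonal direct sums of two objects exist. -/
theorem exists_orthogonal_sum (X Y : C) : ∃ (Z : C) (i : X ⟶ Z) (j : Y ⟶ Z),
    i ≫ dag i = 𝟙 X ∧ j ≫ dag j = 𝟙 Y ∧ i ≫ dag j = 0 ∧ dag i ≫ i + dag j ≫ j = 𝟙 Z := by
  obtain ⟨g, hg, hi⟩ := exists_isometry (biprod.inl : X ⟶ X ⊞ Y)
  set i := inv g ≫ (biprod.inl : X ⟶ X ⊞ Y) with hidef
  have hinl : (biprod.inl : X ⟶ X ⊞ Y) = g ≫ i := by simp [hidef]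
  have hisnd : i ≫ (biprod.snd : X ⊞ Y ⟶ Y) = 0 := by simp [hidef]
  let q : X ⊞ Y ⟶ X ⊞ Y := 𝟙 _ - dag i ≫ i
  have hqi : q ≫ dag i = 0 := by simp [q, Preadditive.sub_comp, hi]
  have hiq : i ≫ q = 0 := by simp [q, Preadditive.comp_sub, reassoc_of% hi]
  have hmono : Mono ((biprod.inr : Y ⟶ X ⊞ Y) ≫ q) := by
    refine Preadditive.mono_of_cancel_zero _ fun f hf => ?_
    have h1 := congrArg (· ≫ (biprod.snd : X ⊞ Y ⟶ Y)) hf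
    simpa [q, Preadditive.comp_sub, Preadditive.sub_comp, hisnd] using h1
  obtain ⟨g', hg', hj⟩ := exists_isometry ((biprod.inr : Y ⟶ X ⊞ Y) ≫ q)
  set j := inv g' ≫ (biprod.inr : Y ⟶ X ⊞ Y) ≫ q with hjdef
  have hji : j ≫ dag i = 0 := by simp [hjdef, hqi]
  have hij : i ≫ dag j = 0 := by
    apply dag_injective
    rw [dag_comp, dag_dag, hji, dag_zero]
  refine ⟨X ⊞ Y, i, j, hi, hj, hij, ?_⟩
  rw [← sub_eq_zero]
  set r := dag i ≫ i + dag j ≫ j - 𝟙 (X ⊞ Y) with hr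
  have hir : i ≫ r = 0 := by
    simp [hr, Preadditive.comp_sub, Preadditive.comp_add, reassoc_of% hi, reassoc_of% hij]
  have hjr : j ≫ r = 0 := by
    simp [hr, Preadditive.comp_sub, Preadditive.comp_add, reassoc_of% hj, reassoc_of% hji]
  apply biprod.hom_ext'
  · rw [hinl, Category.assoc, hir, comp_zero, comp_zero]
  · have h1 : (biprod.inr : Y ⟶ X ⊞ Y) = g' ≫ j + biprod.inr ≫ dag i ≫ i := by
      simp [hjdef, q, Preadditive.comp_sub]
    rw [comp_zero]
    conv_lhs => rw [h1]
    simp [Preadditive.add_comp, hjr, hir]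

theorem nonempty_orthoDecomp_fin : ∀ {n : ℕ} (w : Fin n → C),
    ∃ V : C, Nonempty (OrthoDecomp V w)
  | 0, w => by
    open scoped ZeroObject in
    refine ⟨(0 : C), ⟨⟨fun k => 0, fun k => k.elim0, fun k => k.elim0, ?_⟩⟩⟩
    exact (isZero_zero C).eq_of_src _ _
  | n + 1, w => by
    obtain ⟨V, ⟨P⟩⟩ := nonempty_orthoDecomp_fin (fun k : Fin n => w k.succ)
    obtain ⟨Z, i, j, hi, hj, hij, ht⟩ := exists_orthogonal_sum (w 0) V
    have hji : j ≫ dag i = 0 := by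
      apply dag_injective
      rw [dag_comp, dag_dag, hij, dag_zero]
    refine ⟨Z, ⟨⟨Fin.cases (dag i) (fun k => dag j ≫ P.p k), ?_, ?_, ?_⟩⟩⟩
    · intro k
      refine Fin.cases ?_ (fun k => ?_) k
      · simp [dag_dag, hi]
      · simp [dag_comp, dag_dag, reassoc_of% hj]
    · intro k l
      refine Fin.cases ?_ (fun k => ?_) k <;> refine Fin.cases ?_ (fun l => ?_) l
      · simp
      · intro _
        simp [dag_dag, reassoc_of% hij]
      · intro _
        simp [dag_comp, dag_dag, hji]
      · intro h
        simp [dag_comp, dag_dag, reassoc_of% hj, P.ne k l (by simpa using h)]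
    · rw [Fin.sum_univ_succ, ← ht]
      congr 1
      · simp [dag_dag]
      · have := P.expand_left j
        conv_rhs => rhs; rw [this]
        simp [dag_comp, dag_dag, Preadditive.comp_sum]

theorem exists_orthoDecomp {K : Type*} [Fintype K] (w : K → C) :
    ∃ V : C, Nonempty (OrthoDecomp V w) := by
  obtain ⟨V, ⟨P⟩⟩ := nonempty_orthoDecomp_fin (fun k => w ((Fintype.equivFin K).symm k))
  have key : ∀ k, w ((Fintype.equivFin K).symm (Fintype.equivFin K k)) = w k := by simp
  refine ⟨V, ⟨⟨fun k => P.p (Fintype.equivFin K k) ≫ eqToHom (key k), ?_, ?_, ?_⟩⟩⟩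
  all_goals
    have hdag : ∀ {X Y : C} (h : X = Y), dag (eqToHom h) = eqToHom h.symm := by
      rintro X _ rfl
      exact dag_id X
    simp only [dag_comp, hdag, Category.assoc]
  · intro k
    simp
  · intro k l h
    rw [P.ne_assoc _ _ (by simpa using h)]
    simp
  · rw [← P.total, ← (Fintype.equivFin K).sum_comp]
    simp

end Semisimple

section Pivotal

variable {C : Type u} [Category.{v} C] [Abelian C] [Linear ℂ C] [MonoidalCategory C]
  [MonoidalPreadditive C] [MonoidalLinear ℂ C] [RigidCategory C] [UnitaryFusionCategory C]

namespace StandardDual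

variable {V W U : C} (D : StandardDual V) (E : StandardDual W)

theorem lt_comp (F : StandardDual U) (b : V ⟶ W) (c : W ⟶ U) :
    lt D F (b ≫ c) = lt E F c ≫ lt D E b := by
  rw [lt, dag_comp, rt_comp F E D, dag_comp]
  rfl

theorem dag_rt (b : V ⟶ W) : dag (rt D E b) = lt E D (dag b) := by rw [lt, dag_dag]

theorem dag_lt (b : V ⟶ W) : dag (lt D E b) = rt E D (dag b) := by rw [lt, dag_dag]

theorem lt_sub (b c : V ⟶ W) : lt D E (b - c) = lt D E b - lt D E c := by
  rw [lt, dag_sub, show rt E D (dag b - dag c) = rt E D (dag b) - rt E D (dag c) from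
    (rtₗ E D).map_sub _ _, dag_sub]
  rfl

theorem lt_surjective (s : E.bar ⟶ D.bar) : ∃ b : V ⟶ W, lt D E b = s := by
  obtain ⟨c, hc⟩ := rt_surjective E D (dag s)
  exact ⟨dag c, by rw [lt, dag_dag, hc, dag_dag]⟩

theorem exists_bar_scalar [Simple W] (e : E.bar ⟶ E.bar) : ∃ r : ℂ, e = r • 𝟙 E.bar := by
  obtain ⟨b, rfl⟩ := rt_surjective E E e
  obtain ⟨r, rfl⟩ := exists_scalar b
  exact ⟨r, by rw [rt_smul, rt_id]⟩

theorem dim_eq : E.R ≫ dag E.R = E.Rbar ≫ dag E.Rbar := by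
  simpa using E.spherical (𝟙 W)

theorem rt_dag_rt_eq [Simple W] (b c : V ⟶ W) :
    rt D E b ≫ dag (rt D E c) = lt D E b ≫ dag (lt D E c) := by
  have h := D.spherical (b ≫ dag c)
  have hR : D.Rbar ≫ (b ≫ dag c) ▷ D.bar ≫ dag D.Rbar =
      E.Rbar ≫ W ◁ (rt D E b ≫ dag (rt D E c)) ≫ dag E.Rbar := by
    have h1 := congrArg dag (Rbar_comp D E c)
    simp only [dag_comp, dag_whiskerLeft, dag_whiskerRight] at h1
    rw [comp_whiskerRight, Category.assoc, h1, ← Category.assoc, Rbar_comp D E b]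
    simp
  have hL : D.R ≫ D.bar ◁ (b ≫ dag c) ≫ dag D.R =
      E.R ≫ (lt D E b ≫ dag (lt D E c)) ▷ W ≫ dag E.R := by
    have h1 := congrArg dag (R_comp D E c)
    simp only [dag_comp, dag_whiskerLeft, dag_whiskerRight] at h1
    rw [MonoidalCategory.whiskerLeft_comp, Category.assoc, h1, ← Category.assoc, R_comp D E b]
    simp
  rw [hR, hL] at h
  obtain ⟨r, hr⟩ := exists_bar_scalar E (rt D E b ≫ dag (rt D E c))
  obtain ⟨s, hs⟩ := exists_bar_scalar E (lt D E b ≫ dag (lt D E c))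
  rw [hr, hs] at h ⊢
  simp only [MonoidalLinear.whiskerLeft_smul, MonoidalLinear.smul_whiskerRight, whiskerLeft_id,
    id_whiskerRight, Linear.smul_comp, Linear.comp_smul, Category.id_comp, dim_eq] at h
  have h2 : (s - r) • (E.Rbar ≫ dag E.Rbar) = 0 := by rw [sub_smul, h, sub_self]
  rcases smul_eq_zero.1 h2 with h3 | h3
  · rw [sub_eq_zero.1 h3]
  · exact absurd (eq_zero_of_comp_dag h3) E.Rbar_ne_zero

theorem rt_dag_lt_eq (b c : V ⟶ W) : rt D E b ≫ dag (lt D E c) = rt E E (dag c ≫ b) := by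
  rw [dag_lt, rt_comp E D E]

theorem lt_dag_rt_eq (b c : V ⟶ W) : lt D E b ≫ dag (rt D E c) = lt E E (dag c ≫ b) := by
  rw [dag_rt, lt_comp E D E]

theorem lt_eq_rt_endo [Simple W] (b : W ⟶ W) : lt E E b = rt E E b := by
  obtain ⟨r, rfl⟩ := exists_scalar b
  simp [lt, dag_smul, dag_id, rt_smul, rt_id]

theorem lt_eq_rt_of_simple [Simple W] (b : V ⟶ W) : lt D E b = rt D E b := by
  obtain ⟨b₁, h₁⟩ := rt_surjective D E (lt D E b)
  have h₂ : lt D E b₁ = rt D E b := by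
    rw [← sub_eq_zero]
    obtain ⟨c, hc⟩ := lt_surjective D E (lt D E b₁ - rt D E b)
    rw [← hc]
    apply eq_zero_of_comp_dag
    conv_lhs => arg 1; rw [hc]
    rw [Preadditive.sub_comp, ← rt_dag_rt_eq, h₁, rt_dag_lt_eq, lt_dag_rt_eq, lt_eq_rt_endo,
      sub_self]
  set c := b - b₁ with hc
  have hlc : lt D E c = -rt D E c := by
    rw [hc, lt_sub, h₂, ← h₁, show rt D E (b - b₁) = rt D E b - rt D E b₁ from
      (rtₗ D E).map_sub _ _, neg_sub]
  have hc0 : c = 0 := by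
    obtain ⟨r, hr, hr'⟩ := scalar_comp_dag (dag c)
    rw [dag_dag] at hr'
    have h3 : dag c ≫ c = (r : ℂ) • 𝟙 W := by rw [← hr', scalar_smul_id]
    have h4 := rt_dag_lt_eq D E c c
    rw [hlc, dag_neg, Preadditive.comp_neg, h3, rt_smul, rt_id] at h4
    obtain ⟨q, hq, hq'⟩ := scalar_comp_dag (E.Rbar ≫ W ◁ rt D E c)
    obtain ⟨n, hn, hn'⟩ := pos_of_ne_zero _ E.Rbar_ne_zero
    have h5 : (E.Rbar ≫ W ◁ rt D E c) ≫ dag (E.Rbar ≫ W ◁ rt D E c) =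
        ((-r * n : ℝ) : ℂ) • 𝟙 _ := by
      have h6 : rt D E c ≫ dag (rt D E c) = (-r : ℂ) • 𝟙 _ := by
        rw [neg_smul, ← h4, neg_neg]
      rw [dag_comp, dag_whiskerLeft, Category.assoc, ← whiskerLeft_comp_assoc, h6]
      rw [MonoidalLinear.whiskerLeft_smul, whiskerLeft_id, Linear.smul_comp, Linear.comp_smul,
        Category.id_comp, hn', smul_smul]
      push_cast
      rfl
    rw [scalar_unique h5] at hq'
    have h7 : -r * n = q := by exact_mod_cast hq'
    have h8 : r = 0 := by nlinarith
    apply dag_injective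
    rw [dag_zero]
    apply eq_zero_of_comp_dag
    rw [dag_dag, h3, h8]
    simp
  rw [sub_eq_zero.1 (hc.symm.trans hc0), h₂]
  rw [← h₂, ← sub_eq_zero.1 (hc.symm.trans hc0)]
  exact h₁.symm ▸ (by rw [← sub_eq_zero.1 (hc.symm.trans hc0)])

theorem rt_sum {J : Type*} (s : Finset J) (f : J → (V ⟶ W)) :
    rt D E (∑ j ∈ s, f j) = ∑ j ∈ s, rt D E (f j) := map_sum (rtₗ D E) f s

theorem lt_sum {J : Type*} (s : Finset J) (f : J → (V ⟶ W)) :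
    lt D E (∑ j ∈ s, f j) = ∑ j ∈ s, lt D E (f j) := by
  simp only [lt, dag_sum, rt_sum]

/-- In the canonical spherical structure the two transposes agree. -/
theorem lt_eq_rt {ι : Type} [Fintype ι] (I : SimpleReps C ι) (b : V ⟶ W) : lt D E b = rt D E b := by
  have h (k) : lt D (stdDual (I.obj k.1)) (b ≫ (I.decomp W).p k) =
      rt D (stdDual (I.obj k.1)) (b ≫ (I.decomp W).p k) := lt_eq_rt_of_simple _ _ _
  have h' (k) : lt (stdDual (I.obj k.1)) E (dag ((I.decomp W).p k)) =
      rt (stdDual (I.obj k.1)) E (dag ((I.decomp W).p k)) := by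
    rw [← dag_rt, ← lt_eq_rt_of_simple, dag_lt]
  rw [(I.decomp W).expand_right b]
  simp only [← Category.assoc]
  simp only [lt_sum, rt_sum, lt_comp D (stdDual _) E, rt_comp D (stdDual _) E, h, h']

theorem whiskerRight_comp_dag_Rbar {ι : Type} [Fintype ι] (I : SimpleReps C ι) (b : V ⟶ W) :
    b ▷ E.bar ≫ dag E.Rbar = V ◁ rt D E b ≫ dag D.Rbar := by
  have h := congrArg dag (Rbar_comp E D (dag b))
  simp only [dag_comp, dag_whiskerLeft, dag_whiskerRight, dag_dag, dag_rt] at h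
  rw [h, lt_eq_rt D E I]

/-- The partial trace is cyclic. -/
theorem ptr_cyclic {ι : Type} [Fintype ι] (I : SimpleReps C ι) {x z : C} (b : V ⟶ W)
    (F : x ⊗ W ⟶ z ⊗ V) :
    D.ptr (x ◁ b ≫ F) = E.ptr (F ≫ z ◁ b) := by
  unfold ptr
  calc
    _ = 𝟙 _ ⊗≫ x ◁ (D.Rbar ≫ b ▷ D.bar) ⊗≫ F ▷ D.bar ⊗≫ z ◁ dag D.Rbar ⊗≫ 𝟙 _ := by monoidal
    _ = 𝟙 _ ⊗≫ x ◁ E.Rbar ⊗≫ ((x ⊗ W) ◁ rt D E b ≫ F ▷ D.bar) ⊗≫ z ◁ dag D.Rbar ⊗≫ 𝟙 _ := by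
      rw [Rbar_comp D E]; monoidal
    _ = 𝟙 _ ⊗≫ x ◁ E.Rbar ⊗≫ F ▷ E.bar ⊗≫ z ◁ (V ◁ rt D E b ≫ dag D.Rbar) ⊗≫ 𝟙 _ := by
      rw [whisker_exchange]; monoidal
    _ = _ := by rw [← whiskerRight_comp_dag_Rbar D E I]; monoidal

theorem ptr_eq_ptr {ι : Type} [Fintype ι] (I : SimpleReps C ι) (D' : StandardDual V) {x z : C}
    (F : x ⊗ V ⟶ z ⊗ V) : D.ptr F = D'.ptr F := by
  simpa using ptr_cyclic D D' I (𝟙 V) F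

/-- The dual with the roles of the object and its dual exchanged. -/
def flip {ι : Type} [Fintype ι] (I : SimpleReps C ι) : StandardDual D.bar where
  bar := V
  R := D.Rbar
  Rbar := D.R
  zigzag := by rw [← D.zigzag₄]; simp [monoidalComp]
  zigzag_bar := by rw [← D.zigzag₃]; simp [monoidalComp]
  spherical f := by
    obtain ⟨g, rfl⟩ := rt_surjective D D f
    rw [← Category.assoc, ← Rbar_comp D D, Category.assoc, ← D.spherical, ← lt_eq_rt D D I,
      ← Category.assoc, R_comp D D, Category.assoc]

/-- The standard dual of a tensor product. -/
def tensor : StandardDual (V ⊗ W) where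
  bar := E.bar ⊗ D.bar
  R := E.R ≫ E.bar ◁ ((λ_ W).inv ≫ D.R ▷ W ≫ (α_ D.bar V W).hom) ≫
    (α_ E.bar D.bar (V ⊗ W)).inv
  Rbar := D.Rbar ≫ V ◁ ((λ_ D.bar).inv ≫ E.Rbar ▷ D.bar ≫ (α_ W E.bar D.bar).hom) ≫
    (α_ V W (E.bar ⊗ D.bar)).inv
  zigzag := by
    simp only [dag_comp, dag_whiskerLeft, dag_whiskerRight, dag_associator_inv,
      dag_associator_hom, dag_leftUnitor_inv]
    calc
      _ = 𝟙 _ ⊗≫ D.Rbar ▷ (V ⊗ W) ⊗≫ V ◁ (E.Rbar ▷ (D.bar ⊗ V) ≫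
            (W ⊗ E.bar) ◁ dag D.R) ▷ W ⊗≫ V ◁ W ◁ dag E.R ⊗≫ 𝟙 _ := by monoidal
      _ = 𝟙 _ ⊗≫ (D.Rbar ▷ V ⊗≫ V ◁ dag D.R) ▷ W ⊗≫
            V ◁ (E.Rbar ▷ W ⊗≫ W ◁ dag E.R) ⊗≫ 𝟙 _ := by
        rw [← whisker_exchange]; monoidal
      _ = _ := by rw [zigzag₁, zigzag₁]; monoidal
  zigzag_bar := by
    simp only [dag_comp, dag_whiskerLeft, dag_whiskerRight, dag_associator_inv,
      dag_associator_hom, dag_leftUnitor_inv]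
    calc
      _ = 𝟙 _ ⊗≫ E.bar ◁ D.bar ◁ D.Rbar ⊗≫ E.bar ◁ ((D.bar ⊗ V) ◁ E.Rbar ≫
            dag D.R ▷ (W ⊗ E.bar)) ▷ D.bar ⊗≫ dag E.R ▷ (E.bar ⊗ D.bar) ⊗≫ 𝟙 _ := by monoidal
      _ = 𝟙 _ ⊗≫ E.bar ◁ (D.bar ◁ D.Rbar ⊗≫ dag D.R ▷ D.bar) ⊗≫
            (E.bar ◁ E.Rbar ⊗≫ dag E.R ▷ E.bar) ▷ D.bar ⊗≫ 𝟙 _ := by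
        rw [whisker_exchange]; monoidal
      _ = _ := by rw [zigzag₂, zigzag₂]; monoidal
  spherical f := by
    simp only [dag_comp, dag_whiskerLeft, dag_whiskerRight, dag_associator_inv,
      dag_associator_hom, dag_leftUnitor_inv]
    let p : W ⟶ W := (λ_ W).inv ≫ D.R ▷ W ≫ (α_ D.bar V W).hom ≫ D.bar ◁ f ≫
      (α_ D.bar V W).inv ≫ dag D.R ▷ W ≫ (λ_ W).hom
    let q : V ⟶ V := (ρ_ V).inv ≫ V ◁ E.Rbar ≫ (α_ V W E.bar).inv ≫ f ▷ E.bar ≫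
      (α_ V W E.bar).hom ≫ V ◁ dag E.Rbar ≫ (ρ_ V).hom
    calc
      _ = E.R ≫ E.bar ◁ p ≫ dag E.R := by simp only [p]; monoidal
      _ = E.Rbar ≫ p ▷ E.bar ≫ dag E.Rbar := E.spherical p
      _ = 𝟙 _ ⊗≫ (𝟙_ C ◁ E.Rbar ≫ D.R ▷ (W ⊗ E.bar)) ⊗≫ D.bar ◁ f ▷ E.bar ⊗≫
            (dag D.R ▷ (W ⊗ E.bar) ≫ 𝟙_ C ◁ dag E.Rbar) ⊗≫ 𝟙 _ := by simp only [p]; monoidal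
      _ = D.R ≫ D.bar ◁ q ≫ dag D.R := by
        rw [whisker_exchange D.R E.Rbar, ← whisker_exchange (dag D.R) (dag E.Rbar)]
        simp only [q]; monoidal
      _ = D.Rbar ≫ q ▷ D.bar ≫ dag D.Rbar := D.spherical q
      _ = _ := by simp only [q]; monoidal

theorem tensor_ptr {x z : C} (F : x ⊗ (V ⊗ W) ⟶ z ⊗ (V ⊗ W)) :
    (tensor D E).ptr F = D.ptr (E.ptr ((α_ x V W).hom ≫ F ≫ (α_ z V W).inv)) := by
  simp only [ptr, tensor, dag_comp, dag_whiskerLeft, dag_whiskerRight, dag_associator_inv,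
      dag_associator_hom, dag_leftUnitor_inv]
  monoidal

/-- The trivial dual of the unit. -/
def unit : StandardDual (𝟙_ C) where
  bar := 𝟙_ C
  R := (λ_ _).inv
  Rbar := (λ_ _).inv
  zigzag := by rw [dag_leftUnitor_inv]; monoidal
  zigzag_bar := by rw [dag_leftUnitor_inv]; monoidal
  spherical f := by
    rw [dag_leftUnitor_inv]
    simp [unitors_equal, unitors_inv_equal]

theorem unit_ptr {x z : C} (f : x ⟶ z) :
    (unit (C := C)).ptr ((ρ_ x).hom ≫ f ≫ (ρ_ z).inv) = f := by
  simp only [ptr, unit, dag_leftUnitor_inv]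
  monoidal

/-- The standard dual of an orthogonal direct sum. -/
def ofDecomp {K : Type*} [Fintype K] {w : K → C} (P : OrthoDecomp V w)
    (E : ∀ k, StandardDual (w k)) {Vb : C} (Q : OrthoDecomp Vb (fun k => (E k).bar)) :
    StandardDual V where
  bar := Vb
  R := ∑ k, (E k).R ≫ dag (Q.p k) ▷ w k ≫ Vb ◁ dag (P.p k)
  Rbar := ∑ k, (E k).Rbar ≫ w k ◁ dag (Q.p k) ≫ dag (P.p k) ▷ Vb
  zigzag := by
    have h1 (k l) : ((E k).Rbar ≫ w k ◁ dag (Q.p k) ≫ dag (P.p k) ▷ Vb) ▷ V ≫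
        (α_ V Vb V).hom ≫ V ◁ (Vb ◁ P.p l ≫ Q.p l ▷ w l ≫ dag (E l).R) =
        𝟙 _ ⊗≫ (E k).Rbar ▷ V ⊗≫ w k ◁ (dag (Q.p k) ≫ Q.p l) ▷ V ⊗≫
          (dag (P.p k) ▷ ((E l).bar ⊗ V)) ⊗≫ V ◁ (E l).bar ◁ P.p l ⊗≫ V ◁ dag (E l).R ⊗≫ 𝟙 _ := by
      calc
        _ = 𝟙 _ ⊗≫ (E k).Rbar ▷ V ⊗≫ w k ◁ dag (Q.p k) ▷ V ⊗≫ dag (P.p k) ▷ (Vb ⊗ V) ⊗≫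
          V ◁ (Vb ◁ P.p l ≫ Q.p l ▷ w l) ⊗≫ V ◁ dag (E l).R ⊗≫ 𝟙 _ := by monoidal
        _ = 𝟙 _ ⊗≫ (E k).Rbar ▷ V ⊗≫ w k ◁ dag (Q.p k) ▷ V ⊗≫ (dag (P.p k) ▷ (Vb ⊗ V) ≫
          V ◁ (Q.p l ▷ V)) ⊗≫ V ◁ (E l).bar ◁ P.p l ⊗≫ V ◁ dag (E l).R ⊗≫ 𝟙 _ := by
            rw [whisker_exchange]; monoidal
        _ = _ := by rw [← whisker_exchange]; monoidal
    have h2 (k) : ∑ l, ((E k).Rbar ≫ w k ◁ dag (Q.p k) ≫ dag (P.p k) ▷ Vb) ▷ V ≫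
        (α_ V Vb V).hom ≫ V ◁ (Vb ◁ P.p l ≫ Q.p l ▷ w l ≫ dag (E l).R) =
        (λ_ V).hom ≫ (P.p k ≫ dag (P.p k)) ≫ (ρ_ V).inv := by
      rw [Finset.sum_eq_single k _ (by simp)]
      · rw [h1, Q.self]
        calc
          _ = 𝟙 _ ⊗≫ (E k).Rbar ▷ V ⊗≫ (dag (P.p k) ▷ ((E k).bar ⊗ V) ≫
              V ◁ ((E k).bar ◁ P.p k ≫ dag (E k).R)) ⊗≫ 𝟙 _ := by monoidal
          _ = 𝟙 _ ⊗≫ ((E k).Rbar ▷ V ≫ (w k ⊗ (E k).bar) ◁ P.p k) ⊗≫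
              (w k ◁ dag (E k).R ≫ dag (P.p k) ▷ 𝟙_ C) ⊗≫ 𝟙 _ := by
            rw [← whisker_exchange]; monoidal
          _ = 𝟙 _ ⊗≫ P.p k ⊗≫ ((E k).Rbar ▷ w k ⊗≫ w k ◁ dag (E k).R) ⊗≫ dag (P.p k) ⊗≫ 𝟙 _ := by
            rw [← whisker_exchange]; monoidal
          _ = _ := by rw [zigzag₁]; monoidal
      · intro l _ hl
        rw [h1, Q.ne k l hl.symm]
        simp [monoidalComp]
    rw [sum_whiskerRight, dag_sum, whiskerLeft_sum, Preadditive.comp_sum, Preadditive.sum_comp]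
    simp only [Preadditive.comp_sum, dag_comp, dag_whiskerLeft, dag_whiskerRight, dag_dag,
      Category.assoc] at h2 ⊢
    rw [Finset.sum_congr rfl fun k _ => h2 k, ← Preadditive.comp_sum]
    simp only [← Category.assoc]
    rw [← Preadditive.sum_comp, P.total, Category.id_comp]
  zigzag_bar := by
    have h1 (k l) : Vb ◁ ((E k).Rbar ≫ w k ◁ dag (Q.p k) ≫ dag (P.p k) ▷ Vb) ≫
        (α_ Vb V Vb).inv ≫ (Vb ◁ P.p l ≫ Q.p l ▷ w l ≫ dag (E l).R) ▷ Vb =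
        𝟙 _ ⊗≫ Vb ◁ (E k).Rbar ⊗≫ Vb ◁ w k ◁ dag (Q.p k) ⊗≫
          Vb ◁ (dag (P.p k) ≫ P.p l) ▷ Vb ⊗≫ (Q.p l ▷ w l) ▷ Vb ⊗≫ dag (E l).R ▷ Vb ⊗≫ 𝟙 _ := by
      monoidal
    have h2 (l) : ∑ k, Vb ◁ ((E k).Rbar ≫ w k ◁ dag (Q.p k) ≫ dag (P.p k) ▷ Vb) ≫
        (α_ Vb V Vb).inv ≫ (Vb ◁ P.p l ≫ Q.p l ▷ w l ≫ dag (E l).R) ▷ Vb =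
        (ρ_ Vb).hom ≫ (Q.p l ≫ dag (Q.p l)) ≫ (λ_ Vb).inv := by
      rw [Finset.sum_eq_single l _ (by simp)]
      · rw [h1, P.self]
        calc
          _ = 𝟙 _ ⊗≫ Vb ◁ (E l).Rbar ⊗≫ ((Vb ⊗ w l) ◁ dag (Q.p l) ≫
                (Q.p l ▷ w l ≫ dag (E l).R) ▷ Vb) ⊗≫ 𝟙 _ := by monoidal
          _ = 𝟙 _ ⊗≫ (Vb ◁ (E l).Rbar ≫ Q.p l ▷ (w l ⊗ (E l).bar)) ⊗≫
                (dag (E l).R ▷ (E l).bar ≫ 𝟙_ C ◁ dag (Q.p l)) ⊗≫ 𝟙 _ := by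
            rw [whisker_exchange]; monoidal
          _ = 𝟙 _ ⊗≫ Q.p l ⊗≫ ((E l).bar ◁ (E l).Rbar ⊗≫ dag (E l).R ▷ (E l).bar) ⊗≫
                dag (Q.p l) ⊗≫ 𝟙 _ := by
            rw [whisker_exchange]; monoidal
          _ = _ := by rw [zigzag₂]; monoidal
      · intro k _ hk
        rw [h1, P.ne k l hk]
        simp [monoidalComp]
    rw [whiskerLeft_sum, dag_sum, sum_whiskerRight, Preadditive.comp_sum, Preadditive.comp_sum]
    simp only [Preadditive.sum_comp, dag_comp, dag_whiskerLeft, dag_whiskerRight, dag_dag,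
      Category.assoc] at h2 ⊢
    rw [Finset.sum_congr rfl fun k _ => h2 k, ← Preadditive.comp_sum]
    simp only [← Category.assoc]
    rw [← Preadditive.sum_comp, Q.total, Category.id_comp]
  spherical f := by
    have hL : (∑ k, (E k).R ≫ dag (Q.p k) ▷ w k ≫ Vb ◁ dag (P.p k)) ≫ Vb ◁ f ≫
        dag (∑ k, (E k).R ≫ dag (Q.p k) ▷ w k ≫ Vb ◁ dag (P.p k)) =
        ∑ k, (E k).R ≫ (E k).bar ◁ (dag (P.p k) ≫ f ≫ P.p k) ≫ dag (E k).R := by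
      simp only [dag_sum, Preadditive.comp_sum, Preadditive.sum_comp, dag_comp, dag_whiskerLeft,
        dag_whiskerRight, dag_dag]
      refine Finset.sum_congr rfl fun k _ => ?_
      have h1 (l) : ((E l).R ≫ dag (Q.p l) ▷ w l ≫ Vb ◁ dag (P.p l)) ≫ Vb ◁ f ≫
          (Vb ◁ P.p k ≫ Q.p k ▷ w k) ≫ dag (E k).R = (E l).R ≫
          (dag (Q.p l) ≫ Q.p k) ▷ w l ≫ (E k).bar ◁ (dag (P.p l) ≫ f ≫ P.p k) ≫ dag (E k).R := by
        rw [comp_whiskerRight, Category.assoc (dag (Q.p l) ▷ w l), ← whisker_exchange_assoc]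
        simp
      simp only [Category.assoc] at h1 ⊢
      simp only [h1]
      rw [Finset.sum_eq_single k _ (by simp)]
      · simp
      · intro l _ hl
        rw [Q.ne l k hl]
        simp
    have hR : (∑ k, (E k).Rbar ≫ w k ◁ dag (Q.p k) ≫ dag (P.p k) ▷ Vb) ≫ f ▷ Vb ≫
        dag (∑ k, (E k).Rbar ≫ w k ◁ dag (Q.p k) ≫ dag (P.p k) ▷ Vb) =
        ∑ k, (E k).Rbar ≫ (dag (P.p k) ≫ f ≫ P.p k) ▷ (E k).bar ≫ dag (E k).Rbar := by
      simp only [dag_sum, Preadditive.comp_sum, Preadditive.sum_comp, dag_comp, dag_whiskerLeft,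
        dag_whiskerRight, dag_dag]
      refine Finset.sum_congr rfl fun k _ => ?_
      have h1 (l) : ((E l).Rbar ≫ w l ◁ dag (Q.p l) ≫ dag (P.p l) ▷ Vb) ≫ f ▷ Vb ≫
          (P.p k ▷ Vb ≫ w k ◁ Q.p k) ≫ dag (E k).Rbar = (E l).Rbar ≫
          w l ◁ (dag (Q.p l) ≫ Q.p k) ≫ (dag (P.p l) ≫ f ≫ P.p k) ▷ (E k).bar ≫
            dag (E k).Rbar := by
        rw [MonoidalCategory.whiskerLeft_comp, Category.assoc (w l ◁ dag (Q.p l)),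
          whisker_exchange_assoc]
        simp
      simp only [Category.assoc] at h1 ⊢
      simp only [h1]
      rw [Finset.sum_eq_single k _ (by simp)]
      · simp
      · intro l _ hl
        rw [Q.ne l k hl]
        simp
    rw [hL, hR]
    exact Finset.sum_congr rfl fun k _ => (E k).spherical _

end StandardDual

/-- Every object has a standard dual. -/
theorem exists_standardDual {ι : Type} [Fintype ι] (I : SimpleReps C ι) (V : C) :
    Nonempty (StandardDual V) := by
  obtain ⟨Vb, ⟨Q⟩⟩ := exists_orthoDecomp (fun k : Σ i, Fin (homONB V (I.obj i)).n =>
    (stdDual (I.obj k.1)).bar)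
  exact ⟨StandardDual.ofDecomp (I.decomp V) (fun k => stdDual (I.obj k.1)) Q⟩

end Pivotal

section Trace

variable {C : Type u} [Category.{v} C] [Abelian C] [Linear ℂ C] [MonoidalCategory C]
  [MonoidalPreadditive C] [MonoidalLinear ℂ C] [RigidCategory C] [UnitaryFusionCategory C]

namespace StandardDual

variable {V W : C} (D : StandardDual V) (E : StandardDual W)

/-- The spherical trace. -/
def tr (f : V ⟶ V) : 𝟙_ C ⟶ 𝟙_ C := D.Rbar ≫ f ▷ D.bar ≫ dag D.Rbar

/-- The partial trace over the left tensor factor. -/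
def lptr {x z : C} (F : V ⊗ x ⟶ V ⊗ z) : x ⟶ z :=
  (λ_ x).inv ≫ D.R ▷ x ≫ (α_ D.bar V x).hom ≫ D.bar ◁ F ≫ (α_ D.bar V z).inv ≫
    dag D.R ▷ z ≫ (λ_ z).hom

theorem lptr_comp {x y z : C} (F : V ⊗ x ⟶ V ⊗ y) (g : y ⟶ z) :
    D.lptr F ≫ g = D.lptr (F ≫ V ◁ g) := by
  unfold lptr
  calc
    _ = 𝟙 _ ⊗≫ D.R ▷ x ⊗≫ D.bar ◁ F ⊗≫ (dag D.R ▷ y ≫ 𝟙_ C ◁ g) ⊗≫ 𝟙 _ := by monoidal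
    _ = _ := by rw [← whisker_exchange]; monoidal

theorem whiskerLeft_ptr {x z : C} (U : C) (F : x ⊗ V ⟶ z ⊗ V) :
    U ◁ D.ptr F = D.ptr ((α_ U x V).hom ≫ U ◁ F ≫ (α_ U z V).inv) := by
  unfold ptr
  monoidal

theorem tr_tensor (f : V ⊗ W ⟶ V ⊗ W) : (tensor D E).tr f = D.tr (E.ptr f) := by
  simp only [ptr, tr, tensor, dag_comp, dag_whiskerLeft, dag_whiskerRight, dag_associator_inv,
      dag_associator_hom, dag_leftUnitor_inv]
  monoidal

theorem tr_tensor' (f : V ⊗ W ⟶ V ⊗ W) : (tensor D E).tr f = E.tr (D.lptr f) := by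
  rw [tr, tr, ← spherical, ← spherical]
  simp only [lptr, tensor, dag_comp, dag_whiskerLeft, dag_whiskerRight, dag_associator_inv,
      dag_associator_hom, dag_leftUnitor_inv]
  monoidal

theorem tr_cyclic {ι : Type} [Fintype ι] (I : SimpleReps C ι) (f : V ⟶ W) (g : W ⟶ V) :
    D.tr (f ≫ g) = E.tr (g ≫ f) := by
  unfold tr
  rw [comp_whiskerRight, comp_whiskerRight, Category.assoc, Category.assoc,
    whiskerRight_comp_dag_Rbar D E I f, ← Category.assoc, Rbar_comp D E, Category.assoc,
    whisker_exchange_assoc]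

end StandardDual

theorem scalar_tr (w : C) [Simple w] (f : w ⟶ w) :
    scalar ((stdDual w).tr f) = qdim w * scalar f := by
  obtain ⟨c, rfl⟩ := exists_scalar f
  obtain ⟨r, hr, h⟩ := pos_of_ne_zero _ (stdDual w).Rbar_ne_zero
  have hq : qdim w = r := by rw [qdim, scalar_unique h, Complex.ofReal_re]
  rw [scalar_unique rfl, hq, StandardDual.tr]
  apply scalar_unique
  rw [MonoidalLinear.smul_whiskerRight, id_whiskerRight, Linear.smul_comp, Linear.comp_smul,
    Category.id_comp, h, smul_smul, mul_comm c (r : ℂ)]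

end Trace

section HalfBraidings

variable {C : Type u} [Category.{v} C] [Abelian C] [Linear ℂ C] [MonoidalCategory C]
  [MonoidalPreadditive C] [MonoidalLinear ℂ C] [RigidCategory C] [UnitaryFusionCategory C]

theorem halfBraiding_unit (X : Center C) :
    (X.2.β (𝟙_ C)).hom = (ρ_ X.1).hom ≫ (λ_ X.1).inv := by
  have h := congrArg Center.Hom.f (braiding_tensorUnit_right X)
  rwa [Center.comp_f, Center.rightUnitor_hom_f, Center.leftUnitor_inv_f] at h

theorem halfBraiding_inv_cap (X : Center C) {V : C} (D : StandardDual V) :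
    (X.2.β D.bar).inv ▷ V ≫ (α_ X.1 D.bar V).hom ≫ X.1 ◁ dag D.R =
      (α_ D.bar X.1 V).hom ≫ D.bar ◁ (X.2.β V).hom ≫ (α_ D.bar V X.1).inv ≫ dag D.R ▷ X.1 ≫
        (λ_ X.1).hom ≫ (ρ_ X.1).inv := by
  have h := X.2.naturality (dag D.R)
  rw [halfBraiding_unit, X.2.monoidal] at h
  have h1 : X.1 ◁ dag D.R = (X.1 ◁ dag D.R ≫ (ρ_ X.1).hom ≫ (λ_ X.1).inv) ≫ (λ_ X.1).hom ≫
    (ρ_ X.1).inv := by simp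
  rw [h1, h]
  simp only [Category.assoc, Iso.hom_inv_id_assoc]
  rw [← comp_whiskerRight_assoc, Iso.inv_hom_id, id_whiskerRight, Category.id_comp]

variable {ι : Type} [Fintype ι] (I : SimpleReps C ι)

theorem ptr_flip_rotDag (X : Center C) {V y z : C} (D : StandardDual V) (ψ : V ⊗ z ⟶ y ⊗ V)
    (g : y ⟶ X.1) :
    (D.flip I).ptr (dag (rotDag D ψ) ≫ D.bar ◁ g ≫ (X.2.β D.bar).inv) =
      D.lptr (ψ ≫ g ▷ V ≫ (X.2.β V).hom) := by
  have hb := halfBraiding_inv_cap X D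
  simp only [StandardDual.ptr, StandardDual.flip, StandardDual.lptr, rotDag, dag_comp,
    dag_whiskerLeft, dag_whiskerRight, dag_dag, dag_associator_hom, dag_associator_inv,
    dag_rightUnitor_hom, dag_rightUnitor_inv, dag_leftUnitor_hom, dag_leftUnitor_inv]
  calc
    _ = 𝟙 _ ⊗≫ (𝟙_ C ◁ (z ◁ D.R) ≫ D.R ▷ (z ⊗ D.bar ⊗ V)) ⊗≫ D.bar ◁ ψ ▷ D.bar ▷ V ⊗≫
        D.bar ◁ y ◁ dag D.Rbar ▷ V ⊗≫ D.bar ◁ g ▷ V ⊗≫ ((X.2.β D.bar).inv ▷ V ≫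
          (α_ X.1 D.bar V).hom ≫ X.1 ◁ dag D.R) ⊗≫ 𝟙 _ := by monoidal
    _ = 𝟙 _ ⊗≫ D.R ▷ z ⊗≫ D.bar ◁ ((V ⊗ z) ◁ D.R ≫ ψ ▷ (D.bar ⊗ V)) ⊗≫
        D.bar ◁ y ◁ dag D.Rbar ▷ V ⊗≫ D.bar ◁ g ▷ V ⊗≫ ((α_ D.bar X.1 V).hom ≫
        D.bar ◁ (X.2.β V).hom ≫ (α_ D.bar V X.1).inv ≫ dag D.R ▷ X.1 ≫
        (λ_ X.1).hom ≫ (ρ_ X.1).inv) ⊗≫ 𝟙 _ := by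
      rw [hb, whisker_exchange]; monoidal
    _ = 𝟙 _ ⊗≫ D.R ▷ z ⊗≫ D.bar ◁ ψ ⊗≫ D.bar ◁ y ◁ (V ◁ D.R ⊗≫ dag D.Rbar ▷ V) ⊗≫
        D.bar ◁ g ▷ V ⊗≫ D.bar ◁ (X.2.β V).hom ⊗≫ dag D.R ▷ X.1 ⊗≫ 𝟙 _ := by
      rw [whisker_exchange]; monoidal
    _ = _ := by rw [StandardDual.zigzag₃]; monoidal

/-- The rotation is the adjoint for the trace pairing. -/
theorem star_pairing (X : Center C) {V y z : C} [Simple y] [Simple z] (D : StandardDual V)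
    (ψ : V ⊗ z ⟶ y ⊗ V) (g : y ⟶ X.1) (k : X.1 ⟶ z) :
    (qdim z : ℂ) * scalar ((D.flip I).ptr (dag (rotDag D ψ) ≫ D.bar ◁ g ≫
      (X.2.β D.bar).inv) ≫ k) =
    qdim y * scalar (g ≫ D.ptr ((X.2.β V).hom ≫ V ◁ k ≫ ψ)) := by
  rw [← scalar_tr, ← scalar_tr, ptr_flip_rotDag, StandardDual.lptr_comp,
    ← StandardDual.tr_tensor', StandardDual.comp_ptr, ← StandardDual.tr_tensor]
  simp only [Category.assoc]
  rw [StandardDual.tr_cyclic _ (StandardDual.tensor (stdDual y) D) I]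
  simp only [Category.assoc]

/-- The annular diagram of `φ`, decomposed over the simple objects, acts like `φ` itself. -/
theorem sum_ptr_fuse {X x y V : C} (D : StandardDual V) (c : ∀ U : C, X ⊗ U ⟶ U ⊗ x)
    (hc : ∀ {U U' : C} (f : U ⟶ U'), X ◁ f ≫ c U' = c U ≫ f ▷ x) (φ : V ⊗ x ⟶ y ⊗ V) :
    ∑ w, (stdDual (I.obj w)).ptr (c (I.obj w) ≫ fuse I w φ) = D.ptr (c V ≫ φ) := by
  have h (w : ι) : (stdDual (I.obj w)).ptr (c (I.obj w) ≫ fuse I w φ) =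
      ∑ i, D.ptr ((c V ≫ φ) ≫ y ◁ ((homONB V (I.obj w)).b i ≫ dag ((homONB V (I.obj w)).b i))) := by
    rw [fuse_apply, Preadditive.comp_sum, StandardDual.ptr_sum]
    refine Finset.sum_congr rfl fun i _ => ?_
    rw [← Category.assoc, ← hc, Category.assoc, StandardDual.ptr_cyclic _ D I]
    simp
  simp only [h, ← StandardDual.ptr_sum, ← Preadditive.comp_sum, ← whiskerLeft_sum, I.total]
  simp

theorem sum_encircle_fuse (X : Center C) {x y V : C} (D : StandardDual V) (m : X.1 ⟶ x)
    (φ : V ⊗ x ⟶ y ⊗ V) :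
    ∑ w, encircle (stdDual (I.obj w)) (X.2.β (I.obj w)).hom (I.obj w ◁ m ≫ fuse I w φ) =
      encircle D (X.2.β V).hom (V ◁ m ≫ φ) := by
  simp only [StandardDual.encircle_eq_ptr]
  have := sum_ptr_fuse I D (fun U => (X.2.β U).hom ≫ U ◁ m) (fun f => by
    rw [HalfBraiding.naturality_assoc, Category.assoc, whisker_exchange]) φ
  simpa only [Category.assoc] using this

theorem encircle_add {V x z : C} (D : StandardDual V) (c : x ⊗ V ⟶ V ⊗ x)
    (φ ψ : V ⊗ x ⟶ z ⊗ V) : encircle D c (φ + ψ) = encircle D c φ + encircle D c ψ := by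
  simp only [StandardDual.encircle_eq_ptr, Preadditive.comp_add, StandardDual.ptr_add]

theorem encircle_smul {V x z : C} (D : StandardDual V) (c : x ⊗ V ⟶ V ⊗ x) (r : ℂ)
    (φ : V ⊗ x ⟶ z ⊗ V) : encircle D c (r • φ) = r • encircle D c φ := by
  simp only [StandardDual.encircle_eq_ptr, Linear.comp_smul, StandardDual.ptr_smul]

theorem encircle_zero {V x z : C} (D : StandardDual V) (c : x ⊗ V ⟶ V ⊗ x) :
    encircle D c (0 : V ⊗ x ⟶ z ⊗ V) = 0 := by
  simp only [StandardDual.encircle_eq_ptr, comp_zero, StandardDual.ptr_zero]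

theorem encircle_sum {V x z : C} (D : StandardDual V) (c : x ⊗ V ⟶ V ⊗ x) {J : Type*}
    (s : Finset J) (φ : J → (V ⊗ x ⟶ z ⊗ V)) :
    encircle D c (∑ j ∈ s, φ j) = ∑ j ∈ s, encircle D c (φ j) := by
  simp only [StandardDual.encircle_eq_ptr, Preadditive.comp_sum, StandardDual.ptr_sum]

theorem encircle_stack (X : Center C) {U V x y z : C} (D : StandardDual U) (E : StandardDual V)
    (m : X.1 ⟶ x) (φ : U ⊗ y ⟶ z ⊗ U) (ψ : V ⊗ x ⟶ y ⊗ V) :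
    encircle (D.tensor E) (X.2.β (U ⊗ V)).hom ((U ⊗ V) ◁ m ≫ stack φ ψ) =
      encircle D (X.2.β U).hom (U ◁ encircle E (X.2.β V).hom (V ◁ m ≫ ψ) ≫ φ) := by
  simp only [StandardDual.encircle_eq_ptr, StandardDual.tensor_ptr, StandardDual.whiskerLeft_ptr]
  rw [StandardDual.ptr_comp, StandardDual.comp_ptr, X.2.monoidal]
  simp only [stack, LinearMap.mk₂_apply]
  congr 2
  simp

end HalfBraidings

section TubeAct

variable {C : Type u} [Category.{v} C] [Abelian C] [Linear ℂ C] [MonoidalCategory C]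
  [MonoidalPreadditive C] [MonoidalLinear ℂ C] [RigidCategory C] [UnitaryFusionCategory C]
  {ι : Type} [Fintype ι] (I : SimpleReps C ι)

theorem Tube.of_apply_self {V : C} (x y : ι) (φ : V ⊗ I.obj x ⟶ I.obj y ⊗ V) (w : ι) :
    Tube.of I x y φ (x, y) w = fuse I w φ := by
  classical
  unfold Tube.of
  convert congrFun (Pi.single_eq_same
    (M := fun p : ι × ι => ∀ v : ι, I.obj v ⊗ I.obj p.1 ⟶ I.obj p.2 ⊗ I.obj v) (x, y) _) w

theorem Tube.of_apply_ne {V : C} (x y : ι) (φ : V ⊗ I.obj x ⟶ I.obj y ⊗ V) {p : ι × ι}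
    (hp : p ≠ (x, y)) (w : ι) : Tube.of I x y φ p w = 0 := by
  classical
  unfold Tube.of
  convert congrFun (Pi.single_eq_of_ne
    (M := fun p : ι × ι => ∀ v : ι, I.obj v ⊗ I.obj p.1 ⟶ I.obj p.2 ⊗ I.obj v) hp _) w
  rfl

theorem Tube.ext' {S T : Tube I} (h : ∀ p w, S p w = T p w) : S = T :=
  funext fun p => funext fun w => h p w

theorem Tube.add_apply (S T : Tube I) (p : ι × ι) (w : ι) : (S + T) p w = S p w + T p w := rfl

theorem Tube.sum_apply {J : Type*} (s : Finset J) (T : J → Tube I) (p : ι × ι) (w : ι) :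
    (∑ j ∈ s, T j) p w = ∑ j ∈ s, T j p w :=
  map_sum (AddMonoidHom.mk' (fun T : Tube I => T p w) fun _ _ => rfl) T s

/-- Annular diagrams as a linear map. -/
def Tube.ofₗ (V : C) (x y : ι) : (V ⊗ I.obj x ⟶ I.obj y ⊗ V) →ₗ[ℂ] Tube I where
  toFun φ := Tube.of I x y φ
  map_add' φ ψ := Tube.ext' I fun p w => by
    by_cases hp : p = (x, y)
    · subst hp
      rw [Tube.add_apply, of_apply_self, of_apply_self, of_apply_self, map_add]
    · rw [Tube.add_apply, of_apply_ne I _ _ _ hp, of_apply_ne I _ _ _ hp, of_apply_ne I _ _ _ hp,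
        add_zero]
  map_smul' c φ := Tube.ext' I fun p w => by
    rw [RingHom.id_apply]
    by_cases hp : p = (x, y)
    · subst hp
      rw [Tube.smul_apply, of_apply_self, of_apply_self, map_smul]
    · rw [Tube.smul_apply, of_apply_ne I _ _ _ hp, of_apply_ne I _ _ _ hp, smul_zero]

theorem fuse_obj_self (v : ι) {x y : C} (φ : I.obj v ⊗ x ⟶ y ⊗ I.obj v) : fuse I v φ = φ := by
  have h (i) : dag ((homONB (I.obj v) (I.obj v)).b i) ▷ x ≫ φ ≫
      y ◁ (homONB (I.obj v) (I.obj v)).b i = scalar ((homONB (I.obj v) (I.obj v)).b i ≫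
        dag ((homONB (I.obj v) (I.obj v)).b i)) • φ := by
    obtain ⟨c, hc⟩ := exists_scalar ((homONB (I.obj v) (I.obj v)).b i)
    have h1 : scalar ((c • 𝟙 (I.obj v)) ≫ dag (c • 𝟙 (I.obj v))) = c * conj c :=
      scalar_unique (by rw [dag_smul, dag_id]; simp [smul_smul, mul_comm])
    rw [← hc, h1, dag_smul, dag_id]
    simp [smul_smul]
  rw [fuse_apply, Finset.sum_congr rfl fun i _ => h i, ← Finset.sum_smul]
  have h2 := (homONB (I.obj v) (I.obj v)).eq_sum (𝟙 _)
  have h3 : ∑ i, scalar ((homONB (I.obj v) (I.obj v)).b i ≫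
      dag ((homONB (I.obj v) (I.obj v)).b i)) = 1 := by
    have h4 : (∑ i, scalar ((homONB (I.obj v) (I.obj v)).b i ≫
      dag ((homONB (I.obj v) (I.obj v)).b i))) • 𝟙 (I.obj v) = 𝟙 (I.obj v) := by
      rw [Finset.sum_smul]
      simp only [scalar_smul_id]
      simpa using h2
    rw [← scalar_unique h4.symm, scalar_unique (one_smul ℂ _).symm]
  rw [h3, one_smul]

theorem fuse_obj_ne {v w : ι} (h : v ≠ w) {x y : C} (φ : I.obj v ⊗ x ⟶ y ⊗ I.obj v) :
    fuse I w φ = 0 := by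
  rw [fuse_apply]
  refine Finset.sum_eq_zero fun i _ => ?_
  rw [I.hom_eq_zero h ((homONB (I.obj v) (I.obj w)).b i)]
  simp

theorem Tube.eq_sum_of (T : Tube I) : T = ∑ x, ∑ y, ∑ v, Tube.of I x y (T (x, y) v) := by
  refine Tube.ext' I ?_
  rintro ⟨x, y⟩ w
  rw [Tube.sum_apply, Finset.sum_eq_single x, Tube.sum_apply, Finset.sum_eq_single y,
    Tube.sum_apply, Finset.sum_eq_single w, Tube.of_apply_self, fuse_obj_self]
  · intro v _ hv
    rw [Tube.of_apply_self, fuse_obj_ne I hv]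
  · simp
  · intro y' _ hy
    rw [Tube.sum_apply]
    exact Finset.sum_eq_zero fun v _ => Tube.of_apply_ne I _ _ _ (by simpa using hy.symm) _
  · simp
  · intro x' _ hx
    rw [Tube.sum_apply]
    refine Finset.sum_eq_zero fun y' _ => ?_
    rw [Tube.sum_apply]
    exact Finset.sum_eq_zero fun v _ => Tube.of_apply_ne I _ _ _ (by simp [hx.symm]) _
  · simp

theorem HSpace.add_apply {X : C} (m n : HSpace I X) (y : ι) : (m + n) y = m y + n y := rfl

theorem HSpace.smul_apply {X : C} (c : ℂ) (m : HSpace I X) (y : ι) : (c • m) y = c • m y := rfl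

theorem HSpace.sum_apply {X : C} {J : Type*} (s : Finset J) (m : J → HSpace I X) (y : ι) :
    (∑ j ∈ s, m j) y = ∑ j ∈ s, m j y :=
  map_sum (AddMonoidHom.mk' (fun m : HSpace I X => m y) fun _ _ => rfl) m s

theorem HSpace.ext {X : C} {m n : HSpace I X} (h : ∀ y, m y = n y) : m = n := funext h

/-- The action of the tube algebra as a bilinear map. -/
def tubeActₗ (X : Center C) : Tube I →ₗ[ℂ] HSpace I X.1 →ₗ[ℂ] HSpace I X.1 :=
  LinearMap.mk₂ ℂ (tubeAct I X)
    (fun S T m => HSpace.ext I fun z => by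
      simp only [tubeAct, HSpace.add_apply, Tube.add_apply, Preadditive.comp_add, encircle_add,
        Finset.sum_add_distrib])
    (fun c T m => HSpace.ext I fun z => by
      simp only [tubeAct, HSpace.smul_apply, Tube.smul_apply, Linear.comp_smul, encircle_smul,
        Finset.smul_sum])
    (fun T m n => HSpace.ext I fun z => by
      simp only [tubeAct, HSpace.add_apply, MonoidalPreadditive.whiskerLeft_add,
        Preadditive.add_comp, encircle_add, Finset.sum_add_distrib])
    (fun c T m => HSpace.ext I fun z => by
      simp only [tubeAct, HSpace.smul_apply, MonoidalLinear.whiskerLeft_smul, Linear.smul_comp,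
        encircle_smul, Finset.smul_sum])

theorem tubeActₗ_apply (X : Center C) (T : Tube I) (m : HSpace I X.1) :
    tubeActₗ I X T m = tubeAct I X T m := rfl

theorem tubeAct_of_self (X : Center C) {V : C} (D : StandardDual V) (x y : ι)
    (φ : V ⊗ I.obj x ⟶ I.obj y ⊗ V) (m : HSpace I X.1) :
    tubeAct I X (Tube.of I x y φ) m y = encircle D (X.2.β V).hom (V ◁ m x ≫ φ) := by
  rw [tubeAct, Finset.sum_eq_single x]
  · simp only [Tube.of_apply_self]
    exact sum_encircle_fuse I X D (m x) φ
  · intro x' _ hx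
    refine Finset.sum_eq_zero fun v _ => ?_
    rw [Tube.of_apply_ne I _ _ _ (by simpa using hx), comp_zero, encircle_zero]
  · simp

theorem tubeAct_of_ne (X : Center C) {V : C} (x y : ι) (φ : V ⊗ I.obj x ⟶ I.obj y ⊗ V)
    (m : HSpace I X.1) {z : ι} (hz : z ≠ y) : tubeAct I X (Tube.of I x y φ) m z = 0 := by
  rw [tubeAct]
  refine Finset.sum_eq_zero fun x' _ => Finset.sum_eq_zero fun v _ => ?_
  rw [Tube.of_apply_ne I _ _ _ (by simp [hz]), comp_zero, encircle_zero]

theorem encircle_unit (X : Center C) {x y : C} (m : X.1 ⟶ x) (f : x ⟶ y) :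
    encircle StandardDual.unit (X.2.β (𝟙_ C)).hom
      (𝟙_ C ◁ m ≫ (λ_ x).hom ≫ f ≫ (ρ_ y).inv) = m ≫ f := by
  rw [StandardDual.encircle_eq_ptr, halfBraiding_unit, ← StandardDual.unit_ptr (m ≫ f)]
  simp

theorem tubeAct_one (X : Center C) (m : HSpace I X.1) : tubeAct I X 1 m = m := by
  classical
  change tubeActₗ I X (∑ x, Tube.of I x x ((λ_ (I.obj x)).hom ≫ (ρ_ (I.obj x)).inv)) m = m
  rw [map_sum, LinearMap.sum_apply]
  refine HSpace.ext I fun z => ?_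
  rw [HSpace.sum_apply, Finset.sum_eq_single z]
  · have := encircle_unit X (m z) (𝟙 _)
    rw [Category.id_comp, Category.comp_id] at this
    rw [tubeActₗ_apply, tubeAct_of_self I X StandardDual.unit, this]
  · intro x _ hx
    exact tubeAct_of_ne I X _ _ _ _ hx.symm
  · simp

theorem tubeAct_mul (X : Center C) (S T : Tube I) (m : HSpace I X.1) :
    tubeAct I X (S * T) m = tubeAct I X S (tubeAct I X T m) := by
  refine HSpace.ext I fun z => ?_
  have h (x y u v) := sum_encircle_fuse I X ((stdDual (I.obj u)).tensor (stdDual (I.obj v)))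
    (m x) (stack (S (y, z) u) (T (x, y) v))
  simp only [encircle_stack] at h
  simp only [tubeAct, Tube.mul_apply, Preadditive.comp_sum, encircle_sum, whiskerLeft_sum,
    Preadditive.sum_comp, ← h]
  calc
    _ = ∑ x, ∑ y, ∑ u, ∑ v, ∑ w, encircle (stdDual (I.obj w)) (X.2.β (I.obj w)).hom
        (I.obj w ◁ m x ≫ fuse I w (stack (S (y, z) u) (T (x, y) v))) := by
      refine Finset.sum_congr rfl fun x _ => ?_
      rw [Finset.sum_comm]
      refine Finset.sum_congr rfl fun y _ => ?_
      rw [Finset.sum_comm]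
      refine Finset.sum_congr rfl fun u _ => ?_
      rw [Finset.sum_comm]
    _ = _ := by
      rw [Finset.sum_comm]
      refine Finset.sum_congr rfl fun y _ => ?_
      rw [Finset.sum_comm]

theorem HSpace.inner_def {X : C} (m n : HSpace I X) :
    inner ℂ m n = ∑ y, (qdim (I.obj y) : ℂ) * scalar (dag (m y) ≫ n y) := rfl

theorem scalar_sum {w : C} [Simple w] {J : Type*} (s : Finset J) (f : J → (w ⟶ w)) :
    scalar (∑ j ∈ s, f j) = ∑ j ∈ s, scalar (f j) :=
  map_sum (AddMonoidHom.mk' (fun g : w ⟶ w => scalar g) scalar_add) f s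

theorem tubeAct_star (X : Center C) (hX : IsUnitary X) (T : Tube I) (h k : HSpace I X.1) :
    inner ℂ (tubeAct I X (star T) h) k = inner ℂ h (tubeAct I X T k) := by
  have key (y z v) : (qdim (I.obj z) : ℂ) * scalar (dag (∑ w, encircle (stdDual (I.obj w))
      (X.2.β (I.obj w)).hom (I.obj w ◁ h y ≫ fuse I w
        (rotDag (stdDual (I.obj v)) (T (z, y) v)))) ≫ k z) =
      qdim (I.obj y) * scalar (dag (h y) ≫ encircle (stdDual (I.obj v)) (X.2.β (I.obj v)).hom
        (I.obj v ◁ k z ≫ T (z, y) v)) := by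
    rw [sum_encircle_fuse I X ((stdDual (I.obj v)).flip I), StandardDual.encircle_eq_ptr,
      StandardDual.encircle_eq_ptr, ← star_pairing I X, StandardDual.dag_ptr]
    simp only [dag_comp, hX _, dag_whiskerLeft, Category.assoc]
  rw [HSpace.inner_def, HSpace.inner_def]
  calc
    _ = ∑ z, ∑ y, ∑ v, (qdim (I.obj z) : ℂ) * scalar (dag (∑ w, encircle (stdDual (I.obj w))
      (X.2.β (I.obj w)).hom (I.obj w ◁ h y ≫ fuse I w
        (rotDag (stdDual (I.obj v)) (T (z, y) v)))) ≫ k z) := by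
      refine Finset.sum_congr rfl fun z _ => ?_
      simp only [tubeAct, Tube.star_apply, Preadditive.comp_sum, encircle_sum, dag_sum,
        Preadditive.sum_comp, scalar_sum, Finset.mul_sum]
      refine Finset.sum_congr rfl fun y _ => ?_
      rw [Finset.sum_comm]
    _ = _ := by
      simp only [key]
      rw [Finset.sum_comm]
      simp only [tubeAct, Preadditive.comp_sum, scalar_sum, Finset.mul_sum]

end TubeAct

section Centralizer

variable {C : Type u} [Category.{v} C] [Abelian C] [Linear ℂ C] [MonoidalCategory C]
  [MonoidalPreadditive C] [MonoidalLinear ℂ C] [RigidCategory C] [UnitaryFusionCategory C]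
  {ι : Type} [Fintype ι] (I : SimpleReps C ι) (A : ObjectProperty (Center C))

theorem double_braiding_eq_id_iff (X a : Center C) :
    (β_ X a).hom ≫ (β_ a X).hom = 𝟙 (X ⊗ a) ↔ (X.2.β a.1).hom = (a.2.β X.1).inv := by
  have h1 : ((β_ X a).hom ≫ (β_ a X).hom).f = (X.2.β a.1).hom ≫ (a.2.β X.1).hom := rfl
  constructor
  · intro h
    have h2 := congrArg Center.Hom.f h
    rw [h1] at h2
    rw [← cancel_mono (a.2.β X.1).hom, Iso.inv_hom_id]
    exact h2
  · intro h
    apply Center.ext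
    rw [h1, h, Iso.inv_hom_id]
    rfl

theorem sameMatrixUnits_iff (X a : Center C) :
    SameMatrixUnits I X a ↔ (X.2.β a.1).hom = (a.2.β X.1).inv := by
  constructor
  · intro h
    have h1 (y z : ι) (m : X.1 ⟶ I.obj y) (n : X.1 ⟶ I.obj z) :
        dag n ▷ a.1 ≫ (X.2.β a.1).hom ≫ a.1 ◁ m = dag n ▷ a.1 ≫ (a.2.β X.1).inv ≫ a.1 ◁ m := by
      refine I.eq_of_comp fun x f => dag_injective (I.eq_of_comp fun x' g => dag_injective ?_)
      by_cases hx : x = x'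
      · subst hx
        simpa [dag_comp, dag_dag] using h x y z m n f g
      · rw [dag_comp, dag_dag, dag_comp, dag_dag, I.hom_eq_zero (Ne.symm hx) (dag g ≫ _ ≫ f),
          I.hom_eq_zero (Ne.symm hx) (dag g ≫ _ ≫ f)]
    have h2 : 𝟙 X.1 ▷ a.1 ≫ (X.2.β a.1).hom ≫ a.1 ◁ 𝟙 X.1 =
        𝟙 X.1 ▷ a.1 ≫ (a.2.β X.1).inv ≫ a.1 ◁ 𝟙 X.1 := by
      rw [← (I.decomp X.1).total]
      simp only [sum_whiskerRight, whiskerLeft_sum, Preadditive.sum_comp, Preadditive.comp_sum,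
        comp_whiskerRight, MonoidalCategory.whiskerLeft_comp, Category.assoc]
      refine Finset.sum_congr rfl fun k _ => Finset.sum_congr rfl fun l _ => ?_
      have h3 := h1 k.1 l.1 ((I.decomp X.1).p k) ((I.decomp X.1).p l)
      have h4 := congrArg (fun t => (I.decomp X.1).p l ▷ a.1 ≫ t ≫
        a.1 ◁ dag ((I.decomp X.1).p k)) h3
      simpa only [Category.assoc] using h4
    simpa using h2
  · intro h x y z m n f g
    rw [h]

theorem halfBraiding_inv_naturality (X : Center C) {U U' : C} (f : U ⟶ U') :
    f ▷ X.1 ≫ (X.2.β U').inv = (X.2.β U).inv ≫ X.1 ◁ f := by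
  rw [Iso.comp_inv_eq, Category.assoc, X.2.naturality, Iso.inv_hom_id_assoc]

theorem comp_encircle_inv (a : Center C) (D : StandardDual a.1) {X x y : C} (m : X ⟶ x)
    (φ : a.1 ⊗ x ⟶ y ⊗ a.1) :
    m ≫ encircle D (a.2.β x).inv φ = encircle D (a.2.β X).inv (a.1 ◁ m ≫ φ) := by
  rw [StandardDual.encircle_eq_ptr, StandardDual.encircle_eq_ptr, StandardDual.comp_ptr,
    ← Category.assoc, halfBraiding_inv_naturality, Category.assoc]

/-- Two crossings which agree when closed up against all simple objects are equal. -/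
theorem crossing_eq_of_encircle {X V : C} (D : StandardDual V) {c c' : X ⊗ V ⟶ V ⊗ X}
    (h : ∀ (x y : ι) (m : X ⟶ I.obj x) (φ : V ⊗ I.obj x ⟶ I.obj y ⊗ V),
      encircle D c (V ◁ m ≫ φ) = encircle D c' (V ◁ m ≫ φ)) : c = c' := by
  refine D.eq_of_ptr_comp_eq fun z φ => I.eq_of_comp fun y g => ?_
  rw [StandardDual.ptr_comp, StandardDual.ptr_comp]
  have h1 : V ◁ 𝟙 X ≫ φ ≫ g ▷ V = ∑ k, V ◁ (I.decomp X).p k ≫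
      (V ◁ dag ((I.decomp X).p k) ≫ φ ≫ g ▷ V) := by
    rw [← (I.decomp X).total, whiskerLeft_sum, Preadditive.sum_comp]
    simp
  have h2 (c : X ⊗ V ⟶ V ⊗ X) : D.ptr ((c ≫ φ) ≫ g ▷ V) =
      ∑ k, encircle D c (V ◁ (I.decomp X).p k ≫
      (V ◁ dag ((I.decomp X).p k) ≫ φ ≫ g ▷ V)) := by
    rw [← encircle_sum, ← h1, StandardDual.encircle_eq_ptr]
    simp
  rw [h2, h2]
  exact Finset.sum_congr rfl fun k _ => h _ _ _ _

theorem tubeAct_star_eq_zero (X : Center C) (hX : IsUnitary X) (T : Tube I)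
    (hT : ∀ m, tubeAct I X T m = 0) (m : HSpace I X.1) : tubeAct I X (star T) m = 0 := by
  rw [← inner_self_eq_zero (𝕜 := ℂ), tubeAct_star I X hX, hT, inner_zero_right]

/-- The kernel of the action on `H_X`. -/
theorem isStarIdeal_ker (X : Center C) (hX : IsUnitary X) :
    IsStarIdeal I (LinearMap.ker (tubeActₗ I X)) where
  mul_left s t ht := by
    refine LinearMap.ext fun m => ?_
    rw [tubeActₗ_apply, tubeAct_mul, ← tubeActₗ_apply I X t, LinearMap.mem_ker.1 ht]
    exact map_zero (tubeActₗ I X s)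
  mul_right s t ht := by
    refine LinearMap.ext fun m => ?_
    rw [tubeActₗ_apply, tubeAct_mul, ← tubeActₗ_apply I X t, LinearMap.mem_ker.1 ht]
    rfl
  star_mem t ht := by
    refine LinearMap.ext fun m => ?_
    exact tubeAct_star_eq_zero I X hX t (fun m => DFunLike.congr_fun (LinearMap.mem_ker.1 ht) m) m

theorem tubeAct_of_unit (X : Center C) (x y : ι) (f : I.obj x ⟶ I.obj y) (m : HSpace I X.1) :
    tubeAct I X (Tube.of I x y ((λ_ (I.obj x)).hom ≫ f ≫ (ρ_ (I.obj y)).inv)) m y = m x ≫ f := by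
  rw [tubeAct_of_self I X StandardDual.unit, encircle_unit]

theorem domeRelations_subset_domeIdeal : domeRelations I A ⊆ domeIdeal I A := by
  intro t ht
  rw [domeIdeal, SetLike.mem_coe, Submodule.mem_sInf]
  exact fun J hJ => hJ.2 ht

/-- The representation on `H_X` factors through the dome algebra if the crossings of `X` with the
objects of `A` are symmetric. -/
theorem domeIdeal_le_ker (X : Center C) (hX : IsUnitary X)
    (h : ∀ a, A a → (X.2.β a.1).hom = (a.2.β X.1).inv) :
    domeIdeal I A ≤ LinearMap.ker (tubeActₗ I X) := by
  refine sInf_le ⟨isStarIdeal_ker I X hX, ?_⟩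
  rintro _ ⟨a, ha, D, x, y, φ, rfl⟩
  refine LinearMap.ext fun m => HSpace.ext I fun z => ?_
  rw [map_sub]
  change tubeAct I X _ m z - tubeAct I X _ m z = 0
  by_cases hz : z = y
  · subst hz
    rw [tubeAct_of_unit, tubeAct_of_self I X D, h a ha, comp_encircle_inv, sub_self]
  · rw [tubeAct_of_ne I X _ _ _ _ hz, tubeAct_of_ne I X _ _ _ _ hz, sub_self]

/-- The descended representation on `H_X`. -/
def domeAct (X : Center C) (h : domeIdeal I A ≤ LinearMap.ker (tubeActₗ I X)) :
    Dome I A →ₗ[ℂ] HSpace I X.1 →ₗ[ℂ] HSpace I X.1 :=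
  (domeIdeal I A).liftQ (tubeActₗ I X) h

theorem domeAct_mk (X : Center C) (h : domeIdeal I A ≤ LinearMap.ker (tubeActₗ I X)) (t : Tube I)
    (m : HSpace I X.1) : domeAct I A X h (Dome.mk I A t) m = tubeAct I X t m := rfl

theorem Dome.mk_surjective (t : Dome I A) : ∃ s, Dome.mk I A s = t :=
  (domeIdeal I A).mkQ_surjective t

theorem isStarRep_domeAct (X : Center C) (hX : IsUnitary X)
    (h : domeIdeal I A ≤ LinearMap.ker (tubeActₗ I X)) : IsStarRep (domeAct I A X h) where
  map_one := LinearMap.ext fun m => tubeAct_one I X m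
  map_mul s t := by
    obtain ⟨s, rfl⟩ := Dome.mk_surjective I A s
    obtain ⟨t, rfl⟩ := Dome.mk_surjective I A t
    exact LinearMap.ext fun m => tubeAct_mul I X s t m
  map_star t m n := by
    obtain ⟨t, rfl⟩ := Dome.mk_surjective I A t
    exact tubeAct_star I X hX t m n

theorem crossing_eq_of_descends (X : Center C) (h : Descends I A X) (a : Center C) (ha : A a) :
    (X.2.β a.1).hom = (a.2.β X.1).inv := by
  obtain ⟨π, -, hπ⟩ := h
  obtain ⟨D⟩ := exists_standardDual I a.1
  refine crossing_eq_of_encircle I D fun x y m φ => ?_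
  classical
  let m' : HSpace I X.1 := fun z => if hz : z = x then m ≫ eqToHom (by rw [hz]) else 0
  have hm' : m' x = m := by simp [m']
  have h1 : Dome.mk I A (Tube.of I x y φ - Tube.of I x y ((λ_ (I.obj x)).hom ≫
      encircle D (a.2.β (I.obj x)).inv φ ≫ (ρ_ (I.obj y)).inv)) = 0 :=
    (Submodule.Quotient.mk_eq_zero _).2
      (domeRelations_subset_domeIdeal I A ⟨a, ha, D, x, y, φ, rfl⟩)
  have h2 := hπ (Tube.of I x y φ - Tube.of I x y ((λ_ (I.obj x)).hom ≫
      encircle D (a.2.β (I.obj x)).inv φ ≫ (ρ_ (I.obj y)).inv)) m'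
  rw [h1, map_zero] at h2
  have h3 := congrFun h2 y
  rw [← tubeActₗ_apply, map_sub] at h3
  change 0 = tubeAct I X _ m' y - tubeAct I X _ m' y at h3
  rw [tubeAct_of_unit, tubeAct_of_self I X D, comp_encircle_inv, hm'] at h3
  exact (sub_eq_zero.1 h3.symm)

theorem enrichedCenter_iff (X : Center C) (hX : IsUnitary X) :
    enrichedCenter A X ↔ ∀ a, A a → (X.2.β a.1).hom = (a.2.β X.1).inv := by
  simp only [enrichedCenter, double_braiding_eq_id_iff, hX, true_and]

theorem enrichedCenter_tfae (X : Center C) (hX : IsUnitary X) :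
    List.TFAE [enrichedCenter A X, ∀ a : Center C, A a → (X.2.β a.1).hom = (a.2.β X.1).inv,
      ∀ a : Center C, A a → SameMatrixUnits I X a, Descends I A X] := by
  tfae_have 1 ↔ 2 := enrichedCenter_iff A X hX
  tfae_have 2 ↔ 3 := by simp only [sameMatrixUnits_iff]
  tfae_have 2 → 4 := fun h => ⟨domeAct I A X (domeIdeal_le_ker I A X hX h),
    isStarRep_domeAct I A X hX _, domeAct_mk I A X _⟩
  tfae_have 4 → 2 := crossing_eq_of_descends I A X
  tfae_finish

end Centralizer

section Functor

variable {C : Type u} [Category.{v} C] [Abelian C] [Linear ℂ C] [MonoidalCategory C]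
  [MonoidalPreadditive C] [MonoidalLinear ℂ C] [RigidCategory C] [UnitaryFusionCategory C]
  {ι : Type} [Fintype ι] (I : SimpleReps C ι) (A : ObjectProperty (Center C))

theorem domeIdeal_le_ker_of_mem (X : Center C) (hX : enrichedCenter A X) :
    domeIdeal I A ≤ LinearMap.ker (tubeActₗ I X) :=
  domeIdeal_le_ker I A X hX.1 ((enrichedCenter_iff A X hX.1).1 hX)

/-- The representation `H_X` of the dome algebra. -/
def hRep (X : Center C) (hX : enrichedCenter A X) : StarRep (Dome I A) where
  H := HSpace I X.1
  π := domeAct I A X (domeIdeal_le_ker_of_mem I A X hX)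
  isStarRep := isStarRep_domeAct I A X hX.1 _

/-- Precomposition as a linear map. -/
def HSpace.precomp {X Y : C} (f : X ⟶ Y) : HSpace I Y →ₗ[ℂ] HSpace I X where
  toFun m y := f ≫ m y
  map_add' m n := HSpace.ext I fun y => by
    change f ≫ (m y + n y) = f ≫ m y + f ≫ n y
    simp
  map_smul' c m := HSpace.ext I fun y => by
    change f ≫ (c • m y) = c • (f ≫ m y)
    simp

theorem HSpace.precomp_apply {X Y : C} (f : X ⟶ Y) (m : HSpace I Y) (y : ι) :
    HSpace.precomp I f m y = f ≫ m y := rfl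

theorem tubeAct_precomp {X Y : Center C} (f : X ⟶ Y) (T : Tube I) (m : HSpace I Y.1) :
    tubeAct I X T (HSpace.precomp I f.f m) = HSpace.precomp I f.f (tubeAct I Y T m) := by
  refine HSpace.ext I fun z => ?_
  rw [HSpace.precomp_apply, tubeAct, tubeAct]
  simp only [Preadditive.comp_sum]
  refine Finset.sum_congr rfl fun y _ => Finset.sum_congr rfl fun v _ => ?_
  rw [StandardDual.encircle_eq_ptr, StandardDual.encircle_eq_ptr, StandardDual.comp_ptr,
    ← Category.assoc (f.f ▷ _), f.comm, HSpace.precomp_apply]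
  simp

/-- The functor `X ↦ H_X`. -/
def hFunctor : (enrichedCenter A).FullSubcategoryᵒᵖ ⥤ StarRep (Dome I A) where
  obj X := hRep I A X.unop.obj X.unop.property
  map {X Y} f :=
    { lin := HSpace.precomp I f.unop.hom.f
      comm := fun t h => by
        obtain ⟨t, rfl⟩ := Dome.mk_surjective I A t
        exact (tubeAct_precomp I f.unop.hom t h).symm }
  map_id X := StarRep.Hom.ext (LinearMap.ext fun m => HSpace.ext I fun y => Category.id_comp _)
  map_comp f g := StarRep.Hom.ext (LinearMap.ext fun m => HSpace.ext I fun y =>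
    Category.assoc _ _ _)

theorem isHFunctor_hFunctor : IsHFunctor I A (hFunctor I A) :=
  ⟨fun X => LinearIsometryEquiv.refl ℂ _, fun _ _ _ => rfl, fun _ _ _ _ _ => rfl⟩

instance : (hFunctor I A).Faithful where
  map_injective {X Y} f g h := by
    have h1 : f.unop.hom.f = g.unop.hom.f := by
      refine I.eq_of_comp fun i k => ?_
      classical
      let m : HSpace I X.unop.obj.1 :=
        fun z => if hz : z = i then k ≫ eqToHom (by rw [hz]) else 0
      have hm : m i = k := by simp [m]
      have h2 := congrFun (LinearMap.congr_fun (congrArg StarRep.Hom.lin h) m) i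
      change f.unop.hom.f ≫ m i = g.unop.hom.f ≫ m i at h2
      rwa [hm] at h2
    apply Quiver.Hom.unop_inj
    apply ObjectProperty.hom_ext
    exact Center.ext _ _ h1

/-- The element of `H_X` with the single component `m`. -/
def HSpace.single {X : C} (x : ι) : (X ⟶ I.obj x) →ₗ[ℂ] HSpace I X :=
  open Classical in LinearMap.single ℂ (fun y : ι => X ⟶ I.obj y) x

theorem HSpace.single_self {X : C} (x : ι) (m : X ⟶ I.obj x) : HSpace.single I x m x = m := by
  classical
  unfold HSpace.single
  convert Pi.single_eq_same (M := fun y : ι => X ⟶ I.obj y) x m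
  rfl

theorem HSpace.single_ne {X : C} {x y : ι} (h : y ≠ x) (m : X ⟶ I.obj x) :
    HSpace.single I x m y = 0 := by
  classical
  unfold HSpace.single
  convert Pi.single_eq_of_ne (M := fun y : ι => X ⟶ I.obj y) h m
  rfl

theorem HSpace.sum_single {X : C} (m : HSpace I X) : ∑ x, HSpace.single I x (m x) = m := by
  refine HSpace.ext I fun y => ?_
  rw [HSpace.sum_apply, Finset.sum_eq_single y, HSpace.single_self]
  · intro x _ hx
    exact HSpace.single_ne I hx.symm _
  · simp

/-- The projection of the tube algebra corresponding to a simple object. -/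
def Tube.proj (x : ι) : Tube I := Tube.of I x x ((λ_ (I.obj x)).hom ≫ (ρ_ (I.obj x)).inv)

theorem tubeAct_proj (X : Center C) (x : ι) (m : HSpace I X.1) :
    tubeAct I X (Tube.proj I x) m = HSpace.single I x (m x) := by
  refine HSpace.ext I fun y => ?_
  by_cases hy : y = x
  · subst hy
    have := tubeAct_of_unit I X y y (𝟙 _) m
    rw [Category.id_comp, Category.comp_id] at this
    rw [HSpace.single_self, Tube.proj, this]
  · rw [HSpace.single_ne I hy, Tube.proj, tubeAct_of_ne I X _ _ _ _ hy]

/-- A linear map compatible with the gradings is given by precomposition. -/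
theorem exists_precomp {X Y : C} (T : HSpace I Y →ₗ[ℂ] HSpace I X)
    (hT : ∀ x m, T (HSpace.single I x (m x)) = HSpace.single I x (T m x)) :
    ∃ f : X ⟶ Y, T = HSpace.precomp I f := by
  refine ⟨∑ k, T (HSpace.single I k.1 ((I.decomp Y).p k)) k.1 ≫ dag ((I.decomp Y).p k), ?_⟩
  have h1 (x : ι) (m : Y ⟶ I.obj x) : T (HSpace.single I x m) =
      HSpace.single I x (T (HSpace.single I x m) x) := by
    have := hT x (HSpace.single I x m)
    rwa [HSpace.single_self] at this
  refine LinearMap.ext fun m => ?_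
  rw [← HSpace.sum_single I m, map_sum, map_sum]
  refine Finset.sum_congr rfl fun x _ => HSpace.ext I fun y => ?_
  change _ = _ ≫ HSpace.single I x (m x) y
  by_cases hy : y = x
  · subst hy
    rw [HSpace.single_self, Preadditive.sum_comp]
    conv_lhs => rw [(I.decomp Y).expand_left (m y)]
    rw [map_sum, map_sum, HSpace.sum_apply]
    refine Finset.sum_congr rfl fun k _ => ?_
    rcases k with ⟨i, k⟩
    by_cases hi : i = y
    · subst hi
      obtain ⟨c, hc⟩ := exists_scalar (dag ((I.decomp Y).p ⟨i, k⟩) ≫ m i)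
      rw [Category.assoc, ← hc]
      simp only [Linear.comp_smul, map_smul, HSpace.smul_apply, Category.comp_id]
    · rw [I.hom_eq_zero hi (dag ((I.decomp Y).p ⟨i, k⟩) ≫ m y), Category.assoc,
        I.hom_eq_zero hi (dag ((I.decomp Y).p ⟨i, k⟩) ≫ m y)]
      simp only [comp_zero, map_zero]
      rfl
  · rw [HSpace.single_ne I hy, comp_zero, h1, HSpace.single_ne I hy]

/-- Intertwiners between the representations `H_X` come from morphisms of the center. -/
theorem center_comm_of_precomp {X Y : Center C} (f : X.1 ⟶ Y.1)
    (h : ∀ (T : Tube I) (m : HSpace I Y.1),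
      HSpace.precomp I f (tubeAct I Y T m) = tubeAct I X T (HSpace.precomp I f m)) (U : C) :
    f ▷ U ≫ (Y.2.β U).hom = (X.2.β U).hom ≫ U ◁ f := by
  obtain ⟨D⟩ := exists_standardDual I U
  refine D.eq_of_ptr_comp_eq fun z φ => I.eq_of_comp fun y g => ?_
  rw [StandardDual.ptr_comp, StandardDual.ptr_comp]
  have h1 : φ ≫ g ▷ U = ∑ k, U ◁ (I.decomp Y.1).p k ≫
      (U ◁ dag ((I.decomp Y.1).p k) ≫ φ ≫ g ▷ U) := by
    have : φ ≫ g ▷ U = U ◁ 𝟙 Y.1 ≫ φ ≫ g ▷ U := by simp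
    rw [← (I.decomp Y.1).total, whiskerLeft_sum, Preadditive.sum_comp] at this
    simpa only [MonoidalCategory.whiskerLeft_comp, Category.assoc] using this
  rw [Category.assoc, Category.assoc, Category.assoc, Category.assoc, h1]
  simp only [Preadditive.comp_sum, StandardDual.ptr_sum, Category.assoc]
  refine Finset.sum_congr rfl fun k _ => ?_
  have h2 := congrFun (h (Tube.of I k.1 y (U ◁ dag ((I.decomp Y.1).p k) ≫ φ ≫ g ▷ U))
    (HSpace.single I k.1 ((I.decomp Y.1).p k))) y
  change f ≫ tubeAct I Y _ _ y = _ at h2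
  rw [tubeAct_of_self I Y D, tubeAct_of_self I X D] at h2
  change _ = encircle D _ (U ◁ (f ≫ HSpace.single I k.1 _ k.1) ≫ _) at h2
  rw [HSpace.single_self, StandardDual.encircle_eq_ptr, StandardDual.encircle_eq_ptr,
    StandardDual.comp_ptr] at h2
  simpa using h2

instance : (hFunctor I A).Full where
  map_surjective {X Y} T := by
    have hT (t : Tube I) (m : HSpace I X.unop.obj.1) :
        T.lin (tubeAct I X.unop.obj t m) = tubeAct I Y.unop.obj t (T.lin m) :=
      T.comm (Dome.mk I A t) m
    obtain ⟨f, hf⟩ := exists_precomp I (X := Y.unop.obj.1) (Y := X.unop.obj.1) T.lin (fun x m => by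
      have := hT (Tube.proj I x) m
      rw [tubeAct_proj] at this
      exact this.trans (tubeAct_proj I Y.unop.obj x (T.lin m)))
    have hf' := center_comm_of_precomp I (X := Y.unop.obj) (Y := X.unop.obj) f (fun t m => by
      rw [← hf]
      exact hT t m)
    exact ⟨Quiver.Hom.op (ObjectProperty.homMk ⟨f, hf'⟩), StarRep.Hom.ext hf.symm⟩

end Functor

section TubeAlgebra

variable {C : Type u} [Category.{v} C] [Abelian C] [Linear ℂ C] [MonoidalCategory C]
  [MonoidalPreadditive C] [MonoidalLinear ℂ C] [RigidCategory C] [UnitaryFusionCategory C]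
  {ι : Type} [Fintype ι] (I : SimpleReps C ι)

/-- Annular diagrams are invariant under rotation. -/
theorem fuse_cyclic {V V' x y : C} (b : V ⟶ V') (φ : V' ⊗ x ⟶ y ⊗ V) (w : ι) :
    fuse I w (b ▷ x ≫ φ) = fuse I w (φ ≫ y ◁ b) := by
  set B := homONB V (I.obj w)
  set B' := homONB V' (I.obj w)
  have h1 (i) : dag (B.b i) ≫ b = ∑ j, scalar (dag (B.b i) ≫ b ≫ B'.b j) • dag (B'.b j) := by
    have h2 := congrArg dag (B'.eq_sum (dag b ≫ B.b i))
    rw [dag_sum] at h2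
    simp only [dag_comp, dag_dag, Category.assoc] at h2
    rw [← h2]
    refine Finset.sum_congr rfl fun j _ => ?_
    have h3 : dag (B.b i) ≫ b ≫ B'.b j ≫ dag (B'.b j) =
      (dag (B.b i) ≫ b ≫ B'.b j) ≫ dag (B'.b j) := by simp
    rw [h3]
    conv_lhs => rw [← scalar_smul_id (dag (B.b i) ≫ b ≫ B'.b j)]
    simp
  have h1' (j) : b ≫ B'.b j = ∑ i, scalar (dag (B.b i) ≫ b ≫ B'.b j) • B.b i := by
    conv_lhs => rw [← B.eq_sum (b ≫ B'.b j)]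
    refine Finset.sum_congr rfl fun i _ => ?_
    rw [Category.assoc]
    conv_lhs => rw [← scalar_smul_id (dag (B.b i) ≫ b ≫ B'.b j)]
    simp
  have hsum {J : Type} [Fintype J] {P Q : C} (f : J → (P ⟶ Q)) (R : C) :
      (∑ j, f j) ▷ R = ∑ j, f j ▷ R := sum_whiskerRight _ _ _
  rw [fuse_apply, fuse_apply]
  have hl (i) : dag (B.b i) ▷ x ≫ (b ▷ x ≫ φ) ≫ y ◁ B.b i =
      ∑ j, scalar (dag (B.b i) ≫ b ≫ B'.b j) • (dag (B'.b j) ▷ x ≫ φ ≫ y ◁ B.b i) := by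
    rw [Category.assoc, ← comp_whiskerRight_assoc, h1, hsum, Preadditive.sum_comp]
    simp
  have hr (j) : dag (B'.b j) ▷ x ≫ (φ ≫ y ◁ b) ≫ y ◁ B'.b j =
      ∑ i, scalar (dag (B.b i) ≫ b ≫ B'.b j) • (dag (B'.b j) ▷ x ≫ φ ≫ y ◁ B.b i) := by
    rw [Category.assoc, ← MonoidalCategory.whiskerLeft_comp]
    conv_lhs => rw [h1', whiskerLeft_sum, Preadditive.comp_sum, Preadditive.comp_sum]
    simp
  rw [Finset.sum_congr rfl fun i _ => hl i, Finset.sum_congr rfl fun j _ => hr j,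
    Finset.sum_comm]

theorem Tube.of_cyclic {V V' : C} {x y : ι} (b : V ⟶ V') (φ : V' ⊗ I.obj x ⟶ I.obj y ⊗ V) :
    Tube.of I x y (b ▷ I.obj x ≫ φ) = Tube.of I x y (φ ≫ I.obj y ◁ b) := by
  refine Tube.ext' I fun p w => ?_
  by_cases hp : p = (x, y)
  · subst hp
    rw [Tube.of_apply_self, Tube.of_apply_self, fuse_cyclic]
  · rw [Tube.of_apply_ne I _ _ _ hp, Tube.of_apply_ne I _ _ _ hp]

theorem stack_apply {U V x y z : C} (φ : U ⊗ y ⟶ z ⊗ U) (ψ : V ⊗ x ⟶ y ⊗ V) :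
    stack φ ψ = (α_ U V x).hom ≫ U ◁ ψ ≫ (α_ U y V).inv ≫ φ ▷ V ≫ (α_ z U V).hom := rfl

theorem sum_fuse_stack_fuse {U V x y z : C} (φ : U ⊗ y ⟶ z ⊗ U) (ψ : V ⊗ x ⟶ y ⊗ V) (w : ι) :
    ∑ u, ∑ v, fuse I w (stack (fuse I u φ) (fuse I v ψ)) = fuse I w (stack φ ψ) := by
  have h1 {U' V' : C} (b : U ⟶ U') (c : V ⟶ V') :
      stack (dag b ▷ y ≫ φ ≫ z ◁ b) (dag c ▷ x ≫ ψ ≫ y ◁ c) =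
      (dag b ▷ V' ≫ U ◁ dag c) ▷ x ≫ stack φ ψ ≫ z ◁ (U ◁ c ≫ b ▷ V') := by
    simp only [stack_apply]
    calc
      _ = 𝟙 _ ⊗≫ U' ◁ (dag c ▷ x ≫ ψ) ⊗≫ ((U' ⊗ y) ◁ c ≫ (dag b ▷ y ≫ φ) ▷ V') ⊗≫
          z ◁ b ▷ V' ⊗≫ 𝟙 _ := by monoidal
      _ = 𝟙 _ ⊗≫ (U' ◁ (dag c ▷ x ≫ ψ) ≫ dag b ▷ (y ⊗ V)) ⊗≫ φ ▷ V ⊗≫ z ◁ U ◁ c ⊗≫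
          z ◁ b ▷ V' ⊗≫ 𝟙 _ := by rw [whisker_exchange]; monoidal
      _ = _ := by rw [whisker_exchange]; monoidal
  have h2 {U' V' : C} (b : U ⟶ U') (c : V ⟶ V') :
      fuse I w (stack (dag b ▷ y ≫ φ ≫ z ◁ b) (dag c ▷ x ≫ ψ ≫ y ◁ c)) =
      fuse I w (stack φ ψ ≫ z ◁ (U ◁ (c ≫ dag c) ≫ (b ≫ dag b) ▷ V)) := by
    rw [h1, fuse_cyclic, Category.assoc, ← MonoidalCategory.whiskerLeft_comp]
    congr 3
    rw [Category.assoc, ← comp_whiskerRight_assoc, whisker_exchange_assoc,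
      ← MonoidalCategory.whiskerLeft_comp, whisker_exchange]
  have h5 (u v : ι) : fuse I w (stack (fuse I u φ) (fuse I v ψ)) = ∑ i, ∑ j,
      fuse I w (stack φ ψ ≫ z ◁ (U ◁ ((homONB V (I.obj v)).b j ≫ dag ((homONB V (I.obj v)).b j)) ≫
        ((homONB U (I.obj u)).b i ≫ dag ((homONB U (I.obj u)).b i)) ▷ V)) := by
    rw [fuse_apply I u φ, fuse_apply I v ψ, map_sum, map_sum, Finset.sum_comm]
    refine Finset.sum_congr rfl fun j _ => ?_
    rw [map_sum, LinearMap.sum_apply, map_sum]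
    exact Finset.sum_congr rfl fun i _ => h2 _ _
  have h3 (u : ι) (i : Fin (homONB U (I.obj u)).n) : ∑ v, ∑ j,
      fuse I w (stack φ ψ ≫ z ◁ (U ◁ ((homONB V (I.obj v)).b j ≫ dag ((homONB V (I.obj v)).b j)) ≫
        ((homONB U (I.obj u)).b i ≫ dag ((homONB U (I.obj u)).b i)) ▷ V)) =
      fuse I w (stack φ ψ ≫ z ◁ (((homONB U (I.obj u)).b i ≫
        dag ((homONB U (I.obj u)).b i)) ▷ V)) := by
    simp only [← map_sum, ← Preadditive.comp_sum, ← whiskerLeft_sum, ← Preadditive.sum_comp,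
      I.total]
    simp
  have h4 : ∑ u, ∑ i, fuse I w (stack φ ψ ≫ z ◁ (((homONB U (I.obj u)).b i ≫
        dag ((homONB U (I.obj u)).b i)) ▷ V)) = fuse I w (stack φ ψ) := by
    simp only [← map_sum, ← Preadditive.comp_sum, ← whiskerLeft_sum, ← sum_whiskerRight, I.total]
    simp
  rw [← h4]
  refine Finset.sum_congr rfl fun u _ => ?_
  simp only [← h3, h5]
  rw [Finset.sum_comm]

theorem Tube.of_mul_of {U V : C} {x y z : ι} (φ : U ⊗ I.obj y ⟶ I.obj z ⊗ U)
    (ψ : V ⊗ I.obj x ⟶ I.obj y ⊗ V) :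
    Tube.of I y z φ * Tube.of I x y ψ = Tube.of I x z (stack φ ψ) := by
  refine Tube.ext' I fun p w => ?_
  rw [Tube.mul_apply]
  by_cases hp : p = (x, z)
  · subst hp
    rw [Finset.sum_eq_single y]
    · simp only [Tube.of_apply_self, sum_fuse_stack_fuse]
    · intro y' _ hy
      refine Finset.sum_eq_zero fun u _ => Finset.sum_eq_zero fun v _ => ?_
      rw [Tube.of_apply_ne I y z φ (by simp [hy]), map_zero, LinearMap.zero_apply, map_zero]
    · simp
  · rw [Tube.of_apply_ne I _ _ _ hp]
    refine Finset.sum_eq_zero fun y' _ => Finset.sum_eq_zero fun u _ =>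
      Finset.sum_eq_zero fun v _ => ?_
    by_cases h1 : p.1 = x
    · have h2 : p.2 ≠ z := fun h2 => hp (Prod.ext h1 h2)
      rw [Tube.of_apply_ne I y z φ (by simp [h2]), map_zero, LinearMap.zero_apply, map_zero]
    · rw [Tube.of_apply_ne I x y ψ (by simp [h1]), map_zero, map_zero]

theorem Tube.of_mul_of_ne {U V : C} {x y y' z : ι} (h : y ≠ y') (φ : U ⊗ I.obj y ⟶ I.obj z ⊗ U)
    (ψ : V ⊗ I.obj x ⟶ I.obj y' ⊗ V) :
    Tube.of I y z φ * Tube.of I x y' ψ = 0 := by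
  refine Tube.ext' I fun p w => ?_
  rw [Tube.mul_apply]
  refine Finset.sum_eq_zero fun t _ => Finset.sum_eq_zero fun u _ =>
      Finset.sum_eq_zero fun v _ => ?_
  by_cases h1 : t = y
  · rw [Tube.of_apply_ne I x y' ψ (by simp [h1, h]), map_zero, map_zero]
  · rw [Tube.of_apply_ne I y z φ (by simp [h1]), map_zero, LinearMap.zero_apply, map_zero]

theorem rotDag_conj {V W x y : C} (D : StandardDual V) (E : StandardDual W) (b : V ⟶ W)
    (φ : V ⊗ x ⟶ y ⊗ V) : rotDag E (dag b ▷ x ≫ φ ≫ y ◁ b) =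
      StandardDual.rt D E b ▷ y ≫ rotDag D φ ≫ x ◁ StandardDual.rt E D (dag b) := by
  simp only [rotDag, dag_comp, dag_whiskerLeft, dag_whiskerRight, dag_dag]
  calc
    _ = 𝟙 _ ⊗≫ E.bar ◁ y ◁ (E.Rbar ≫ dag b ▷ E.bar) ⊗≫ E.bar ◁ dag φ ▷ E.bar ⊗≫
        (E.bar ◁ b ≫ dag E.R) ▷ (x ⊗ E.bar) ⊗≫ 𝟙 _ := by monoidal
    _ = 𝟙 _ ⊗≫ E.bar ◁ y ◁ D.Rbar ⊗≫ E.bar ◁ ((y ⊗ V) ◁ StandardDual.rt E D (dag b) ≫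
        dag φ ▷ E.bar) ⊗≫ StandardDual.rt D E b ▷ V ▷ x ▷ E.bar ⊗≫ dag D.R ▷ (x ⊗ E.bar) ⊗≫
          𝟙 _ := by
      rw [StandardDual.Rbar_comp E D, StandardDual.whiskerLeft_comp_dag_R E D]; monoidal
    _ = 𝟙 _ ⊗≫ (E.bar ◁ (y ◁ D.Rbar ⊗≫ dag φ ▷ D.bar ⊗≫ V ◁ x ◁ StandardDual.rt E D (dag b)) ≫
        StandardDual.rt D E b ▷ (V ⊗ x ⊗ E.bar)) ⊗≫ dag D.R ▷ (x ⊗ E.bar) ⊗≫ 𝟙 _ := by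
      rw [whisker_exchange]; monoidal
    _ = 𝟙 _ ⊗≫ StandardDual.rt D E b ▷ y ⊗≫ D.bar ◁ y ◁ D.Rbar ⊗≫ D.bar ◁ dag φ ▷ D.bar ⊗≫
        ((D.bar ⊗ V) ◁ x ◁ StandardDual.rt E D (dag b) ≫ dag D.R ▷ (x ⊗ E.bar)) ⊗≫ 𝟙 _ := by
      rw [whisker_exchange]; monoidal
    _ = _ := by rw [whisker_exchange]; monoidal

theorem sum_fuse_rotDag_fuse {V x y : C} (D : StandardDual V) (φ : V ⊗ x ⟶ y ⊗ V) (w : ι) :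
    ∑ v, fuse I w (rotDag (stdDual (I.obj v)) (fuse I v φ)) = fuse I w (rotDag D φ) := by
  have hadd {V x y : C} (D : StandardDual V) {J : Type} [Fintype J]
      (f : J → (V ⊗ x ⟶ y ⊗ V)) : rotDag D (∑ j, f j) = ∑ j, rotDag D (f j) :=
    map_sum (AddMonoidHom.ofMapSub (rotDag D) (rotDag_sub D)) f _
  have h (v : ι) : fuse I w (rotDag (stdDual (I.obj v)) (fuse I v φ)) =
      ∑ i, fuse I w (rotDag D φ ≫ x ◁ StandardDual.rt D D
        ((homONB V (I.obj v)).b i ≫ dag ((homONB V (I.obj v)).b i))) := by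
    rw [fuse_apply I v, hadd, map_sum]
    refine Finset.sum_congr rfl fun i _ => ?_
    rw [rotDag_conj D, fuse_cyclic, Category.assoc, ← MonoidalCategory.whiskerLeft_comp,
      ← StandardDual.rt_comp]
  simp only [h, ← map_sum, ← Preadditive.comp_sum, ← whiskerLeft_sum, ← StandardDual.rt_sum,
    I.total, StandardDual.rt_id]
  simp

theorem Tube.star_of {V : C} (D : StandardDual V) {x y : ι} (φ : V ⊗ I.obj x ⟶ I.obj y ⊗ V) :
    star (Tube.of I x y φ) = Tube.of I y x (rotDag D φ) := by
  refine Tube.ext' I fun p w => ?_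
  rw [Tube.star_apply]
  have h0 {V x y : C} (D : StandardDual V) : rotDag D (0 : V ⊗ x ⟶ y ⊗ V) = 0 := by
    simpa using rotDag_sub D (0 : V ⊗ x ⟶ y ⊗ V) 0
  by_cases hp : p = (y, x)
  · subst hp
    simp only [Tube.of_apply_self]
    exact sum_fuse_rotDag_fuse I D φ w
  · rw [Tube.of_apply_ne I _ _ _ hp]
    refine Finset.sum_eq_zero fun v _ => ?_
    rw [Tube.of_apply_ne I x y φ (by
      rintro h
      exact hp (Prod.ext (Prod.ext_iff.1 h).2 (Prod.ext_iff.1 h).1)), h0, map_zero]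

theorem Tube.star_proj (x : ι) : star (Tube.proj I x) = Tube.proj I x := by
  rw [Tube.proj, Tube.star_of I StandardDual.unit]
  congr 1
  simp only [rotDag, StandardDual.unit, dag_comp, dag_leftUnitor_inv, dag_leftUnitor_hom,
    dag_rightUnitor_inv]
  monoidal

theorem Tube.proj_mul_of {V : C} {x y : ι} (φ : V ⊗ I.obj x ⟶ I.obj y ⊗ V) :
    Tube.proj I y * Tube.of I x y φ = Tube.of I x y φ := by
  rw [Tube.proj, Tube.of_mul_of]
  have h : stack ((λ_ (I.obj y)).hom ≫ (ρ_ (I.obj y)).inv) φ =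
      (λ_ V).hom ▷ I.obj x ≫ φ ≫ I.obj y ◁ (λ_ V).inv := by
    rw [stack_apply]
    monoidal
  rw [h, Tube.of_cyclic, Category.assoc, ← MonoidalCategory.whiskerLeft_comp, Iso.inv_hom_id]
  simp

theorem Tube.of_mul_proj {V : C} {x y : ι} (φ : V ⊗ I.obj x ⟶ I.obj y ⊗ V) :
    Tube.of I x y φ * Tube.proj I x = Tube.of I x y φ := by
  rw [Tube.proj, Tube.of_mul_of]
  have h : stack φ ((λ_ (I.obj x)).hom ≫ (ρ_ (I.obj x)).inv) =
      (ρ_ V).hom ▷ I.obj x ≫ φ ≫ I.obj y ◁ (ρ_ V).inv := by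
    rw [stack_apply]
    monoidal
  rw [h, Tube.of_cyclic, Category.assoc, ← MonoidalCategory.whiskerLeft_comp, Iso.inv_hom_id]
  simp

theorem Tube.one_eq : (1 : Tube I) = ∑ x, Tube.proj I x := rfl

end TubeAlgebra

section Reconstruction

variable {C : Type u} [Category.{v} C] [Abelian C] [Linear ℂ C] [MonoidalCategory C]
  [MonoidalPreadditive C] [MonoidalLinear ℂ C] [RigidCategory C] [UnitaryFusionCategory C]

namespace StandardDual

theorem tensor_ptr_stack {U V X P x y z : C} (D : StandardDual U) (E : StandardDual V)
    (F : P ⊗ U ⟶ U ⊗ X) (G : X ⊗ V ⟶ V ⊗ x) (φ : U ⊗ y ⟶ z ⊗ U) (ψ : V ⊗ x ⟶ y ⊗ V) :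
    (D.tensor E).ptr (((α_ P U V).inv ≫ F ▷ V ≫ (α_ U X V).hom ≫ U ◁ G ≫ (α_ U V x).inv) ≫
      stack φ ψ) = D.ptr (F ≫ U ◁ E.ptr (G ≫ ψ) ≫ φ) := by
  rw [tensor_ptr, whiskerLeft_ptr, ptr_comp, comp_ptr]
  simp only [stack_apply]
  congr 2
  simp

/-- Every morphism `(U V) x ⟶ z (U V)` is a stack. -/
theorem eq_stack {U V x z : C} (E : StandardDual V) (φ : (U ⊗ V) ⊗ x ⟶ z ⊗ (U ⊗ V)) :
    ∃ ψ' : U ⊗ ((V ⊗ x) ⊗ E.bar) ⟶ z ⊗ U, φ = stack ψ' (E.cupR (V ⊗ x)) := by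
  let χ : U ⊗ (V ⊗ x) ⟶ (z ⊗ U) ⊗ V := (α_ U V x).inv ≫ φ ≫ (α_ z U V).inv
  refine ⟨(α_ U (V ⊗ x) E.bar).inv ≫ χ ▷ E.bar ≫ (α_ (z ⊗ U) V E.bar).hom ≫
    (z ⊗ U) ◁ dag E.Rbar ≫ (ρ_ (z ⊗ U)).hom, ?_⟩
  have h1 : φ = (α_ U V x).hom ≫ χ ≫ (α_ z U V).hom := by simp [χ]
  have h2 : U ◁ E.cupR (V ⊗ x) ≫ (α_ U ((V ⊗ x) ⊗ E.bar) V).inv ≫ (α_ U (V ⊗ x) E.bar).inv ▷ V =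
      E.cupR (U ⊗ (V ⊗ x)) := by
    simp only [cupR]
    monoidal
  conv_lhs => rw [h1, ← E.cupR_comp_ptr χ, ← h2]
  rw [stack_apply]
  simp

end StandardDual

theorem rotDag_surjective {ι : Type} [Fintype ι] (I : SimpleReps C ι) {V x y : C}
    (D : StandardDual V) (θ : D.bar ⊗ y ⟶ x ⊗ D.bar) : ∃ ψ : V ⊗ x ⟶ y ⊗ V, rotDag D ψ = θ := by
  refine ⟨rotDag (D.flip I) θ, ?_⟩
  simp only [rotDag, StandardDual.flip, dag_comp, dag_whiskerLeft, dag_whiskerRight, dag_dag,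
    dag_associator_hom, dag_associator_inv, dag_rightUnitor_inv, dag_leftUnitor_hom]
  calc
    _ = 𝟙 _ ⊗≫ (D.bar ⊗ y) ◁ D.Rbar ⊗≫ (D.bar ◁ D.Rbar) ▷ (y ⊗ (V ⊗ D.bar)) ⊗≫
        ((D.bar ⊗ V) ◁ (θ ▷ (V ⊗ D.bar) ⊗≫ x ◁ (dag D.R ▷ D.bar) ⊗≫ 𝟙 (x ⊗ D.bar)) ≫
          dag D.R ▷ (x ⊗ D.bar)) ⊗≫ 𝟙 (x ⊗ D.bar) := by monoidal
    _ = 𝟙 _ ⊗≫ (D.bar ⊗ y) ◁ D.Rbar ⊗≫ (D.bar ◁ D.Rbar ⊗≫ dag D.R ▷ D.bar) ▷ (y ⊗ (V ⊗ D.bar)) ⊗≫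
        θ ▷ (V ⊗ D.bar) ⊗≫ x ◁ (dag D.R ▷ D.bar) ⊗≫ 𝟙 (x ⊗ D.bar) := by
      rw [whisker_exchange]
      monoidal
    _ = 𝟙 _ ⊗≫ ((D.bar ⊗ y) ◁ D.Rbar ≫ θ ▷ (V ⊗ D.bar)) ⊗≫
          x ◁ (dag D.R ▷ D.bar) ⊗≫ 𝟙 (x ⊗ D.bar) := by
      rw [D.zigzag₂]
      monoidal
    _ = 𝟙 _ ⊗≫ θ ⊗≫ x ◁ (D.bar ◁ D.Rbar ⊗≫ dag D.R ▷ D.bar) ⊗≫ 𝟙 (x ⊗ D.bar) := by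
      rw [whisker_exchange]
      monoidal
    _ = θ := by
      rw [D.zigzag₂]
      monoidal

variable {ι : Type} [Fintype ι] (I : SimpleReps C ι) {X : C}
  (ρ : Tube I →ₗ[ℂ] HSpace I X →ₗ[ℂ] HSpace I X)

/-- The matrix entry of a representation of the tube algebra at an annular diagram. -/
def tubeEntry {V : C} {x y : ι} :
    (V ⊗ I.obj x ⟶ I.obj y ⊗ V) →ₗ[ℂ] (X ⟶ I.obj x) →ₗ[ℂ] (X ⟶ I.obj y) :=
  LinearMap.mk₂ ℂ (fun φ m => ρ (Tube.of I x y φ) (HSpace.single I x m) y)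
    (fun φ ψ m => by
      have h : Tube.of I x y (φ + ψ) = Tube.of I x y φ + Tube.of I x y ψ :=
        (Tube.ofₗ I V x y).map_add φ ψ
      rw [h, map_add]
      rfl)
    (fun c φ m => by
      have h : Tube.of I x y (c • φ) = c • Tube.of I x y φ := (Tube.ofₗ I V x y).map_smul c φ
      rw [h, map_smul]
      rfl)
    (fun φ m n => by
      rw [map_add, map_add]
      rfl)
    (fun c φ m => by
      rw [map_smul, map_smul]
      rfl)

theorem tubeEntry_cyclic {V V' : C} {x y : ι} (b : V ⟶ V') (φ : V' ⊗ I.obj x ⟶ I.obj y ⊗ V)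
    (m : X ⟶ I.obj x) :
    tubeEntry I ρ (b ▷ I.obj x ≫ φ) m = tubeEntry I ρ (φ ≫ I.obj y ◁ b) m := by
  change ρ _ _ y = ρ _ _ y
  rw [Tube.of_cyclic]

theorem tubeEntry_comp {V : C} {x y y' : ι} (φ : V ⊗ I.obj x ⟶ I.obj y ⊗ V)
    (g : I.obj y ⟶ I.obj y') (m : X ⟶ I.obj x) :
    tubeEntry I ρ (φ ≫ g ▷ V) m = tubeEntry I ρ φ m ≫ g := by
  by_cases h : y = y'
  · subst h
    obtain ⟨c, rfl⟩ := exists_scalar g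
    simp
  · rw [I.hom_eq_zero h g]
    simp

theorem tubeEntry_precomp {V : C} {x x' y : ι} (f : I.obj x' ⟶ I.obj x)
    (φ : V ⊗ I.obj x ⟶ I.obj y ⊗ V) (m : X ⟶ I.obj x') :
    tubeEntry I ρ (V ◁ f ≫ φ) m = tubeEntry I ρ φ (m ≫ f) := by
  by_cases h : x' = x
  · subst h
    obtain ⟨c, rfl⟩ := exists_scalar f
    simp
  · rw [I.hom_eq_zero h f]
    simp

/-- The extension of the matrix entries to diagrams `V X ⟶ y V` with arbitrary `y`. -/
def tubeEval {V y : C} : (V ⊗ X ⟶ y ⊗ V) →ₗ[ℂ] (X ⟶ y) :=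
  ∑ k, ∑ l, Linear.rightComp ℂ X (dag ((I.decomp y).p l)) ∘ₗ
    (tubeEntry I ρ (V := V)).flip ((I.decomp X).p k) ∘ₗ
    Linear.leftComp ℂ _ (V ◁ dag ((I.decomp X).p k)) ∘ₗ
    Linear.rightComp ℂ (V ⊗ X) ((I.decomp y).p l ▷ V)

theorem tubeEval_apply {V y : C} (φ : V ⊗ X ⟶ y ⊗ V) : tubeEval I ρ φ =
    ∑ k, ∑ l, tubeEntry I ρ (V ◁ dag ((I.decomp X).p k) ≫ φ ≫ (I.decomp y).p l ▷ V)
      ((I.decomp X).p k) ≫ dag ((I.decomp y).p l) := by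
  simp [tubeEval]

theorem tubeEval_comp {V y y' : C} (φ : V ⊗ X ⟶ y ⊗ V) (g : y ⟶ y') :
    tubeEval I ρ (φ ≫ g ▷ V) = tubeEval I ρ φ ≫ g := by
  rw [tubeEval_apply, tubeEval_apply, Preadditive.sum_comp]
  refine Finset.sum_congr rfl fun k _ => ?_
  have h1 (l) : V ◁ dag ((I.decomp X).p k) ≫ (φ ≫ g ▷ V) ≫ (I.decomp y').p l ▷ V =
      ∑ j, (V ◁ dag ((I.decomp X).p k) ≫ φ ≫ (I.decomp y).p j ▷ V) ≫
        (dag ((I.decomp y).p j) ≫ g ≫ (I.decomp y').p l) ▷ V := by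
    have h2 := (I.decomp y).expand_left (g ≫ (I.decomp y').p l)
    have h3 : (φ ≫ g ▷ V) ≫ (I.decomp y').p l ▷ V = φ ≫ (g ≫ (I.decomp y').p l) ▷ V := by simp
    rw [h3]
    conv_lhs => rw [h2, sum_whiskerRight, Preadditive.comp_sum, Preadditive.comp_sum]
    simp
  simp only [h1, map_sum, LinearMap.sum_apply, tubeEntry_comp, Preadditive.sum_comp]
  rw [Finset.sum_comm]
  refine Finset.sum_congr rfl fun j _ => ?_
  have h4 := (I.decomp y').expand_right (dag ((I.decomp y).p j) ≫ g)
  simp only [Category.assoc] at h4 ⊢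
  rw [← Preadditive.comp_sum, ← h4]

theorem tubeEval_obj {V : C} {y : ι} (φ : V ⊗ X ⟶ I.obj y ⊗ V) : tubeEval I ρ φ =
    ∑ k, tubeEntry I ρ (V ◁ dag ((I.decomp X).p k) ≫ φ) ((I.decomp X).p k) := by
  rw [tubeEval_apply]
  refine Finset.sum_congr rfl fun k _ => ?_
  have h1 (l) : V ◁ dag ((I.decomp X).p k) ≫ φ ≫ (I.decomp (I.obj y)).p l ▷ V =
    (V ◁ dag ((I.decomp X).p k) ≫ φ) ≫ (I.decomp (I.obj y)).p l ▷ V := by simp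
  have h2 (l) : tubeEntry I ρ (V ◁ dag ((I.decomp X).p k) ≫ φ ≫ (I.decomp (I.obj y)).p l ▷ V)
      ((I.decomp X).p k) ≫ dag ((I.decomp (I.obj y)).p l) =
      tubeEntry I ρ (V ◁ dag ((I.decomp X).p k) ≫ φ) ((I.decomp X).p k) ≫
        (I.decomp (I.obj y)).p l ≫ dag ((I.decomp (I.obj y)).p l) := by
    rw [h1, tubeEntry_comp, Category.assoc]
  rw [Finset.sum_congr rfl fun l _ => h2 l]
  rw [← Preadditive.comp_sum, (I.decomp (I.obj y)).total, Category.comp_id]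

theorem tubeEval_whiskerLeft {V : C} {x y : ι} (m : X ⟶ I.obj x)
    (φ : V ⊗ I.obj x ⟶ I.obj y ⊗ V) : tubeEval I ρ (V ◁ m ≫ φ) = tubeEntry I ρ φ m := by
  rw [tubeEval_obj]
  simp only [← whiskerLeft_comp_assoc, tubeEntry_precomp]
  rw [← map_sum, ← (I.decomp X).expand_left]

theorem tubeEval_cyclic {V V' y : C} (b : V ⟶ V') (φ : V' ⊗ X ⟶ y ⊗ V) :
    tubeEval I ρ (b ▷ X ≫ φ) = tubeEval I ρ (φ ≫ y ◁ b) := by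
  rw [tubeEval_apply, tubeEval_apply]
  refine Finset.sum_congr rfl fun k _ => Finset.sum_congr rfl fun l _ => ?_
  have h1 : V ◁ dag ((I.decomp X).p k) ≫ (b ▷ X ≫ φ) ≫ (I.decomp y).p l ▷ V =
      b ▷ _ ≫ V' ◁ dag ((I.decomp X).p k) ≫ φ ≫ (I.decomp y).p l ▷ V := by
    rw [Category.assoc, whisker_exchange_assoc]
  have h2 : V' ◁ dag ((I.decomp X).p k) ≫ (φ ≫ y ◁ b) ≫ (I.decomp y).p l ▷ V' =
      (V' ◁ dag ((I.decomp X).p k) ≫ φ ≫ (I.decomp y).p l ▷ V) ≫ _ ◁ b := by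
    simp only [Category.assoc, whisker_exchange]
  rw [h1, h2, tubeEntry_cyclic]

variable (hproj : ∀ x m, ρ (Tube.proj I x) m = HSpace.single I x (m x))
  (hmul : ∀ s t m, ρ (s * t) m = ρ s (ρ t m))

include hproj in
theorem tubeEntry_unit {x y : ι} (f : I.obj x ⟶ I.obj y) (m : X ⟶ I.obj x) :
    tubeEntry I ρ ((λ_ (I.obj x)).hom ≫ f ≫ (ρ_ (I.obj y)).inv) m = m ≫ f := by
  by_cases h : x = y
  · subst h
    obtain ⟨c, rfl⟩ := exists_scalar f
    have h1 : tubeEntry I ρ ((λ_ (I.obj x)).hom ≫ (ρ_ (I.obj x)).inv) m = m := by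
      change ρ (Tube.proj I x) _ x = m
      rw [hproj, HSpace.single_self, HSpace.single_self]
    simp [h1]
  · rw [I.hom_eq_zero h f]
    simp

include hproj in
theorem tubeEval_unit {y : C} (f : X ⟶ y) :
    tubeEval I ρ ((λ_ X).hom ≫ f ≫ (ρ_ y).inv) = f := by
  rw [tubeEval_apply]
  have h1 (k l) : 𝟙_ C ◁ dag ((I.decomp X).p k) ≫ ((λ_ X).hom ≫ f ≫ (ρ_ y).inv) ≫
      (I.decomp y).p l ▷ 𝟙_ C = (λ_ _).hom ≫ (dag ((I.decomp X).p k) ≫ f ≫ (I.decomp y).p l) ≫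
        (ρ_ _).inv := by simp
  simp only [h1, tubeEntry_unit I ρ hproj]
  have h2 := (I.decomp X).expand_left f
  conv_rhs => rw [h2]
  refine Finset.sum_congr rfl fun k _ => ?_
  have h3 := (I.decomp y).expand_right f
  conv_rhs => rw [h3, Preadditive.comp_sum, Preadditive.comp_sum]
  simp

include hproj hmul in
theorem apply_of {V : C} {x y : ι} (φ : V ⊗ I.obj x ⟶ I.obj y ⊗ V) (m : HSpace I X) :
    ρ (Tube.of I x y φ) m = HSpace.single I y (tubeEntry I ρ φ (m x)) := by
  conv_lhs => rw [← Tube.of_mul_proj, hmul, hproj, ← Tube.proj_mul_of, hmul, hproj]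
  rfl

include hproj hmul in
theorem tubeEntry_stack {U V : C} {x y z : ι} (φ : U ⊗ I.obj y ⟶ I.obj z ⊗ U)
    (ψ : V ⊗ I.obj x ⟶ I.obj y ⊗ V) (m : X ⟶ I.obj x) :
    tubeEntry I ρ (stack φ ψ) m = tubeEntry I ρ φ (tubeEntry I ρ ψ m) := by
  change ρ (Tube.of I x z (stack φ ψ)) _ z = _
  rw [← Tube.of_mul_of, hmul, apply_of I ρ hproj hmul, apply_of I ρ hproj hmul, HSpace.single_self,
    HSpace.single_self, HSpace.single_self]

include hproj hmul in
theorem tubeEval_stack {U V Y z : C} (φ : U ⊗ Y ⟶ z ⊗ U) (ψ : V ⊗ X ⟶ Y ⊗ V) :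
    tubeEval I ρ (stack φ ψ) = tubeEval I ρ (U ◁ tubeEval I ρ ψ ≫ φ) := by
  have h1 (k l) : (U ⊗ V) ◁ dag ((I.decomp X).p k) ≫ stack φ ψ ≫ (I.decomp z).p l ▷ (U ⊗ V) =
      ∑ j, stack (U ◁ dag ((I.decomp Y).p j) ≫ φ ≫ (I.decomp z).p l ▷ U)
        (V ◁ dag ((I.decomp X).p k) ≫ ψ ≫ (I.decomp Y).p j ▷ V) := by
    have h2 (j) : stack (U ◁ dag ((I.decomp Y).p j) ≫ φ ≫ (I.decomp z).p l ▷ U)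
        (V ◁ dag ((I.decomp X).p k) ≫ ψ ≫ (I.decomp Y).p j ▷ V) =
        (U ⊗ V) ◁ dag ((I.decomp X).p k) ≫ (α_ U V X).hom ≫ U ◁ ψ ≫
          U ◁ (((I.decomp Y).p j ≫ dag ((I.decomp Y).p j)) ▷ V) ≫ (α_ U Y V).inv ≫ φ ▷ V ≫
            (α_ z U V).hom ≫ (I.decomp z).p l ▷ (U ⊗ V) := by
      rw [stack_apply]
      monoidal
    simp only [h2]
    rw [← Preadditive.comp_sum, ← Preadditive.comp_sum, ← Preadditive.comp_sum,
      ← Preadditive.sum_comp, ← whiskerLeft_sum, ← sum_whiskerRight, (I.decomp Y).total,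
      stack_apply]
    simp
  have h3 : U ◁ tubeEval I ρ ψ ≫ φ = ∑ k, ∑ j, U ◁ tubeEntry I ρ (V ◁ dag ((I.decomp X).p k) ≫ ψ ≫
      (I.decomp Y).p j ▷ V) ((I.decomp X).p k) ≫ (U ◁ dag ((I.decomp Y).p j) ≫ φ) := by
    rw [tubeEval_apply]
    simp [whiskerLeft_sum, Preadditive.sum_comp]
  have h4 (Z : U ⊗ X ⟶ z ⊗ U) : tubeEval I ρ Z =
      ∑ l, tubeEval I ρ (Z ≫ (I.decomp z).p l ▷ U) ≫ dag ((I.decomp z).p l) := by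
    rw [(I.decomp z).expand_right (tubeEval I ρ Z)]
    refine Finset.sum_congr rfl fun l _ => ?_
    rw [tubeEval_comp, Category.assoc]
  rw [tubeEval_apply]
  conv_rhs => rw [h4]
  rw [Finset.sum_comm]
  refine Finset.sum_congr rfl fun l _ => ?_
  rw [h3, Preadditive.sum_comp, map_sum, Preadditive.sum_comp]
  refine Finset.sum_congr rfl fun k _ => ?_
  rw [h1, Preadditive.sum_comp, map_sum, map_sum, Preadditive.sum_comp, LinearMap.sum_apply,
    Preadditive.sum_comp]
  refine Finset.sum_congr rfl fun j _ => ?_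
  rw [tubeEntry_stack I ρ hproj hmul, Category.assoc, Category.assoc, tubeEval_whiskerLeft]

/-- The half-braiding attached to a representation of the tube algebra. -/
def tubeCrossing (V : C) : X ⊗ V ⟶ V ⊗ X :=
  let D := (exists_standardDual I V).some
  D.unbend (tubeEval I ρ (D.cupR (V ⊗ X)))

theorem ptr_tubeCrossing {V y : C} (D : StandardDual V) (φ : V ⊗ X ⟶ y ⊗ V) :
    D.ptr (tubeCrossing I ρ V ≫ φ) = tubeEval I ρ φ := by
  rw [D.ptr_eq_ptr I (exists_standardDual I V).some]
  set E := (exists_standardDual I V).some with hE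
  have h1 := E.cupR_comp_ptr φ
  conv_lhs => rw [← h1, ← Category.assoc, ← StandardDual.ptr_comp, StandardDual.ptr_comp_cupR]
  rw [tubeCrossing, ← hE, StandardDual.bend_unbend, ← tubeEval_comp, h1]

theorem tubeCrossing_naturality {U V : C} (f : U ⟶ V) :
    X ◁ f ≫ tubeCrossing I ρ V = tubeCrossing I ρ U ≫ f ▷ X := by
  obtain ⟨D⟩ := exists_standardDual I U
  obtain ⟨E⟩ := exists_standardDual I V
  refine D.eq_of_ptr_comp_eq fun z φ => ?_
  rw [Category.assoc, D.ptr_cyclic E I, Category.assoc, ptr_tubeCrossing, Category.assoc,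
    ptr_tubeCrossing, tubeEval_cyclic]

include hproj hmul in
theorem tubeCrossing_tensor (U V : C) : tubeCrossing I ρ (U ⊗ V) = (α_ X U V).inv ≫
    tubeCrossing I ρ U ▷ V ≫ (α_ U X V).hom ≫ U ◁ tubeCrossing I ρ V ≫ (α_ U V X).inv := by
  obtain ⟨D⟩ := exists_standardDual I U
  obtain ⟨E⟩ := exists_standardDual I V
  refine (D.tensor E).eq_of_ptr_comp_eq fun z φ => ?_
  obtain ⟨ψ', rfl⟩ := StandardDual.eq_stack E φ
  rw [ptr_tubeCrossing, StandardDual.tensor_ptr_stack, ptr_tubeCrossing, ptr_tubeCrossing,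
    tubeEval_stack I ρ hproj hmul]

include hproj in
theorem tubeCrossing_unit : tubeCrossing I ρ (𝟙_ C) = (ρ_ X).hom ≫ (λ_ X).inv := by
  refine StandardDual.unit.eq_of_ptr_comp_eq fun z φ => ?_
  have h : φ = (λ_ X).hom ≫ ((λ_ X).inv ≫ φ ≫ (ρ_ z).hom) ≫ (ρ_ z).inv := by simp
  rw [ptr_tubeCrossing, h, tubeEval_unit I ρ hproj]
  conv_lhs => rw [← StandardDual.unit_ptr ((λ_ X).inv ≫ φ ≫ (ρ_ z).hom)]
  simp

end Reconstruction

section HalfBraiding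

variable {C : Type u} [Category.{v} C] [Abelian C] [Linear ℂ C] [MonoidalCategory C]
  [MonoidalPreadditive C] [MonoidalLinear ℂ C] [RigidCategory C] [UnitaryFusionCategory C]

variable {X : C} (c : ∀ V, X ⊗ V ⟶ V ⊗ X)

/-- The candidate inverse of a crossing, by rotation. -/
def rotCrossing {V : C} (D : StandardDual V) : V ⊗ X ⟶ X ⊗ V :=
  𝟙 (V ⊗ X) ⊗≫ (V ⊗ X) ◁ D.R ⊗≫ V ◁ c D.bar ▷ V ⊗≫ dag D.Rbar ▷ (X ⊗ V) ⊗≫ 𝟙 (X ⊗ V)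

variable (hnat : ∀ {U V : C} (f : U ⟶ V), X ◁ f ≫ c V = c U ≫ f ▷ X)
  (htensor : ∀ U V, c (U ⊗ V) = (α_ X U V).inv ≫ c U ▷ V ≫ (α_ U X V).hom ≫ U ◁ c V ≫
    (α_ U V X).inv)
  (hunit : c (𝟙_ C) = (ρ_ X).hom ≫ (λ_ X).inv)

include hnat htensor hunit in
theorem comp_rotCrossing {V : C} (D : StandardDual V) : c V ≫ rotCrossing c D = 𝟙 _ := by
  have h1 := hnat (dag D.Rbar)
  rw [htensor, hunit] at h1
  calc
    _ = 𝟙 (X ⊗ V) ⊗≫ (c V ▷ 𝟙_ C ≫ (V ⊗ X) ◁ D.R) ⊗≫ V ◁ c D.bar ▷ V ⊗≫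
        dag D.Rbar ▷ (X ⊗ V) ⊗≫ 𝟙 (X ⊗ V) := by
      rw [rotCrossing]
      monoidal
    _ = 𝟙 (X ⊗ V) ⊗≫ (X ⊗ V) ◁ D.R ⊗≫
        (((α_ X V D.bar).inv ≫ c V ▷ D.bar ≫ (α_ V X D.bar).hom ≫ V ◁ c D.bar ≫
          (α_ V D.bar X).inv) ≫ dag D.Rbar ▷ X) ▷ V ⊗≫ 𝟙 (X ⊗ V) := by
      rw [← whisker_exchange]
      monoidal
    _ = 𝟙 (X ⊗ V) ⊗≫ X ◁ (V ◁ D.R ⊗≫ dag D.Rbar ▷ V) ⊗≫ 𝟙 (X ⊗ V) := by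
      rw [← h1]
      monoidal
    _ = 𝟙 _ := by
      rw [D.zigzag₃]
      monoidal

include hnat htensor hunit in
theorem rotCrossing_comp {V : C} (D : StandardDual V) : rotCrossing c D ≫ c V = 𝟙 _ := by
  have h1 := hnat D.R
  rw [htensor, hunit] at h1
  calc
    _ = 𝟙 (V ⊗ X) ⊗≫ (V ⊗ X) ◁ D.R ⊗≫ V ◁ c D.bar ▷ V ⊗≫
        (dag D.Rbar ▷ (X ⊗ V) ≫ 𝟙_ C ◁ c V) ⊗≫ 𝟙 (V ⊗ X) := by
      rw [rotCrossing]
      monoidal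
    _ = 𝟙 (V ⊗ X) ⊗≫ V ◁ (X ◁ D.R ≫ (α_ X D.bar V).inv ≫ c D.bar ▷ V ≫ (α_ D.bar X V).hom ≫
          D.bar ◁ c V ≫ (α_ D.bar V X).inv) ⊗≫ dag D.Rbar ▷ (V ⊗ X) ⊗≫ 𝟙 (V ⊗ X) := by
      rw [← whisker_exchange]
      monoidal
    _ = 𝟙 (V ⊗ X) ⊗≫ (V ◁ D.R ⊗≫ dag D.Rbar ▷ V) ▷ X ⊗≫ 𝟙 (V ⊗ X) := by
      rw [h1]
      monoidal
    _ = 𝟙 _ := by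
      rw [D.zigzag₃]
      monoidal

/-- A natural monoidal family of crossings is a half-braiding. -/
def halfBraidingOfCrossing {ι : Type} [Fintype ι] (I : SimpleReps C ι) : HalfBraiding X where
  β V := ⟨c V, rotCrossing c (exists_standardDual I V).some,
    comp_rotCrossing c hnat htensor hunit _, rotCrossing_comp c hnat htensor hunit _⟩
  monoidal := htensor
  naturality := hnat

end HalfBraiding

section Unitarity

variable {C : Type u} [Category.{v} C] [Abelian C] [Linear ℂ C] [MonoidalCategory C]
  [MonoidalPreadditive C] [MonoidalLinear ℂ C] [RigidCategory C] [UnitaryFusionCategory C]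
  {ι : Type} [Fintype ι] (I : SimpleReps C ι)

theorem HSpace.inner_single_left {X : C} (y : ι) (h : X ⟶ I.obj y) (n : HSpace I X) :
    inner ℂ (HSpace.single I y h) n = (qdim (I.obj y) : ℂ) * scalar (dag h ≫ n y) := by
  rw [HSpace.inner_def, Finset.sum_eq_single y, HSpace.single_self]
  · intro x _ hx
    rw [HSpace.single_ne I hx, dag_zero, zero_comp, scalar_zero, mul_zero]
  · simp

theorem HSpace.inner_single_right {X : C} (y : ι) (h : X ⟶ I.obj y) (n : HSpace I X) :
    inner ℂ n (HSpace.single I y h) = (qdim (I.obj y) : ℂ) * scalar (dag (n y) ≫ h) := by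
  rw [HSpace.inner_def, Finset.sum_eq_single y, HSpace.single_self]
  · intro x _ hx
    rw [HSpace.single_ne I hx, comp_zero, scalar_zero, mul_zero]
  · simp

theorem eq_of_scalar_dag_comp {X w : C} [Simple w] {f g : X ⟶ w}
    (h : ∀ k : X ⟶ w, scalar (dag f ≫ k) = scalar (dag g ≫ k)) : f = g := by
  rw [← sub_eq_zero]
  apply dag_injective
  rw [dag_zero]
  refine eq_zero_of_scalar_comp_dag _ ?_
  rw [dag_dag, dag_sub, Preadditive.sub_comp, sub_eq_add_neg, ← neg_one_smul ℂ, scalar_add,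
    scalar_smul, h]
  ring

/-- An object of the center whose representation of the tube algebra is a `*`-representation has
a unitary half-braiding. -/
theorem isUnitary_of_star (X : Center C) (hstar : ∀ (t : Tube I) (h k : HSpace I X.1),
    inner ℂ (tubeAct I X (star t) h) k = inner ℂ h (tubeAct I X t k)) : IsUnitary X := by
  have key : ∀ {V : C} (D : StandardDual V),
      (X.2.β D.bar).hom = dag (X.2.β D.bar).inv := by
    intro V D
    refine crossing_eq_of_encircle I (D.flip I) fun y z h φ => ?_
    obtain ⟨ψ, rfl⟩ := rotDag_surjective I D φ
    refine eq_of_scalar_dag_comp fun k => ?_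
    have h1 := hstar (Tube.of I z y ψ) (HSpace.single I y h) (HSpace.single I z k)
    rw [Tube.star_of I D, HSpace.inner_single_left, HSpace.inner_single_right,
      tubeAct_of_self I X (D.flip I), tubeAct_of_self I X D, HSpace.single_self,
      HSpace.single_self, StandardDual.encircle_eq_ptr D, ← star_pairing I X] at h1
    have h2 := mul_left_cancel₀ (by exact_mod_cast (qdim_pos (I.obj z)).ne') h1
    rw [h2, StandardDual.encircle_eq_ptr, StandardDual.dag_ptr]
    simp only [dag_comp, dag_dag, dag_whiskerLeft, Category.assoc]
  intro V
  obtain ⟨D⟩ := exists_standardDual I V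
  have h1 : (X.2.β V).hom = dag (X.2.β V).inv := key (D.flip I)
  rw [h1, dag_dag]

end Unitarity

section Reconstruction

variable {C : Type u} [Category.{v} C] [Abelian C] [Linear ℂ C] [MonoidalCategory C]
  [MonoidalPreadditive C] [MonoidalLinear ℂ C] [RigidCategory C] [UnitaryFusionCategory C]
  {ι : Type} [Fintype ι] (I : SimpleReps C ι)

theorem tubeActₗ_eq (Y : Center C) (ρ : Tube I →ₗ[ℂ] HSpace I Y.1 →ₗ[ℂ] HSpace I Y.1)
    (hproj : ∀ x m, ρ (Tube.proj I x) m = HSpace.single I x (m x))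
    (hmul : ∀ s t m, ρ (s * t) m = ρ s (ρ t m))
    (hY : ∀ V, (Y.2.β V).hom = tubeCrossing I ρ V) : tubeActₗ I Y = ρ := by
  refine LinearMap.ext fun t => ?_
  rw [Tube.eq_sum_of I t]
  simp only [map_sum]
  refine Finset.sum_congr rfl fun x _ => Finset.sum_congr rfl fun y _ =>
    Finset.sum_congr rfl fun v _ => LinearMap.ext fun m => ?_
  rw [tubeActₗ_apply, apply_of I ρ hproj hmul]
  refine HSpace.ext I fun z => ?_
  by_cases hz : z = y
  · subst hz
    rw [tubeAct_of_self I _ (stdDual (I.obj v)), HSpace.single_self,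
      StandardDual.encircle_eq_ptr, ← tubeEval_whiskerLeft, ← ptr_tubeCrossing I ρ (stdDual _), hY]
  · rw [tubeAct_of_ne I _ _ _ _ _ hz, HSpace.single_ne I hz]

/-- Every representation of the tube algebra on `H_X` which is compatible with the grading comes
from a half-braiding on `X`. -/
theorem exists_center {X : C} (ρ : Tube I →ₗ[ℂ] HSpace I X →ₗ[ℂ] HSpace I X)
    (hproj : ∀ x m, ρ (Tube.proj I x) m = HSpace.single I x (m x))
    (hmul : ∀ s t m, ρ (s * t) m = ρ s (ρ t m)) :
    ∃ (Y : Center C) (h : X = Y.1), tubeActₗ I Y = h ▸ ρ := by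
  let Y : Center C := ⟨X, halfBraidingOfCrossing (fun V => tubeCrossing I ρ V)
    (fun f => tubeCrossing_naturality I ρ f) (tubeCrossing_tensor I ρ hproj hmul)
    (tubeCrossing_unit I ρ hproj) I⟩
  exact ⟨Y, rfl, tubeActₗ_eq I Y ρ hproj hmul fun _ => rfl⟩

end Reconstruction

/-- A finite orthogonal resolution of the identity has an adapted orthonormal basis. -/
theorem exists_adapted_orthonormalBasis {ι H : Type*} [Fintype ι] [NormedAddCommGroup H]
    [InnerProductSpace ℂ H] [FiniteDimensional ℂ H] (E : ι → H →ₗ[ℂ] H)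
    (hE : ∀ x h k, inner ℂ (E x h) k = inner ℂ h (E x k)) (hself : ∀ x h, E x (E x h) = E x h)
    (hne : ∀ x y, x ≠ y → ∀ h, E x (E y h) = 0) (hsum : ∀ h, ∑ x, E x h = h) :
    ∃ (n : ι → ℕ) (b : OrthonormalBasis (Σ x, Fin (n x)) ℂ H),
      (∀ k, E k.1 (b k) = b k) ∧ ∀ x k, x ≠ k.1 → E x (b k) = 0 := by
  let e x := stdOrthonormalBasis ℂ (LinearMap.range (E x))
  let b : (Σ x, Fin (Module.finrank ℂ (LinearMap.range (E x)))) → H := fun k => e k.1 k.2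
  have hb k : E k.1 (b k) = b k := by
    obtain ⟨h, hh⟩ := (e k.1 k.2).2
    change E k.1 (e k.1 k.2 : H) = e k.1 k.2
    rw [← hh, hself]
  have hb' x k (hx : x ≠ k.1) : E x (b k) = 0 := by rw [← hb k, hne x k.1 hx]
  have hon : Orthonormal ℂ b := by
    classical
    rw [orthonormal_iff_ite]
    rintro ⟨x, i⟩ ⟨y, j⟩
    by_cases hxy : x = y
    · subst hxy
      have := orthonormal_iff_ite.1 (e x).orthonormal i j
      rw [Submodule.coe_inner] at this
      change inner ℂ (e x i : H) (e x j : H) = _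
      rw [this]
      simp
    · have h1 : inner ℂ (b ⟨x, i⟩) (b ⟨y, j⟩) = (0 : ℂ) := by
        rw [← hb ⟨x, i⟩, hE, hb' x ⟨y, j⟩ hxy, inner_zero_right]
      rw [h1, if_neg]
      intro h
      exact hxy (congrArg Sigma.fst h)
  have hspan : ⊤ ≤ Submodule.span ℂ (Set.range b) := by
    intro h _
    rw [← hsum h]
    refine Submodule.sum_mem _ fun x _ => ?_
    have h1 := congrArg (Submodule.subtype _) ((e x).sum_repr ⟨E x h, ⟨h, rfl⟩⟩)
    rw [map_sum] at h1
    change _ = E x h at h1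
    rw [← h1]
    refine Submodule.sum_mem _ fun i _ => ?_
    rw [map_smul]
    exact Submodule.smul_mem _ _ (Submodule.subset_span ⟨⟨x, i⟩, rfl⟩)
  refine ⟨_, OrthonormalBasis.mk hon hspan, ?_, ?_⟩
  · simpa using hb
  · simpa using hb'

section Model

variable {C : Type u} [Category.{v} C] [Abelian C] [Linear ℂ C] [MonoidalCategory C]
  [MonoidalPreadditive C] [MonoidalLinear ℂ C] [RigidCategory C] [UnitaryFusionCategory C]
  {ι : Type} [Fintype ι] (I : SimpleReps C ι)

/-- The basis of `H_X` given by an orthogonal decomposition of `X` into simple objects. -/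
theorem exists_orthonormalBasis_hSpace {X : C} {n : ι → ℕ}
    (P : OrthoDecomp X (fun k : Σ x, Fin (n x) => I.obj k.1)) :
    ∃ b : OrthonormalBasis (Σ x, Fin (n x)) ℂ (HSpace I X),
      ∀ k, b k = HSpace.single I k.1 (((Real.sqrt (qdim (I.obj k.1)))⁻¹ : ℂ) • P.p k) := by
  let b : (Σ x, Fin (n x)) → HSpace I X :=
    fun k => HSpace.single I k.1 (((Real.sqrt (qdim (I.obj k.1)))⁻¹ : ℂ) • P.p k)
  have hs (x : ι) : ((Real.sqrt (qdim (I.obj x)) : ℝ) : ℂ) ≠ 0 := by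
    exact_mod_cast (Real.sqrt_pos.2 (qdim_pos _)).ne'
  have hq (x : ι) : (qdim (I.obj x) : ℂ) = Real.sqrt (qdim (I.obj x)) * Real.sqrt (qdim (I.obj x)) := by
    exact_mod_cast (Real.mul_self_sqrt (qdim_pos _).le).symm
  have hon : Orthonormal ℂ b := by
    classical
    rw [orthonormal_iff_ite]
    rintro ⟨x, i⟩ ⟨y, j⟩
    change inner ℂ (HSpace.single I x ((Real.sqrt (qdim (I.obj x)) : ℂ)⁻¹ • P.p ⟨x, i⟩))
      (HSpace.single I y ((Real.sqrt (qdim (I.obj y)) : ℂ)⁻¹ • P.p ⟨y, j⟩)) = _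
    rw [HSpace.inner_single_left]
    by_cases hxy : x = y
    · subst hxy
      rw [HSpace.single_self, dag_smul, Linear.smul_comp, Linear.comp_smul, scalar_smul,
        scalar_smul, map_inv₀, Complex.conj_ofReal, hq]
      by_cases hij : i = j
      · subst hij
        rw [P.self, if_pos rfl, scalar_unique (one_smul ℂ _).symm]
        have := hs x
        field_simp
      · have h1 : (⟨x, i⟩ : Σ x, Fin (n x)) ≠ ⟨x, j⟩ := by simpa using hij
        rw [P.ne _ _ h1, if_neg h1, scalar_zero]
        simp
    · rw [HSpace.single_ne I hxy, comp_zero, scalar_zero, mul_zero, if_neg]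
      intro h
      exact hxy (congrArg Sigma.fst h)
  have hspan : ⊤ ≤ Submodule.span ℂ (Set.range b) := by
    intro m _
    rw [← HSpace.sum_single I m]
    refine Submodule.sum_mem _ fun x _ => ?_
    rw [P.expand_left (m x), map_sum]
    refine Submodule.sum_mem _ ?_
    rintro ⟨y, j⟩ _
    by_cases hxy : y = x
    · subst hxy
      obtain ⟨c, hc⟩ := exists_scalar (dag (P.p ⟨y, j⟩) ≫ m y)
      have h1 : HSpace.single I y (P.p ⟨y, j⟩ ≫ dag (P.p ⟨y, j⟩) ≫ m y) =
          (c * Real.sqrt (qdim (I.obj y))) • b ⟨y, j⟩ := by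
        change _ = (c * Real.sqrt (qdim (I.obj y))) •
          HSpace.single I y ((Real.sqrt (qdim (I.obj y)) : ℂ)⁻¹ • P.p ⟨y, j⟩)
        rw [← hc, Linear.comp_smul, Category.comp_id, map_smul, map_smul, smul_smul, mul_assoc,
          mul_inv_cancel₀ (hs y), mul_one]
      rw [h1]
      exact Submodule.smul_mem _ _ (Submodule.subset_span ⟨_, rfl⟩)
    · rw [I.hom_eq_zero hxy (dag (P.p ⟨y, j⟩) ≫ m x), comp_zero, map_zero]
      exact Submodule.zero_mem _
  exact ⟨OrthonormalBasis.mk hon hspan, fun k => by simp [b]⟩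

/-- A Hilbert space graded by the simple objects is some `H_X`. -/
theorem exists_graded_model {H : Type v} [NormedAddCommGroup H] [InnerProductSpace ℂ H]
    [FiniteDimensional ℂ H] (E : ι → H →ₗ[ℂ] H)
    (hE : ∀ x h k, inner ℂ (E x h) k = inner ℂ h (E x k)) (hself : ∀ x h, E x (E x h) = E x h)
    (hne : ∀ x y, x ≠ y → ∀ h, E x (E y h) = 0) (hsum : ∀ h, ∑ x, E x h = h) :
    ∃ (X : C) (Φ : H ≃ₗᵢ[ℂ] HSpace I X), ∀ x h, Φ (E x h) = HSpace.single I x (Φ h x) := by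
  obtain ⟨n, b, hb, hb'⟩ := exists_adapted_orthonormalBasis E hE hself hne hsum
  obtain ⟨X, ⟨P⟩⟩ := exists_orthoDecomp (fun k : Σ x, Fin (n x) => I.obj k.1)
  obtain ⟨e, he⟩ := exists_orthonormalBasis_hSpace I P
  refine ⟨X, b.equiv e (Equiv.refl _), fun x h => ?_⟩
  let S : HSpace I X →ₗ[ℂ] HSpace I X := HSpace.single I x ∘ₗ
    { toFun := fun m => m x, map_add' := fun _ _ => rfl, map_smul' := fun _ _ => rfl }
  suffices h1 : (b.equiv e (Equiv.refl _)).toLinearEquiv.toLinearMap ∘ₗ E x =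
      S ∘ₗ (b.equiv e (Equiv.refl _)).toLinearEquiv.toLinearMap from LinearMap.congr_fun h1 h
  refine b.toBasis.ext fun k => ?_
  rw [OrthonormalBasis.coe_toBasis]
  change b.equiv e (Equiv.refl _) (E x (b k)) = HSpace.single I x (b.equiv e (Equiv.refl _) (b k) x)
  rw [OrthonormalBasis.equiv_apply_basis]
  by_cases hx : x = k.1
  · subst hx
    rw [hb, OrthonormalBasis.equiv_apply_basis]
    simp only [Equiv.refl_apply, he, HSpace.single_self]
  · rw [hb' x k hx, map_zero]
    simp only [Equiv.refl_apply, he, HSpace.single_ne I hx, map_zero]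

theorem Tube.proj_mul_self (x : ι) : Tube.proj I x * Tube.proj I x = Tube.proj I x :=
  Tube.proj_mul_of I _

theorem Tube.proj_mul_ne {x y : ι} (h : x ≠ y) : Tube.proj I x * Tube.proj I y = 0 :=
  Tube.of_mul_of_ne I h _ _

variable (A : ObjectProperty (Center C))

instance : (hFunctor I A).EssSurj where
  mem_essImage M := by
    have hM := M.isStarRep
    obtain ⟨X, Φ, hΦ⟩ := exists_graded_model I (fun x => M.π (Dome.mk I A (Tube.proj I x)))
      (fun x h k => by rw [← hM.map_star, ← Dome.mk_star, Tube.star_proj])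
      (fun x h => by
        rw [← LinearMap.comp_apply, ← hM.map_mul, ← Dome.mk_mul, Tube.proj_mul_self])
      (fun x y hxy h => by
        rw [← LinearMap.comp_apply, ← hM.map_mul, ← Dome.mk_mul, Tube.proj_mul_ne I hxy, map_zero,
          map_zero, LinearMap.zero_apply])
      (fun h => by
        rw [← LinearMap.sum_apply, ← map_sum, ← map_sum, ← Tube.one_eq, Dome.mk_one, hM.map_one,
          LinearMap.id_apply])
    obtain ⟨π, hπ⟩ : ∃ π : Dome I A →ₗ[ℂ] HSpace I X →ₗ[ℂ] HSpace I X,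
        ∀ t h, π t h = Φ (M.π t (Φ.symm h)) :=
      ⟨Φ.toLinearEquiv.conj.toLinearMap ∘ₗ M.π, fun _ _ => rfl⟩
    have hπ' : IsStarRep π :=
      { map_one := by
          refine LinearMap.ext fun h => ?_
          rw [hπ, hM.map_one]
          simp
        map_mul := fun s t => by
          refine LinearMap.ext fun h => ?_
          rw [LinearMap.comp_apply, hπ, hπ, hπ, hM.map_mul]
          simp
        map_star := fun t h k => by
          rw [hπ, hπ, ← Φ.symm.inner_map_map, Φ.symm_apply_apply, hM.map_star,
            ← Φ.inner_map_map, Φ.apply_symm_apply] }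
    obtain ⟨Y, rfl, hb⟩ := exists_center I (π ∘ₗ Dome.mk I A)
      (fun x m => by
        rw [LinearMap.comp_apply, hπ, hΦ, Φ.apply_symm_apply])
      (fun s t m => by
        simp only [LinearMap.comp_apply]
        rw [Dome.mk_mul, hπ'.map_mul]
        rfl)
    have hY (t : Tube I) (m : HSpace I Y.1) : tubeAct I Y t m = π (Dome.mk I A t) m :=
      LinearMap.congr_fun (LinearMap.congr_fun hb t) m
    have hU : IsUnitary Y := isUnitary_of_star I Y fun t h k => by
      rw [hY, hY, Dome.mk_star]
      exact hπ'.map_star _ _ _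
    have hA : enrichedCenter A Y := by
      have hD : Descends I A Y := ⟨π, hπ', fun t m => (hY t m).symm⟩
      exact ((enrichedCenter_tfae I A Y hU).out 0 3).2 hD
    have hiso (t : Dome I A) (h : HSpace I Y.1) :
        (hRep I A Y hA).π t h = Φ (M.π t (Φ.symm h)) := by
      obtain ⟨t, rfl⟩ := Dome.mk_surjective I A t
      exact (hY t h).trans (hπ _ _)
    refine ⟨Opposite.op ⟨Y, hA⟩, ⟨?_⟩⟩
    exact
      { hom := StarRep.Hom.mk (V := hRep I A Y hA) Φ.symm.toLinearEquiv.toLinearMap fun t h =>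
          (congrArg Φ.symm (hiso t h)).trans (Φ.symm_apply_apply _)
        inv := StarRep.Hom.mk (W := hRep I A Y hA) Φ.toLinearEquiv.toLinearMap fun t h =>
          ((hiso t (Φ h)).trans (congrArg (fun k => Φ (M.π t k)) (Φ.symm_apply_apply h))).symm
        hom_inv_id := StarRep.Hom.ext (LinearMap.ext fun h => Φ.apply_symm_apply h)
        inv_hom_id := StarRep.Hom.ext (LinearMap.ext fun h => Φ.symm_apply_apply h) }

instance : (hFunctor I A).IsEquivalence where

end Model

namespace StarRep

section Schur

variable {B : Type v} [AddCommGroup B] [Module ℂ B] [Mul B] [One B] [Star B]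

/-- The linear map `f` commutes with the action. -/
def IsIntertwiner (M N : StarRep B) (f : M.H →ₗ[ℂ] N.H) : Prop :=
  ∀ t h, f (M.π t h) = N.π t (f h)

theorem IsIntertwiner.comp {M N P : StarRep B} {g : N.H →ₗ[ℂ] P.H} {f : M.H →ₗ[ℂ] N.H}
    (hg : IsIntertwiner N P g) (hf : IsIntertwiner M N f) : IsIntertwiner M P (g ∘ₗ f) :=
  fun t h => by rw [LinearMap.comp_apply, hf, hg, LinearMap.comp_apply]

theorem IsIntertwiner.smul {M N : StarRep B} {f : M.H →ₗ[ℂ] N.H} (hf : IsIntertwiner M N f)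
    (c : ℂ) : IsIntertwiner M N (c • f) :=
  fun t h => by rw [LinearMap.smul_apply, hf, LinearMap.smul_apply, map_smul]

theorem IsIntertwiner.id (M : StarRep B) : IsIntertwiner M M LinearMap.id := fun _ _ => rfl

theorem IsIntertwiner.zero (M N : StarRep B) : IsIntertwiner M N 0 := fun t h => by simp

theorem IsIntertwiner.sum {M N : StarRep B} {J : Type*} (s : Finset J) (f : J → M.H →ₗ[ℂ] N.H)
    (hf : ∀ j, IsIntertwiner M N (f j)) : IsIntertwiner M N (∑ j ∈ s, f j) := fun t h => by
  rw [LinearMap.sum_apply, LinearMap.sum_apply, map_sum]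
  exact Finset.sum_congr rfl fun j _ => hf j t h

theorem inner_star_right (M : StarRep B) (t : B) (h k : M.H) :
    inner ℂ h (M.π (star t) k) = inner ℂ (M.π t h) k := by
  rw [← inner_conj_symm, M.isStarRep.map_star, inner_conj_symm]

theorem IsIntertwiner.adjoint {M N : StarRep B} {f : M.H →ₗ[ℂ] N.H} (hf : IsIntertwiner M N f) :
    IsIntertwiner N M (LinearMap.adjoint f) := fun t k => by
  refine ext_inner_right ℂ fun h => ?_
  rw [LinearMap.adjoint_inner_left, ← inner_star_right, ← hf, ← inner_star_right,
    LinearMap.adjoint_inner_left]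

/-- The subrepresentation on an invariant subspace. -/
def sub (M : StarRep B) (W : Submodule ℂ M.H) (hW : ∀ t, ∀ h ∈ W, M.π t h ∈ W) : StarRep B where
  H := W
  π :=
    { toFun := fun t => (M.π t).restrict (hW t)
      map_add' := fun s t => LinearMap.ext fun h => Subtype.ext (by simp)
      map_smul' := fun c t => LinearMap.ext fun h => Subtype.ext (by simp) }
  isStarRep :=
    { map_one := LinearMap.ext fun h => Subtype.ext (by
        change M.π 1 (h : M.H) = h
        rw [M.isStarRep.map_one]
        rfl)
      map_mul := fun s t => LinearMap.ext fun h => Subtype.ext (by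
        change M.π (s * t) (h : M.H) = M.π s (M.π t (h : M.H))
        rw [M.isStarRep.map_mul]
        rfl)
      map_star := fun t h k => M.isStarRep.map_star t (h : M.H) (k : M.H) }

theorem orthogonal_invariant (M : StarRep B) (W : Submodule ℂ M.H)
    (hW : ∀ t, ∀ h ∈ W, M.π t h ∈ W) : ∀ t, ∀ h ∈ Wᗮ, M.π t h ∈ Wᗮ := fun t h hh => by
  rw [Submodule.mem_orthogonal] at hh ⊢
  intro k hk
  rw [← M.isStarRep.map_star]
  exact hh _ (hW _ _ hk)

/-- A representation is irreducible. -/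
def IsIrreducible (M : StarRep B) : Prop :=
  Nontrivial M.H ∧ ∀ W : Submodule ℂ M.H, (∀ t, ∀ h ∈ W, M.π t h ∈ W) → W = ⊥ ∨ W = ⊤

theorem IsIrreducible.exists_smul_id {M : StarRep B} (hM : M.IsIrreducible) {f : M.H →ₗ[ℂ] M.H}
    (hf : IsIntertwiner M M f) : ∃ c : ℂ, f = c • LinearMap.id := by
  have := hM.1
  obtain ⟨c, hc⟩ := Module.End.exists_eigenvalue f
  refine ⟨c, ?_⟩
  rcases hM.2 (Module.End.eigenspace f c) (fun t h hh => by
    rw [Module.End.mem_eigenspace_iff] at hh ⊢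
    rw [hf, hh, map_smul]) with h | h
  · exact absurd h hc
  · refine LinearMap.ext fun k => ?_
    have : k ∈ Module.End.eigenspace f c := h ▸ Submodule.mem_top
    simpa using Module.End.mem_eigenspace_iff.1 this

theorem IsIrreducible.bijective {M N : StarRep B} (hM : M.IsIrreducible) (hN : N.IsIrreducible)
    {f : M.H →ₗ[ℂ] N.H} (hf : IsIntertwiner M N f) (h0 : f ≠ 0) : Function.Bijective f := by
  constructor
  · rcases hM.2 (LinearMap.ker f) (fun t h hh => by
      rw [LinearMap.mem_ker] at hh ⊢
      rw [hf, hh, map_zero]) with h | h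
    · exact LinearMap.ker_eq_bot.1 h
    · exact absurd (LinearMap.ker_eq_top.1 h) h0
  · rcases hN.2 (LinearMap.range f) (fun t h => by
      rintro ⟨k, rfl⟩
      exact ⟨M.π t k, hf t k⟩) with h | h
    · exact absurd (LinearMap.range_eq_bot.1 h) h0
    · exact LinearMap.range_eq_top.1 h

theorem nonempty_iso_of_bijective {M N : StarRep B} {f : M.H →ₗ[ℂ] N.H} (hf : IsIntertwiner M N f)
    (hb : Function.Bijective f) : Nonempty (M ≅ N) := by
  let e := LinearEquiv.ofBijective f hb
  have he (t h) : e (M.π t h) = N.π t (e h) := hf t h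
  exact ⟨{
    hom := Hom.mk f hf
    inv := Hom.mk e.symm.toLinearMap fun t h => by
      change e.symm _ = M.π t (e.symm h)
      rw [LinearEquiv.symm_apply_eq, he, LinearEquiv.apply_symm_apply]
    hom_inv_id := Hom.ext (LinearMap.ext fun h => e.symm_apply_apply h)
    inv_hom_id := Hom.ext (LinearMap.ext fun h => e.apply_symm_apply h) }⟩

variable (B) in
/-- The relation of isomorphism between irreducible representations. -/
def irrSetoid : Setoid {M : StarRep B // M.IsIrreducible} where
  r M N := Nonempty (M.1 ≅ N.1)
  iseqv := ⟨fun _ => ⟨Iso.refl _⟩, fun ⟨e⟩ => ⟨e.symm⟩, fun ⟨e⟩ ⟨e'⟩ => ⟨e.trans e'⟩⟩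

variable (B) in
/-- The isomorphism classes of irreducible representations. -/
def Irr : Type (v + 1) := Quotient (irrSetoid B)

/-- The chosen representative of an isomorphism class of irreducible representations. -/
def Irr.rep (j : Irr B) : StarRep B := (Quotient.out j).1

theorem Irr.isIrreducible (j : Irr B) : j.rep.IsIrreducible := (Quotient.out j).2

theorem Irr.eq_zero {i j : Irr B} (h : i ≠ j) {f : i.rep.H →ₗ[ℂ] j.rep.H}
    (hf : IsIntertwiner _ _ f) : f = 0 := by
  by_contra h0
  obtain ⟨e⟩ := nonempty_iso_of_bijective hf (i.isIrreducible.bijective j.isIrreducible hf h0)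
  refine h ?_
  rw [← Quotient.out_eq i, ← Quotient.out_eq j]
  exact Quotient.sound ⟨e⟩

theorem IsIrreducible.exists_iso {M : StarRep B} (hM : M.IsIrreducible) :
    ∃ j : Irr B, Nonempty (j.rep ≅ M) := by
  let j : Irr B := Quotient.mk (irrSetoid B) ⟨M, hM⟩
  exact ⟨j, Quotient.exact (s := irrSetoid B) (Quotient.out_eq j)⟩

/-- An orthogonal decomposition into chosen irreducible representations. -/
structure Decomp (M : StarRep B) where
  K : Type
  [fintype : Fintype K]
  j : K → Irr B
  s : ∀ k, (j k).rep.H →ₗ[ℂ] M.H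
  comm : ∀ k, IsIntertwiner _ _ (s k)
  self : ∀ k, LinearMap.adjoint (s k) ∘ₗ s k = LinearMap.id
  ne : ∀ k l, k ≠ l → LinearMap.adjoint (s k) ∘ₗ s l = 0
  total : ∑ k, s k ∘ₗ LinearMap.adjoint (s k) = LinearMap.id

attribute [instance] Decomp.fintype

theorem IsIrreducible.nonempty_decomp {M : StarRep B} (hM : M.IsIrreducible) :
    Nonempty M.Decomp := by
  obtain ⟨j, ⟨e⟩⟩ := hM.exists_iso
  have he : IsIntertwiner j.rep M e.hom.lin := e.hom.comm
  obtain ⟨c, hc⟩ := j.isIrreducible.exists_smul_id (he.adjoint.comp he)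
  have h1 (h : j.rep.H) : e.inv.lin (e.hom.lin h) = h :=
    LinearMap.congr_fun (congrArg Hom.lin e.hom_inv_id) h
  have h2 (h : M.H) : e.hom.lin (e.inv.lin h) = h :=
    LinearMap.congr_fun (congrArg Hom.lin e.inv_hom_id) h
  have := j.isIrreducible.1
  obtain ⟨h, hh⟩ := exists_ne (0 : j.rep.H)
  have h3 : inner ℂ (e.hom.lin h) (e.hom.lin h) = c * inner ℂ h h := by
    rw [← LinearMap.adjoint_inner_right, ← LinearMap.comp_apply, hc]
    simp [inner_smul_right]
  have h4 : e.hom.lin h ≠ 0 := fun h0 => hh (by rw [← h1 h, h0, map_zero])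
  obtain ⟨r, hr, rfl⟩ : ∃ r : ℝ, 0 < r ∧ c = r := by
    rw [inner_self_eq_norm_sq_to_K, inner_self_eq_norm_sq_to_K] at h3
    have h5 : 0 < ‖h‖ := norm_pos_iff.2 hh
    have h6 : 0 < ‖e.hom.lin h‖ := norm_pos_iff.2 h4
    refine ⟨‖e.hom.lin h‖ ^ 2 / ‖h‖ ^ 2, by positivity, ?_⟩
    have h7 : ((‖h‖ : ℝ) : ℂ) ≠ 0 := by exact_mod_cast h5.ne'
    push_cast
    rw [eq_div_iff (pow_ne_zero 2 h7)]
    exact h3.symm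
  let s : j.rep.H →ₗ[ℂ] M.H := ((Real.sqrt r)⁻¹ : ℂ) • e.hom.lin
  have hs : LinearMap.adjoint s ∘ₗ s = LinearMap.id := by
    have h5 : ((Real.sqrt r : ℝ) : ℂ) ≠ 0 := by exact_mod_cast (Real.sqrt_pos.2 hr).ne'
    have h6 : (r : ℂ) = Real.sqrt r * Real.sqrt r := by
      exact_mod_cast (Real.mul_self_sqrt hr.le).symm
    simp only [s, map_smulₛₗ, LinearMap.smul_comp, LinearMap.comp_smul]
    rw [hc, smul_smul, smul_smul, map_inv₀, Complex.conj_ofReal, h6]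
    have : ((Real.sqrt r : ℝ) : ℂ)⁻¹ * (Real.sqrt r : ℂ)⁻¹ * (Real.sqrt r * Real.sqrt r) = 1 := by
      field_simp
    rw [this, one_smul]
  have hs' : Function.Surjective s := by
    intro k
    refine ⟨(Real.sqrt r : ℂ) • e.inv.lin k, ?_⟩
    have h5 : ((Real.sqrt r : ℝ) : ℂ) ≠ 0 := by exact_mod_cast (Real.sqrt_pos.2 hr).ne'
    change ((Real.sqrt r)⁻¹ : ℂ) • e.hom.lin _ = k
    rw [map_smul, h2, smul_smul, inv_mul_cancel₀ h5, one_smul]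
  exact ⟨{
    K := Unit
    j := fun _ => j
    s := fun _ => s
    comm := fun _ => he.smul _
    self := fun _ => hs
    ne := fun k l h => absurd (Subsingleton.elim k l) h
    total := by
      rw [Finset.univ_unique, Finset.sum_singleton]
      refine LinearMap.ext fun k => ?_
      obtain ⟨h, rfl⟩ := hs' k
      exact congrArg s (LinearMap.congr_fun hs h) }⟩

/-- Decompositions of two orthogonal complementary pieces combine. -/
theorem Decomp.nonempty_of_sum {M N P : StarRep B} (a : N.H →ₗ[ℂ] M.H) (b : P.H →ₗ[ℂ] M.H)
    (ha : IsIntertwiner N M a) (hb : IsIntertwiner P M b)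
    (haa : LinearMap.adjoint a ∘ₗ a = LinearMap.id) (hbb : LinearMap.adjoint b ∘ₗ b = LinearMap.id)
    (hab : LinearMap.adjoint a ∘ₗ b = 0)
    (htot : a ∘ₗ LinearMap.adjoint a + b ∘ₗ LinearMap.adjoint b = LinearMap.id)
    (D : N.Decomp) (E : P.Decomp) : Nonempty M.Decomp := by
  have hba : LinearMap.adjoint b ∘ₗ a = 0 := by
    have := congrArg LinearMap.adjoint hab
    rwa [LinearMap.adjoint_comp, LinearMap.adjoint_adjoint, map_zero] at this
  refine ⟨{
    K := D.K ⊕ E.K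
    j := Sum.elim D.j E.j
    s := fun k => match k with
      | Sum.inl k => a ∘ₗ D.s k
      | Sum.inr k => b ∘ₗ E.s k
    comm := ?_
    self := ?_
    ne := ?_
    total := ?_ }⟩
  · rintro (k | k)
    · exact ha.comp (D.comm k)
    · exact hb.comp (E.comm k)
  · rintro (k | k)
    · change LinearMap.adjoint (a ∘ₗ D.s k) ∘ₗ (a ∘ₗ D.s k) = LinearMap.id
      rw [LinearMap.adjoint_comp, LinearMap.comp_assoc, ← LinearMap.comp_assoc _ a, haa,
        LinearMap.id_comp, D.self]
    · change LinearMap.adjoint (b ∘ₗ E.s k) ∘ₗ (b ∘ₗ E.s k) = LinearMap.id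
      rw [LinearMap.adjoint_comp, LinearMap.comp_assoc, ← LinearMap.comp_assoc _ b, hbb,
        LinearMap.id_comp, E.self]
  · rintro (k | k) (l | l) h
    · change LinearMap.adjoint (a ∘ₗ D.s k) ∘ₗ (a ∘ₗ D.s l) = 0
      rw [LinearMap.adjoint_comp, LinearMap.comp_assoc, ← LinearMap.comp_assoc _ a, haa,
        LinearMap.id_comp, D.ne k l fun e => h (e ▸ rfl)]
    · change LinearMap.adjoint (a ∘ₗ D.s k) ∘ₗ (b ∘ₗ E.s l) = 0
      rw [LinearMap.adjoint_comp, LinearMap.comp_assoc, ← LinearMap.comp_assoc _ b, hab,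
        LinearMap.zero_comp, LinearMap.comp_zero]
    · change LinearMap.adjoint (b ∘ₗ E.s k) ∘ₗ (a ∘ₗ D.s l) = 0
      rw [LinearMap.adjoint_comp, LinearMap.comp_assoc, ← LinearMap.comp_assoc _ a, hba,
        LinearMap.zero_comp, LinearMap.comp_zero]
    · change LinearMap.adjoint (b ∘ₗ E.s k) ∘ₗ (b ∘ₗ E.s l) = 0
      rw [LinearMap.adjoint_comp, LinearMap.comp_assoc, ← LinearMap.comp_assoc _ b, hbb,
        LinearMap.id_comp, E.ne k l fun e => h (e ▸ rfl)]
  · rw [Fintype.sum_sum_type, ← htot]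
    congr 1
    · change ∑ k, (a ∘ₗ D.s k) ∘ₗ LinearMap.adjoint (a ∘ₗ D.s k) = _
      have h1 : a ∘ₗ LinearMap.id ∘ₗ LinearMap.adjoint a = a ∘ₗ LinearMap.adjoint a := rfl
      rw [← h1, ← D.total]
      refine LinearMap.ext fun h => ?_
      simp [LinearMap.adjoint_comp]
    · change ∑ k, (b ∘ₗ E.s k) ∘ₗ LinearMap.adjoint (b ∘ₗ E.s k) = _
      have h1 : b ∘ₗ LinearMap.id ∘ₗ LinearMap.adjoint b = b ∘ₗ LinearMap.adjoint b := rfl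
      rw [← h1, ← E.total]
      refine LinearMap.ext fun h => ?_
      simp [LinearMap.adjoint_comp]

theorem nonempty_decomp_aux : ∀ (d : ℕ) (M : StarRep B), Module.finrank ℂ M.H = d →
    Nonempty M.Decomp := by
  intro d
  induction d using Nat.strong_induction_on with
  | _ d ih =>
  intro M hd
  by_cases hM : M.IsIrreducible
  · exact hM.nonempty_decomp
  by_cases hn : Nontrivial M.H
  · obtain ⟨W, hW, h0, h1⟩ : ∃ W : Submodule ℂ M.H, (∀ t, ∀ h ∈ W, M.π t h ∈ W) ∧ W ≠ ⊥ ∧ W ≠ ⊤ := by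
      by_contra hcon
      push Not at hcon
      refine hM ⟨hn, fun W hW => ?_⟩
      by_cases h : W = ⊥
      · exact Or.inl h
      · exact Or.inr (hcon W hW h)
    have hdim := W.finrank_add_finrank_orthogonal
    have h2 : Module.finrank ℂ W ≠ 0 := fun h => h0 (Submodule.finrank_eq_zero.1 h)
    have h3 : Module.finrank ℂ Wᗮ ≠ 0 := fun h => h1 (by
      have := Submodule.finrank_eq_zero.1 h
      rwa [Submodule.orthogonal_eq_bot_iff] at this)
    obtain ⟨D⟩ := ih (Module.finrank ℂ W) (by omega) (M.sub W hW) rfl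
    obtain ⟨E⟩ := ih (Module.finrank ℂ Wᗮ) (by omega)
      (M.sub Wᗮ (M.orthogonal_invariant W hW)) rfl
    have hadj (V : Submodule ℂ M.H) (h : M.H) :
        LinearMap.adjoint V.subtype h = V.orthogonalProjectionOnto h := by
      refine ext_inner_right ℂ fun k => ?_
      rw [LinearMap.adjoint_inner_left]
      simp
    refine Decomp.nonempty_of_sum (N := M.sub W hW)
      (P := M.sub Wᗮ (M.orthogonal_invariant W hW)) W.subtype Wᗮ.subtype (fun _ _ => rfl)
      (fun _ _ => rfl) ?_ ?_ ?_ ?_ D E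
    · exact LinearMap.ext fun h =>
        (hadj W _).trans (Submodule.orthogonalProjectionOnto_mem_subspace_eq_self h)
    · exact LinearMap.ext fun h =>
        (hadj Wᗮ _).trans (Submodule.orthogonalProjectionOnto_mem_subspace_eq_self h)
    · exact LinearMap.ext fun h => (hadj W _).trans
        (Submodule.orthogonalProjectionOnto_apply_of_mem_orthogonal h.2)
    · refine LinearMap.ext fun h => ?_
      refine Eq.trans ?_ (W.starProjection_add_starProjection_orthogonal h)
      exact congrArg₂ (· + ·) (congrArg W.subtype (hadj W h)) (congrArg Wᗮ.subtype (hadj Wᗮ h))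
  · rw [not_nontrivial_iff_subsingleton] at hn
    exact ⟨{
      K := Empty
      j := Empty.elim
      s := fun k => k.elim
      comm := fun k => k.elim
      self := fun k => k.elim
      ne := fun k => k.elim
      total := LinearMap.ext fun h => Subsingleton.elim _ _ }⟩

/-- The chosen decomposition. -/
def decomp (M : StarRep B) : M.Decomp := (nonempty_decomp_aux _ M rfl).some

end Schur

end StarRep

namespace StarRep

section Conjugation

variable {B : Type v} [AddCommGroup B] [Module ℂ B] [Mul B] [One B] [Star B]

/-- Complex conjugation of the multiples of the identity of a chosen irreducible. -/
def irrConj {i j : Irr B} (g : i.rep.H →ₗ[ℂ] j.rep.H) : i.rep.H →ₗ[ℂ] j.rep.H := by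
  classical
  exact if h : i = j then by
    subst h
    exact conj (LinearMap.trace ℂ _ g / Module.finrank ℂ i.rep.H) • LinearMap.id
  else 0

theorem irrConj_self {i : Irr B} (g : i.rep.H →ₗ[ℂ] i.rep.H) :
    irrConj g = conj (LinearMap.trace ℂ _ g / Module.finrank ℂ i.rep.H) • LinearMap.id := by
  simp [irrConj]

theorem irrConj_ne {i j : Irr B} (h : i ≠ j) (g : i.rep.H →ₗ[ℂ] j.rep.H) : irrConj g = 0 := by
  simp [irrConj, h]

theorem irrConj_smul_id {i : Irr B} (c : ℂ) :
    irrConj (c • (LinearMap.id : i.rep.H →ₗ[ℂ] i.rep.H)) = conj c • LinearMap.id := by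
  have := i.isIrreducible.1
  have h : (Module.finrank ℂ i.rep.H : ℂ) ≠ 0 := by exact_mod_cast Module.finrank_pos.ne'
  rw [irrConj_self, map_smul, LinearMap.trace_id, smul_eq_mul, mul_div_cancel_right₀ _ h]

theorem irrConj_add {i j : Irr B} (f g : i.rep.H →ₗ[ℂ] j.rep.H) :
    irrConj (f + g) = irrConj f + irrConj g := by
  by_cases h : i = j
  · subst h
    rw [irrConj_self, irrConj_self, irrConj_self, map_add, add_div, map_add, add_smul]
  · simp [irrConj_ne h]

theorem irrConj_smul {i j : Irr B} (c : ℂ) (g : i.rep.H →ₗ[ℂ] j.rep.H) :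
    irrConj (c • g) = conj c • irrConj g := by
  by_cases h : i = j
  · subst h
    rw [irrConj_self, irrConj_self, map_smul, smul_eq_mul, mul_div_assoc, map_mul, mul_smul]
  · simp [irrConj_ne h]

/-- `irrConj` as an antilinear map. -/
def irrConjₗ (i j : Irr B) : (i.rep.H →ₗ[ℂ] j.rep.H) →ₛₗ[starRingEnd ℂ] (i.rep.H →ₗ[ℂ] j.rep.H) where
  toFun := irrConj
  map_add' := irrConj_add
  map_smul' := irrConj_smul

theorem isIntertwiner_irrConj {i j : Irr B} (g : i.rep.H →ₗ[ℂ] j.rep.H) :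
    IsIntertwiner i.rep j.rep (irrConj g) := by
  by_cases h : i = j
  · subst h
    rw [irrConj_self]
    exact (IsIntertwiner.id _).smul _
  · rw [irrConj_ne h]
    exact IsIntertwiner.zero _ _

theorem irrConj_comp {i j k : Irr B} {f : i.rep.H →ₗ[ℂ] j.rep.H} {g : j.rep.H →ₗ[ℂ] k.rep.H}
    (hf : IsIntertwiner _ _ f) (hg : IsIntertwiner _ _ g) :
    irrConj (g ∘ₗ f) = irrConj g ∘ₗ irrConj f := by
  by_cases h : i = j
  · subst h
    obtain ⟨c, rfl⟩ := i.isIrreducible.exists_smul_id hf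
    rw [LinearMap.comp_smul, LinearMap.comp_id, irrConj_smul, irrConj_smul_id,
      LinearMap.comp_smul, LinearMap.comp_id]
  · rw [Irr.eq_zero h hf, LinearMap.comp_zero, irrConj_ne h, LinearMap.comp_zero]
    exact (irrConjₗ i k).map_zero

theorem irrConj_irrConj {i j : Irr B} {f : i.rep.H →ₗ[ℂ] j.rep.H} (hf : IsIntertwiner _ _ f) :
    irrConj (irrConj f) = f := by
  by_cases h : i = j
  · subst h
    obtain ⟨c, rfl⟩ := i.isIrreducible.exists_smul_id hf
    rw [irrConj_smul_id, irrConj_smul_id, Complex.conj_conj]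
  · rw [Irr.eq_zero h hf, irrConj_ne h]

theorem irrConj_adjoint {i j : Irr B} {f : i.rep.H →ₗ[ℂ] j.rep.H} (hf : IsIntertwiner _ _ f) :
    irrConj (LinearMap.adjoint f) = LinearMap.adjoint (irrConj f) := by
  by_cases h : i = j
  · subst h
    obtain ⟨c, rfl⟩ := i.isIrreducible.exists_smul_id hf
    have hid : LinearMap.adjoint (LinearMap.id : i.rep.H →ₗ[ℂ] i.rep.H) = LinearMap.id :=
      LinearMap.adjoint_id
    rw [irrConj_smul_id, map_smulₛₗ, map_smulₛₗ, hid, irrConj_smul_id]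
  · rw [irrConj_ne h, irrConj_ne (Ne.symm h), map_zero]

/-- Complex conjugation of the matrix entries of a linear map with respect to the chosen
decompositions of its source and target. -/
def conjLin (M N : StarRep B) : (M.H →ₗ[ℂ] N.H) →ₛₗ[starRingEnd ℂ] (M.H →ₗ[ℂ] N.H) where
  toFun f := ∑ k, ∑ l, N.decomp.s l ∘ₗ
    irrConjₗ _ _ (LinearMap.adjoint (N.decomp.s l) ∘ₗ f ∘ₗ M.decomp.s k) ∘ₗ
      LinearMap.adjoint (M.decomp.s k)
  map_add' f g := by
    simp only [LinearMap.add_comp, LinearMap.comp_add, map_add, Finset.sum_add_distrib]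
  map_smul' c f := by
    simp only [LinearMap.smul_comp, LinearMap.comp_smul, map_smulₛₗ, Finset.smul_sum]

theorem conjLin_apply (M N : StarRep B) (f : M.H →ₗ[ℂ] N.H) : conjLin M N f =
    ∑ k, ∑ l, N.decomp.s l ∘ₗ
      irrConj (LinearMap.adjoint (N.decomp.s l) ∘ₗ f ∘ₗ M.decomp.s k) ∘ₗ
        LinearMap.adjoint (M.decomp.s k) := rfl

theorem Decomp.adjoint_apply_s {M : StarRep B} (D : M.Decomp) (k : D.K) (h : (D.j k).rep.H) :
    LinearMap.adjoint (D.s k) (D.s k h) = h := LinearMap.congr_fun (D.self k) h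

theorem Decomp.adjoint_apply_s_ne {M : StarRep B} (D : M.Decomp) {k l : D.K} (hkl : k ≠ l)
    (h : (D.j l).rep.H) : LinearMap.adjoint (D.s k) (D.s l h) = 0 :=
  LinearMap.congr_fun (D.ne k l hkl) h

theorem Decomp.sum_apply {M : StarRep B} (D : M.Decomp) (h : M.H) :
    ∑ k, D.s k (LinearMap.adjoint (D.s k) h) = h := by
  have := LinearMap.congr_fun D.total h
  simpa using this

theorem Decomp.expand {M N : StarRep B} (D : M.Decomp) (E : N.Decomp) (f : M.H →ₗ[ℂ] N.H) :
    ∑ k, ∑ l, E.s l ∘ₗ (LinearMap.adjoint (E.s l) ∘ₗ f ∘ₗ D.s k) ∘ₗ LinearMap.adjoint (D.s k) = f := by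
  refine LinearMap.ext fun h => ?_
  simp only [LinearMap.sum_apply, LinearMap.comp_apply, E.sum_apply]
  rw [← map_sum, D.sum_apply]

theorem adjoint_comp_conjLin_comp (M N : StarRep B) (f : M.H →ₗ[ℂ] N.H) (k : M.decomp.K)
    (l : N.decomp.K) : LinearMap.adjoint (N.decomp.s l) ∘ₗ conjLin M N f ∘ₗ M.decomp.s k =
      irrConj (LinearMap.adjoint (N.decomp.s l) ∘ₗ f ∘ₗ M.decomp.s k) := by
  refine LinearMap.ext fun h => ?_
  simp only [conjLin_apply, LinearMap.comp_apply, LinearMap.sum_apply]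
  rw [Finset.sum_eq_single k, map_sum, Finset.sum_eq_single l, Decomp.adjoint_apply_s,
    Decomp.adjoint_apply_s]
  · intro l' _ hl
    rw [Decomp.adjoint_apply_s_ne _ hl.symm]
  · simp
  · intro k' _ hk
    refine Finset.sum_eq_zero fun l' _ => ?_
    rw [Decomp.adjoint_apply_s_ne _ hk, map_zero, map_zero]
  · simp

theorem eq_of_entries {M N : StarRep B} {f g : M.H →ₗ[ℂ] N.H}
    (h : ∀ k l, LinearMap.adjoint (N.decomp.s l) ∘ₗ f ∘ₗ M.decomp.s k =
      LinearMap.adjoint (N.decomp.s l) ∘ₗ g ∘ₗ M.decomp.s k) : f = g := by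
  rw [← Decomp.expand M.decomp N.decomp f, ← Decomp.expand M.decomp N.decomp g]
  simp only [h]

theorem isIntertwiner_entry {M N : StarRep B} {f : M.H →ₗ[ℂ] N.H} (hf : IsIntertwiner M N f)
    (k : M.decomp.K) (l : N.decomp.K) :
    IsIntertwiner _ _ (LinearMap.adjoint (N.decomp.s l) ∘ₗ f ∘ₗ M.decomp.s k) :=
  (N.decomp.comm l).adjoint.comp (hf.comp (M.decomp.comm k))

theorem isIntertwiner_conjLin (M N : StarRep B) (f : M.H →ₗ[ℂ] N.H) :
    IsIntertwiner M N (conjLin M N f) :=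
  IsIntertwiner.sum _ _ fun k => IsIntertwiner.sum _ _ fun l =>
    (N.decomp.comm l).comp ((isIntertwiner_irrConj _).comp (M.decomp.comm k).adjoint)

theorem conjLin_conjLin {M N : StarRep B} {f : M.H →ₗ[ℂ] N.H} (hf : IsIntertwiner M N f) :
    conjLin M N (conjLin M N f) = f := by
  refine eq_of_entries fun k l => ?_
  rw [adjoint_comp_conjLin_comp, adjoint_comp_conjLin_comp,
    irrConj_irrConj (isIntertwiner_entry hf k l)]

theorem conjLin_adjoint {M N : StarRep B} {f : M.H →ₗ[ℂ] N.H} (hf : IsIntertwiner M N f) :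
    conjLin N M (LinearMap.adjoint f) = LinearMap.adjoint (conjLin M N f) := by
  refine eq_of_entries fun k l => ?_
  have h1 (g : M.H →ₗ[ℂ] N.H) : LinearMap.adjoint (M.decomp.s l) ∘ₗ LinearMap.adjoint g ∘ₗ
      N.decomp.s k = LinearMap.adjoint (LinearMap.adjoint (N.decomp.s k) ∘ₗ g ∘ₗ M.decomp.s l) := by
    rw [LinearMap.adjoint_comp, LinearMap.adjoint_comp, LinearMap.adjoint_adjoint]
    rfl
  rw [adjoint_comp_conjLin_comp, h1, h1, irrConj_adjoint (isIntertwiner_entry hf l k),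
    adjoint_comp_conjLin_comp]

theorem conjLin_id (M : StarRep B) : conjLin M M LinearMap.id = LinearMap.id := by
  refine eq_of_entries fun k l => ?_
  rw [adjoint_comp_conjLin_comp, LinearMap.id_comp]
  by_cases h : l = k
  · subst h
    rw [Decomp.self, ← one_smul ℂ LinearMap.id, irrConj_smul_id, map_one]
  · rw [Decomp.ne _ _ _ h]
    exact (irrConjₗ _ _).map_zero

theorem conjLin_comp {M N P : StarRep B} {f : M.H →ₗ[ℂ] N.H} {g : N.H →ₗ[ℂ] P.H}
    (hf : IsIntertwiner M N f) (hg : IsIntertwiner N P g) :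
    conjLin M P (g ∘ₗ f) = conjLin N P g ∘ₗ conjLin M N f := by
  have h1 (f : M.H →ₗ[ℂ] N.H) (g : N.H →ₗ[ℂ] P.H) (k l) :
      LinearMap.adjoint (P.decomp.s l) ∘ₗ (g ∘ₗ f) ∘ₗ M.decomp.s k =
      ∑ n, (LinearMap.adjoint (P.decomp.s l) ∘ₗ g ∘ₗ N.decomp.s n) ∘ₗ
        (LinearMap.adjoint (N.decomp.s n) ∘ₗ f ∘ₗ M.decomp.s k) := by
    refine LinearMap.ext fun h => ?_
    simp only [LinearMap.sum_apply, LinearMap.comp_apply]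
    rw [← map_sum, ← map_sum, Decomp.sum_apply]
  refine eq_of_entries fun k l => ?_
  rw [adjoint_comp_conjLin_comp, h1, h1]
  change irrConjₗ _ _ _ = _
  rw [map_sum]
  refine Finset.sum_congr rfl fun n _ => ?_
  rw [adjoint_comp_conjLin_comp, adjoint_comp_conjLin_comp]
  exact irrConj_comp (isIntertwiner_entry hf k n) (isIntertwiner_entry hg n l)

end Conjugation

end StarRep

section Covariant

variable {C : Type u} [Category.{v} C] [Abelian C] [Linear ℂ C] [MonoidalCategory C]
  [MonoidalPreadditive C] [MonoidalLinear ℂ C] [RigidCategory C] [UnitaryFusionCategory C]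
  {ι : Type} [Fintype ι] (I : SimpleReps C ι) (A : ObjectProperty (Center C))

/-- The dagger of a morphism between objects of the unitary center. -/
def centerDag {X Y : (enrichedCenter A).FullSubcategory} (f : X ⟶ Y) : Y ⟶ X :=
  ObjectProperty.homMk ⟨dag f.hom.f, fun U => by
    have h := congrArg dag (f.hom.comm U)
    rw [dag_comp, dag_comp, dag_whiskerLeft, dag_whiskerRight, X.property.1, Y.property.1] at h
    rw [← cancel_epi (Y.obj.2.β U).inv, Iso.inv_hom_id_assoc, ← cancel_mono (X.obj.2.β U).inv]
    simpa using h⟩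

theorem hom_ext_f {X Y : (enrichedCenter A).FullSubcategory} {f g : X ⟶ Y}
    (h : f.hom.f = g.hom.f) : f = g :=
  ObjectProperty.hom_ext _ (Center.ext _ _ h)

theorem centerDag_centerDag {X Y : (enrichedCenter A).FullSubcategory} (f : X ⟶ Y) :
    centerDag A (centerDag A f) = f := hom_ext_f A (dag_dag _)

theorem centerDag_id (X : (enrichedCenter A).FullSubcategory) : centerDag A (𝟙 X) = 𝟙 X :=
  hom_ext_f A (dag_id _)

theorem centerDag_comp {X Y Z : (enrichedCenter A).FullSubcategory} (f : X ⟶ Y) (g : Y ⟶ Z) :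
    centerDag A (f ≫ g) = centerDag A g ≫ centerDag A f :=
  hom_ext_f A (dag_comp _ _)

theorem HSpace.adjoint_precomp {X Y : C} (f : X ⟶ Y) :
    LinearMap.adjoint (HSpace.precomp I (dag f)) = HSpace.precomp I f := by
  symm
  rw [LinearMap.eq_adjoint_iff]
  intro m n
  rw [HSpace.inner_def, HSpace.inner_def]
  refine Finset.sum_congr rfl fun y _ => ?_
  rw [HSpace.precomp_apply, HSpace.precomp_apply, dag_comp, Category.assoc]

/-- The covariant functor: matrix entries of `H(f†)` are complex conjugated. -/
def covFunctor : (enrichedCenter A).FullSubcategory ⥤ StarRep (Dome I A) where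
  obj X := hRep I A X.obj X.property
  map {X Y} f := StarRep.Hom.mk
    (StarRep.conjLin _ _ (StarRep.toLin ((hFunctor I A).map (centerDag A f).op)))
    (StarRep.isIntertwiner_conjLin _ _ _)
  map_id X := StarRep.Hom.ext (by
    rw [centerDag_id, op_id, CategoryTheory.Functor.map_id]
    exact StarRep.conjLin_id _)
  map_comp {X Y Z} f g := StarRep.Hom.ext (by
    rw [centerDag_comp, op_comp, CategoryTheory.Functor.map_comp]
    exact StarRep.conjLin_comp (StarRep.Hom.comm _) (StarRep.Hom.comm _))

theorem toLin_covFunctor_map {X Y : (enrichedCenter A).FullSubcategory} (f : X ⟶ Y) :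
    StarRep.toLin ((covFunctor I A).map f) = StarRep.conjLin (hRep I A X.obj X.property)
      (hRep I A Y.obj Y.property) (HSpace.precomp I (dag f.hom.f)) := rfl

theorem isIntertwiner_precomp_dag {X Y : (enrichedCenter A).FullSubcategory} (f : X ⟶ Y) :
    StarRep.IsIntertwiner (hRep I A X.obj X.property) (hRep I A Y.obj Y.property)
      (HSpace.precomp I (dag f.hom.f)) :=
  StarRep.Hom.comm ((hFunctor I A).map (centerDag A f).op)

instance : (covFunctor I A).Faithful where
  map_injective {X Y} f g h := by
    have h1 := congrArg StarRep.toLin h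
    rw [toLin_covFunctor_map, toLin_covFunctor_map] at h1
    have h2 := congrArg (StarRep.conjLin _ _) h1
    rw [StarRep.conjLin_conjLin (isIntertwiner_precomp_dag I A f),
      StarRep.conjLin_conjLin (isIntertwiner_precomp_dag I A g)] at h2
    have h3 : (hFunctor I A).map (centerDag A f).op = (hFunctor I A).map (centerDag A g).op :=
      StarRep.Hom.ext h2
    have h4 := Quiver.Hom.op_inj ((hFunctor I A).map_injective h3)
    rw [← centerDag_centerDag A f, h4, centerDag_centerDag]

instance : (covFunctor I A).Full where
  map_surjective {X Y} T := by
    let T' : (hFunctor I A).obj (Opposite.op X) ⟶ (hFunctor I A).obj (Opposite.op Y) :=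
      StarRep.Hom.mk (StarRep.conjLin _ _ T.lin) (StarRep.isIntertwiner_conjLin _ _ _)
    obtain ⟨g, hg⟩ := (hFunctor I A).map_surjective T'
    refine ⟨centerDag A g.unop, StarRep.Hom.ext ?_⟩
    change StarRep.conjLin _ _ (StarRep.toLin ((hFunctor I A).map
      (centerDag A (centerDag A g.unop)).op)) = _
    rw [centerDag_centerDag, Quiver.Hom.op_unop, hg]
    exact StarRep.conjLin_conjLin T.comm

instance : (covFunctor I A).EssSurj where
  mem_essImage M := ⟨_, ⟨(hFunctor I A).objObjPreimageIso M⟩⟩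

instance : (covFunctor I A).IsEquivalence where

theorem isLinearFunctor_covFunctor : IsLinearFunctor (covFunctor I A) := by
  intro X Y f g k c h
  rw [toLin_covFunctor_map, toLin_covFunctor_map, toLin_covFunctor_map, h]
  have h1 : HSpace.precomp I (dag (f.hom.f + c • g.hom.f)) =
      HSpace.precomp I (dag f.hom.f) + conj c • HSpace.precomp I (dag g.hom.f) := by
    refine LinearMap.ext fun m => HSpace.ext I fun y => ?_
    change dag (f.hom.f + c • g.hom.f) ≫ m y = dag f.hom.f ≫ m y + conj c • (dag g.hom.f ≫ m y)
    rw [dag_add, dag_smul, Preadditive.add_comp, Linear.smul_comp]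
  rw [h1]
  refine ((StarRep.conjLin _ _).map_add _ _).trans ?_
  congr 1
  refine ((StarRep.conjLin _ _).map_smulₛₗ _ _).trans ?_
  rw [Complex.conj_conj]
  rfl

theorem isDaggerFunctor_covFunctor : IsDaggerFunctor (covFunctor I A) := by
  intro X Y f g hg h k
  let S : HSpace I X.obj.1 →ₗ[ℂ] HSpace I Y.obj.1 := HSpace.precomp I (dag f.hom.f)
  have h1 : StarRep.toLin ((covFunctor I A).map g) =
      LinearMap.adjoint (StarRep.conjLin (hRep I A X.obj X.property)
        (hRep I A Y.obj Y.property) S) := by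
    rw [toLin_covFunctor_map, hg, dag_dag, ← HSpace.adjoint_precomp]
    exact StarRep.conjLin_adjoint (isIntertwiner_precomp_dag I A f)
  rw [h1]
  exact LinearMap.adjoint_inner_left (StarRep.conjLin (hRep I A X.obj X.property)
        (hRep I A Y.obj Y.property) S) h k

end Covariant

end

end DomeAlg

theorem mainTheorem1 {C : Type u} [Category.{v} C] [Abelian C] [Linear ℂ C] [MonoidalCategory C]
    [MonoidalPreadditive C] [MonoidalLinear ℂ C] [RigidCategory C] [UnitaryFusionCategory C]
    {ι : Type} [Fintype ι] (I : DomeAlg.SimpleReps C ι)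
    (A : ObjectProperty (Center C)) (hA : DomeAlg.IsBraidedTensorSubcategory A) :
    (∀ X : Center C, DomeAlg.IsUnitary X →
      List.TFAE [
        DomeAlg.enrichedCenter A X,
        ∀ a : Center C, A a → (X.2.β a.1).hom = (a.2.β X.1).inv,
        ∀ a : Center C, A a → DomeAlg.SameMatrixUnits I X a,
        DomeAlg.Descends I A X]) ∧
    (∃ F : (DomeAlg.enrichedCenter A).FullSubcategoryᵒᵖ ⥤ DomeAlg.StarRep (DomeAlg.Dome I A),
      F.IsEquivalence ∧ DomeAlg.IsHFunctor I A F) ∧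
    (∃ G : (DomeAlg.enrichedCenter A).FullSubcategory ⥤ DomeAlg.StarRep (DomeAlg.Dome I A),
      G.IsEquivalence ∧ DomeAlg.IsLinearFunctor G ∧ DomeAlg.IsDaggerFunctor G) := 
  ⟨fun X hX => DomeAlg.enrichedCenter_tfae I A X hX,
    ⟨DomeAlg.hFunctor I A, inferInstance, DomeAlg.isHFunctor_hFunctor I A⟩,
    ⟨DomeAlg.covFunctor I A, inferInstance, DomeAlg.isLinearFunctor_covFunctor I A,
      DomeAlg.isDaggerFunctor_covFunctor I A⟩⟩
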